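/- Let $k$ be a field, $V$ a $k$-vector space (possibly infinite dimensional), $s\ge 2$ an integer, $R$ a subspace of $V^{\otimes s}$, and $A=T(V)/I(R)$ the corresponding $s$-homogeneous algebra, where $I(R)$ is the two-sided ideal generated by $R$; $A=\bigoplus_{n\ge 0}A_n$ is graded by the length of words. For $n\ge 0$ let $J_n=\bigcap_{i+s+j=n}V^{\otimes i}\otimes R\otimes V^{\otimes j}\subseteq V^{\otimes n}$ (so $J_n=V^{\otimes n}$ for $n<s$ and $J_s=R$), and put $n(2j)=js$, $n(2j+1)=js+1$. On $\bigoplus_n A\otimes J_n\otimes A$ let $\delta'_L$ and $\delta'_R$ be the commuting bimodule maps of degree $n\mapsto n-1$ that are induced by the inclusions $J_n\subseteq V\otimes J_{n-1}$ and $J_n\subseteq J_{n-1}\otimes V$, i.e. $\delta'_L(a\otimes vt\otimes b)=av\otimes t\otimes b$ and $\delta'_R(a\otimes tv\otimes b)=a\otimes t\otimes vb$ (and both are $0$ for $n=0$). The bimodule Koszul complex $(K_{L-R},d')$ has the terms $K_{L-R,i}=A\otimes J_{n(i)}\otimes A$ and the differentials $d'_i=\delta'_L-\delta'_R$ for $i$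 odd, $d'_i=\sum_{j=0}^{s-1}(\delta'_L)^{s-1-j}(\delta'_R)^{j}$ for $i\geq 2$ even; it is augmented by the multiplication $A\otimes A\to A$. Then: 1. The augmented bimodule Koszul complex is a complex of graded $A$-bimodules with homogeneous maps of degree $0$, and each $K_{L-R,i}$ is projective and generated in degree $n(i)$. 2. The sequence $A\otimes R\otimes A\xrightarrow{d'_2}A\otimes V\otimes A\xrightarrow{d'_1}A\otimes A\to A\to 0$ is exact. 3. The following are equivalent: (a) $A$ is Koszul, i.e. for every $i\ge 0$ the graded vector space $\mathrm{Tor}_i^A(k,k)$ is concentrated in degree $n(i)$; (b) the left Koszul complex of $A$, with terms $A\otimes J_{n(i)}$ and differentials $\delta_L$ for $i$ odd and $\delta_L^{s-1}$ for $i\geq 2$ even, where $\delta_L(a\otimes vt)=av\otimes t$, is a resolution of the trivial module $k$; (c) the bimodule Koszul complex $(K_{L-R},d')$ is a resolution of $A$ by projective graded bimodules, i.e. its augmented complex is exact. -/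

import Mathlib

open scoped TensorProduct
open MulOpposite (op unop)

namespace HomogKoszul

universe u v w x

/-! ## Splitting off the first and the last letter in a tensor algebra -/

section Letters

variable (k : Type u) [Field k] (M : Type v) [AddCommGroup M] [Module k M]

/-- The `n`-th tensor power of `M`, as a subspace of the tensor algebra. -/
noncomputable def tpow (n : ℕ) : Submodule k (TensorAlgebra k M) :=
  (LinearMap.range (TensorAlgebra.ι k (M := M))) ^ n

/-- Auxiliary: the letter `m` acts on the left by `(t, w) ↦ (m t, m ⊗ t)`. -/
noncomputable def headStep :
    M →ₗ[k] Module.End k (TensorAlgebra k M × (M ⊗[k] TensorAlgebra k M)) :=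
  LinearMap.mk₂ k
    (fun m x => (TensorAlgebra.ι k m * x.1, m ⊗ₜ[k] x.1))
    (fun a b x => by simp [add_mul, TensorProduct.add_tmul])
    (fun c a x => by simp [TensorProduct.smul_tmul'])
    (fun a x y => by simp [mul_add, TensorProduct.tmul_add])
    (fun c a x => by simp)

theorem headStep_apply (m : M) (x : TensorAlgebra k M × (M ⊗[k] TensorAlgebra k M)) :
    headStep k M m x = (TensorAlgebra.ι k m * x.1, m ⊗ₜ[k] x.1) := rfl

/-- Splitting off the first letter: the linear map `T(M) → M ⊗ T(M)` that is `0` on scalars and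
sends `m t` to `m ⊗ t` for `m` in `M` and `t` in `T(M)`. -/
noncomputable def head : TensorAlgebra k M →ₗ[k] M ⊗[k] TensorAlgebra k M :=
  LinearMap.snd k _ _ ∘ₗ LinearMap.applyₗ (1, 0) ∘ₗ
    (TensorAlgebra.lift k (headStep k M)).toLinearMap

/-- Auxiliary: the letter `m` acts on the right by `(t, w) ↦ (t m, t ⊗ m)`. -/
noncomputable def tailStep :
    M →ₗ[k] Module.End k (TensorAlgebra k M × (TensorAlgebra k M ⊗[k] M)) :=
  LinearMap.mk₂ k
    (fun m x => (x.1 * TensorAlgebra.ι k m, x.1 ⊗ₜ[k] m))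
    (fun a b x => by simp [mul_add, TensorProduct.tmul_add])
    (fun c a x => by simp)
    (fun a x y => by simp [add_mul, TensorProduct.add_tmul])
    (fun c a x => by simp [TensorProduct.smul_tmul'])

theorem tailStep_apply (m : M) (x : TensorAlgebra k M × (TensorAlgebra k M ⊗[k] M)) :
    tailStep k M m x = (x.1 * TensorAlgebra.ι k m, x.1 ⊗ₜ[k] m) := rfl

/-- Splitting off the last letter: the linear map `T(M) → T(M) ⊗ M` that is `0` on scalars and
sends `t m` to `t ⊗ m` for `m` in `M` and `t` in `T(M)`. -/
noncomputable def tail : TensorAlgebra k M →ₗ[k] TensorAlgebra k M ⊗[k] M :=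
  LinearMap.snd k _ _ ∘ₗ LinearMap.applyₗ (1, 0) ∘ₗ
    (MulOpposite.opLinearEquiv k).symm.toLinearMap ∘ₗ
    (TensorAlgebra.lift k
      ((MulOpposite.opLinearEquiv k).toLinearMap ∘ₗ tailStep k M)).toLinearMap

theorem head_one : head k M 1 = 0 := by
  simp [head]

theorem tail_one : tail k M 1 = 0 := by
  simp [tail]

theorem head_ι_mul (m : M) (t : TensorAlgebra k M) :
    head k M (TensorAlgebra.ι k m * t) = m ⊗ₜ[k] t := by
  have h : ∀ t : TensorAlgebra k M, ∀ x,
      (TensorAlgebra.lift k (headStep k M) t x).1 = t * x.1 := by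
    intro t
    induction t using TensorAlgebra.induction with
    | algebraMap r => intro x; simp [Algebra.smul_def]
    | ι m => intro x; simp [headStep_apply]
    | mul a b ha hb => intro x; simp [ha, hb, mul_assoc]
    | add a b ha hb => intro x; simp [ha, hb, add_mul]
  have h2 := h t (1, 0)
  simp only [mul_one] at h2
  simp [head, headStep_apply, h2]

theorem tail_mul_ι (m : M) (t : TensorAlgebra k M) :
    tail k M (t * TensorAlgebra.ι k m) = t ⊗ₜ[k] m := by
  have h : ∀ t : TensorAlgebra k M, ∀ x,
      ((TensorAlgebra.lift k ((MulOpposite.opLinearEquiv k).toLinearMap ∘ₗ tailStep k M) t).unop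
        x).1 = x.1 * t := by
    intro t
    induction t using TensorAlgebra.induction with
    | algebraMap r => intro x; simp [Algebra.smul_def, Algebra.commutes]
    | ι m => intro x; simp [tailStep_apply]
    | mul a b ha hb => intro x; simp [ha, hb, mul_assoc]
    | add a b ha hb => intro x; simp [ha, hb, mul_add]
  have h2 := h t (1, 0)
  simp only [one_mul] at h2
  simp [tail, tailStep_apply, h2]

/-- The `B`-linear map `B ⊗ M → N`, `b ⊗ m ↦ b • f m`, that extends a `k`-linear map `f : M → N`. -/
noncomputable def extend {k : Type u} [Field k] (B : Type v) [Ring B] [Algebra k B]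
    {M : Type w} [AddCommGroup M] [Module k M]
    {N : Type x} [AddCommGroup N] [Module k N] [Module B N] [IsScalarTower k B N]
    (f : M →ₗ[k] N) : B ⊗[k] M →ₗ[B] N :=
  TensorProduct.AlgebraTensorModule.lift (LinearMap.toSpanSingleton B (M →ₗ[k] N) f)

theorem extend_tmul {k : Type u} [Field k] (B : Type v) [Ring B] [Algebra k B]
    {M : Type w} [AddCommGroup M] [Module k M]
    {N : Type x} [AddCommGroup N] [Module k N] [Module B N] [IsScalarTower k B N]
    (f : M →ₗ[k] N) (b : B) (m : M) : extend B f (b ⊗ₜ[k] m) = b • f m := by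
  simp [extend]

end Letters

/-! ## Homogeneous algebras

The space of relations is a subspace `R` of `V^{⊗ s}`, which is regarded as a subspace of the tensor
algebra of `V`; so the hypothesis on `R` is `R ≤ tpow k V s`. -/

section Algebra

variable {k : Type u} [Field k] {V : Type v} [AddCommGroup V] [Module k V]

/-- The algebra `A = T(V)/I(R)`, where `I(R)` is the two-sided ideal generated by `R`. -/
def Alg (R : Submodule k (TensorAlgebra k V)) : Type (max u v) :=
  (TwoSidedIdeal.span (R : Set (TensorAlgebra k V))).ringCon.Quotient

variable (R : Submodule k (TensorAlgebra k V))

noncomputable instance : Ring (Alg R) :=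
  inferInstanceAs (Ring (TwoSidedIdeal.span (R : Set (TensorAlgebra k V))).ringCon.Quotient)

noncomputable instance : Algebra k (Alg R) :=
  inferInstanceAs (Algebra k (TwoSidedIdeal.span (R : Set (TensorAlgebra k V))).ringCon.Quotient)

/-- The projection `T(V) → A`. -/
def proj : TensorAlgebra k V →ₐ[k] Alg R where
  toRingHom := (TwoSidedIdeal.span (R : Set (TensorAlgebra k V))).ringCon.mk'
  commutes' _ := rfl

/-- The map `V → A`. -/
noncomputable def gen : V →ₗ[k] Alg R :=
  (proj R).toLinearMap ∘ₗ TensorAlgebra.ι k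

/-- The component `A_n` of degree `n` of `A`. -/
noncomputable def gr (n : ℕ) : Submodule k (Alg R) :=
  (tpow k V n).map (proj R).toLinearMap

/-- The augmentation ideal `A_+`, the sum of all `A_n` with `n ≥ 1`. -/
noncomputable def aug : Submodule k (Alg R) := ⨆ n : ℕ, gr R (n + 1)

theorem gr_mul_gr (p q : ℕ) : gr R p * gr R q = gr R (p + q) := by
  simp only [gr, tpow, pow_add]
  exact (Submodule.map_mul _ _ (proj R)).symm

theorem aug_mul_mem {a b : Alg R} (ha : a ∈ aug R) (hb : b ∈ aug R) : a * b ∈ aug R := by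
  have h : aug R * aug R ≤ aug R := by
    unfold aug
    rw [Submodule.iSup_mul]
    refine iSup_le fun p => ?_
    rw [Submodule.mul_iSup]
    refine iSup_le fun q => ?_
    rw [gr_mul_gr, show p + 1 + (q + 1) = (p + 1 + q) + 1 by omega]
    exact le_iSup (fun n : ℕ => gr R (n + 1)) (p + 1 + q)
  exact h (Submodule.mul_mem_mul ha hb)

/-- The multiplication of the augmentation ideal. -/
noncomputable def augMul : aug R →ₗ[k] aug R →ₗ[k] aug R :=
  LinearMap.mk₂ k (fun a b => ⟨a.1 * b.1, aug_mul_mem R a.2 b.2⟩)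
    (fun a b c => by ext; simp [add_mul])
    (fun c a b => by ext; simp)
    (fun a b c => by ext; simp [mul_add])
    (fun c a b => by ext; simp)

/-! ## The bar complex and Koszulity

`Tor^A(k, k)` is the homology of the reduced bar complex, whose term in homological degree `n` is
`A_+^{⊗ n}`. The direct sum of all its terms is the tensor algebra of the vector space `A_+`. -/

/-- Auxiliary: `(a, a' ⊗ t) ↦ (a a') t`. -/
noncomputable def barContract :
    aug R →ₗ[k] (aug R ⊗[k] TensorAlgebra k (aug R)) →ₗ[k] TensorAlgebra k (aug R) :=
  (TensorProduct.lift.equiv (RingHom.id k) _ _ _).toLinearMap ∘ₗ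
    (augMul R).compr₂ (LinearMap.mul k (TensorAlgebra k (aug R)) ∘ₗ TensorAlgebra.ι k)

theorem barContract_tmul (a b : aug R) (t : TensorAlgebra k (aug R)) :
    barContract R a (b ⊗ₜ[k] t) = TensorAlgebra.ι k (augMul R a b) * t := rfl

/-- Auxiliary: the letter `a` acts by `(t, x) ↦ (a t, a · t - a x)`, where `a · t` denotes the result
of multiplying `a` into the first letter of `t`. -/
noncomputable def barStep :
    aug R →ₗ[k] Module.End k (TensorAlgebra k (aug R) × TensorAlgebra k (aug R)) :=
  LinearMap.mk₂ k
    (fun a x => (TensorAlgebra.ι k a * x.1,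
      barContract R a (head k (aug R) x.1) - TensorAlgebra.ι k a * x.2))
    (fun a b x => by
      ext1
      · simp [add_mul]
      · simp only [map_add, LinearMap.add_apply, add_mul, Prod.mk_add_mk]; abel)
    (fun c a x => by simp [smul_sub])
    (fun a x y => by
      ext1
      · simp [mul_add]
      · simp only [map_add, mul_add, Prod.mk_add_mk, Prod.fst_add, Prod.snd_add]; abel)
    (fun c a x => by simp [smul_sub])

theorem barStep_apply (a : aug R) (x : TensorAlgebra k (aug R) × TensorAlgebra k (aug R)) :
    barStep R a x = (TensorAlgebra.ι k a * x.1,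
      barContract R a (head k (aug R) x.1) - TensorAlgebra.ι k a * x.2) := rfl

/-- The differential of the reduced bar complex,
`[a₁|…|aₙ] ↦ ∑ i, (-1)^(i-1) [a₁|…|aᵢ aᵢ₊₁|…|aₙ]`. It is determined by the three equations
`barD_one`, `barD_ι` and `barD_ι_mul_ι_mul`. -/
noncomputable def barD : TensorAlgebra k (aug R) →ₗ[k] TensorAlgebra k (aug R) :=
  LinearMap.snd k _ _ ∘ₗ LinearMap.applyₗ (1, 0) ∘ₗ
    (TensorAlgebra.lift k (barStep R)).toLinearMap

theorem barD_one : barD R 1 = 0 := by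
  simp [barD]

theorem barD_ι_mul (a : aug R) (t : TensorAlgebra k (aug R)) :
    barD R (TensorAlgebra.ι k a * t) =
      barContract R a (head k (aug R) t) - TensorAlgebra.ι k a * barD R t := by
  have h : ∀ t : TensorAlgebra k (aug R), ∀ x,
      (TensorAlgebra.lift k (barStep R) t x).1 = t * x.1 := by
    intro t
    induction t using TensorAlgebra.induction with
    | algebraMap r => intro x; simp [Algebra.smul_def]
    | ι m => intro x; simp [barStep_apply]
    | mul a b ha hb => intro x; simp [ha, hb, mul_assoc]
    | add a b ha hb => intro x; simp [ha, hb, add_mul]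
  have h2 := h t (1, 0)
  simp only [mul_one] at h2
  simp [barD, barStep_apply, h2]

theorem barD_ι (a : aug R) : barD R (TensorAlgebra.ι k a) = 0 := by
  have := barD_ι_mul R a 1
  simpa [head_one, barD_one] using this

theorem barD_ι_mul_ι_mul (a b : aug R) (t : TensorAlgebra k (aug R)) :
    barD R (TensorAlgebra.ι k a * (TensorAlgebra.ι k b * t)) =
      TensorAlgebra.ι k (augMul R a b) * t
        - TensorAlgebra.ι k a * barD R (TensorAlgebra.ι k b * t) := by
  rw [barD_ι_mul, head_ι_mul]
  rw [barContract_tmul]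

/-- The part of internal degree `m` of the term `A_+^{⊗ n}` of the bar complex: it is spanned by the
`[a₁|…|aₙ]` whose entries are homogeneous of degrees adding up to `m`. -/
noncomputable def barPiece : ℕ → ℕ → Submodule k (TensorAlgebra k (aug R))
  | 0, m => if m = 0 then 1 else ⊥
  | n + 1, m => ⨆ (p : ℕ) (q : ℕ) (_ : p + q = m),
      (((gr R p).comap (aug R).subtype).map (TensorAlgebra.ι k)) * barPiece n q

/-- The graded vector space `Tor_n^A(k, k)` vanishes outside degree `m₀`. -/
def TorConcentrated (n m₀ : ℕ) : Prop :=
  ∀ m, m ≠ m₀ →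
    barPiece R n m ⊓ LinearMap.ker (barD R) ≤ (barPiece R (n + 1) m).map (barD R)

/-- The degree in which the `i`-th term of a Koszul complex is generated: `js` if `i = 2j` and
`js + 1` if `i = 2j + 1`. -/
def koszulDegree (s i : ℕ) : ℕ := i / 2 * s + i % 2

/-- The `s`-homogeneous algebra `A = T(V)/I(R)` is Koszul: for every `i`, the graded vector space
`Tor_i^A(k, k)` is concentrated in degree `js` if `i = 2j` and in degree `js + 1` if
`i = 2j + 1`. -/
def IsKoszul (s : ℕ) : Prop := ∀ i, TorConcentrated R i (koszulDegree s i)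

/-! ## The Koszul complexes -/

/-- The subspace `J_n` of `V^{⊗ n}`: the intersection of the `V^{⊗ i} ⊗ R ⊗ V^{⊗ j}` with
`i + s + j = n`. It is all of `V^{⊗ n}` if `n < s`. -/
noncomputable def J (s n : ℕ) : Submodule k (TensorAlgebra k V) :=
  tpow k V n ⊓ ⨅ (i : ℕ) (j : ℕ) (_ : i + s + j = n), tpow k V i * R * tpow k V j

/-- The map `δ_L` on `A ⊗ T(V)`, `a ⊗ v t ↦ a v ⊗ t` and `a ⊗ 1 ↦ 0`. It is `A`-linear, and its
restriction `A ⊗ J_n → A ⊗ J_{n-1}` is defined by the inclusion of `J_n` in `V ⊗ J_{n-1}`. -/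
noncomputable def leftδ : Module.End (Alg R) (Alg R ⊗[k] TensorAlgebra k V) :=
  extend (Alg R) (TensorProduct.map (gen R) LinearMap.id ∘ₗ head k V)

theorem leftδ_apply (a : Alg R) (v : V) (t : TensorAlgebra k V) :
    leftδ R (a ⊗ₜ[k] (TensorAlgebra.ι k v * t)) = (a * gen R v) ⊗ₜ[k] t := by
  simp [leftδ, extend_tmul, head_ι_mul, TensorProduct.smul_tmul']

theorem leftδ_apply_one (a : Alg R) : leftδ R (a ⊗ₜ[k] 1) = 0 := by
  simp [leftδ, extend_tmul, head_one]

/-- The differential `d_i : A ⊗ J_{n(i)} → A ⊗ J_{n(i-1)}` of the left Koszul complex, where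
`n(2j) = js` and `n(2j+1) = js + 1`. -/
noncomputable def leftD (s i : ℕ) : Module.End (Alg R) (Alg R ⊗[k] TensorAlgebra k V) :=
  if Odd i then leftδ R else leftδ R ^ (s - 1)

/-- The `i`-th term `A ⊗ J_{n(i)}` of the left Koszul complex, as a submodule of `A ⊗ T(V)`. -/
noncomputable def leftK (s i : ℕ) : Submodule (Alg R) (Alg R ⊗[k] TensorAlgebra k V) :=
  (J R s (koszulDegree s i)).baseChange (Alg R)

/-- The left Koszul complex is a resolution of the trivial module `k = A/A_+`: in degree `0` the
image of the differential is `A_+`, and in positive degrees the complex is exact. -/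
structure IsLeftKoszulResolution (s : ℕ) : Prop where
  exact_zero : ∀ x, x ∈ (leftK R s 1).map (leftD R s 1) ↔
    ∃ a ∈ aug R, x = a ⊗ₜ[k] (1 : TensorAlgebra k V)
  exact_succ : ∀ i, (leftK R s (i + 2)).map (leftD R s (i + 2)) =
    leftK R s (i + 1) ⊓ LinearMap.ker (leftD R s (i + 1))

/-- The enveloping algebra `A ⊗ Aᵒᵖ`; `A`-`A`-bimodules, on which `k` acts centrally, are its left
modules. -/
def Env : Type (max u v) := Alg R ⊗[k] (Alg R)ᵐᵒᵖ

noncomputable instance : Ring (Env R) := inferInstanceAs (Ring (Alg R ⊗[k] (Alg R)ᵐᵒᵖ))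

noncomputable instance : Algebra k (Env R) := inferInstanceAs (Algebra k (Alg R ⊗[k] (Alg R)ᵐᵒᵖ))

/-- The algebra map `A → A ⊗ Aᵒᵖ`, `a ↦ a ⊗ 1`. -/
noncomputable def envLeft : Alg R →ₐ[k] Env R :=
  (Algebra.TensorProduct.includeLeft : Alg R →ₐ[k] Alg R ⊗[k] (Alg R)ᵐᵒᵖ)

/-- The algebra map `Aᵒᵖ → A ⊗ Aᵒᵖ`, `b ↦ 1 ⊗ b`. -/
noncomputable def envRight : (Alg R)ᵐᵒᵖ →ₐ[k] Env R :=
  (Algebra.TensorProduct.includeRight : (Alg R)ᵐᵒᵖ →ₐ[k] Alg R ⊗[k] (Alg R)ᵐᵒᵖ)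

/-- The element `a ⊗ op b` of the enveloping algebra; it acts on a bimodule by `x ↦ a x b`. -/
noncomputable def env (a b : Alg R) : Env R :=
  (a ⊗ₜ[k] op b : Alg R ⊗[k] (Alg R)ᵐᵒᵖ)

theorem env_mul_envLeft (a b c : Alg R) : env R a b * envLeft R c = env R (a * c) b := by
  have h : (a ⊗ₜ[k] op b : Alg R ⊗[k] (Alg R)ᵐᵒᵖ) * (c ⊗ₜ[k] 1) = (a * c) ⊗ₜ[k] op b := by simp
  exact h

theorem env_mul_envRight (a b c : Alg R) : env R a b * envRight R (op c) = env R a (c * b) := by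
  have h : (a ⊗ₜ[k] op b : Alg R ⊗[k] (Alg R)ᵐᵒᵖ) * (1 ⊗ₜ[k] op c) = a ⊗ₜ[k] op (c * b) := by simp
  exact h

/-- The action of the enveloping algebra on the unit of `A`: `a ⊗ op b ↦ a b`. -/
noncomputable def envToAlg : Env R →ₗ[k] Alg R :=
  (LinearMap.applyₗ (1 : Alg R) ∘ₗ (AlgHom.mulLeftRight k (Alg R)).toLinearMap :
    Alg R ⊗[k] (Alg R)ᵐᵒᵖ →ₗ[k] Alg R)

theorem envToAlg_env (a b : Alg R) : envToAlg R (env R a b) = a * b := by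
  change AlgHom.mulLeftRight k (Alg R) (a ⊗ₜ[k] op b) 1 = a * b
  simp

/-- The bimodule `A ⊗ T(V) ⊗ A`, written as `(A ⊗ Aᵒᵖ) ⊗ T(V)`: the element `a ⊗ t ⊗ b` is
`env R a b ⊗ t`. -/
abbrev Bimod : Type (max u v) := Env R ⊗[k] TensorAlgebra k V

/-- The bimodule map `δ'_L = δ_L ⊗ 1`: `a ⊗ v t ⊗ b ↦ a v ⊗ t ⊗ b` and `a ⊗ 1 ⊗ b ↦ 0`. -/
noncomputable def δL : Module.End (Env R) (Bimod R) :=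
  extend (Env R)
    (TensorProduct.map ((envLeft R).toLinearMap ∘ₗ gen R) LinearMap.id ∘ₗ head k V)

/-- The bimodule map `δ'_R = 1 ⊗ δ_R`: `a ⊗ t v ⊗ b ↦ a ⊗ t ⊗ v b` and `a ⊗ 1 ⊗ b ↦ 0`. -/
noncomputable def δR : Module.End (Env R) (Bimod R) :=
  extend (Env R)
    (TensorProduct.map
        ((envRight R).toLinearMap ∘ₗ (MulOpposite.opLinearEquiv k).toLinearMap ∘ₗ gen R)
        LinearMap.id ∘ₗ
      (TensorProduct.comm k (TensorAlgebra k V) V).toLinearMap ∘ₗ tail k V)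

theorem δL_apply (a b : Alg R) (v : V) (t : TensorAlgebra k V) :
    δL R (env R a b ⊗ₜ[k] (TensorAlgebra.ι k v * t)) = env R (a * gen R v) b ⊗ₜ[k] t := by
  simp [δL, extend_tmul, head_ι_mul, TensorProduct.smul_tmul', env_mul_envLeft]

theorem δL_apply_one (e : Env R) : δL R (e ⊗ₜ[k] 1) = 0 := by
  simp [δL, extend_tmul, head_one]

theorem δR_apply (a b : Alg R) (v : V) (t : TensorAlgebra k V) :
    δR R (env R a b ⊗ₜ[k] (t * TensorAlgebra.ι k v)) = env R a (gen R v * b) ⊗ₜ[k] t := by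
  simp [δR, extend_tmul, tail_mul_ι, TensorProduct.smul_tmul', env_mul_envRight]

theorem δR_apply_one (e : Env R) : δR R (e ⊗ₜ[k] 1) = 0 := by
  simp [δR, extend_tmul, tail_one]

/-- The differential `d'_i` of the bimodule Koszul complex. -/
noncomputable def bimodD (s i : ℕ) : Module.End (Env R) (Bimod R) :=
  if Odd i then δL R - δR R
  else ∑ j ∈ Finset.range s, δL R ^ (s - 1 - j) * δR R ^ j

/-- The `i`-th term `A ⊗ J_{n(i)} ⊗ A` of the bimodule Koszul complex, as a sub-bimodule of
`A ⊗ T(V) ⊗ A`. -/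
noncomputable def bimodK (s i : ℕ) : Submodule (Env R) (Bimod R) :=
  (J R s (koszulDegree s i)).baseChange (Env R)

/-- The map `A ⊗ T(V) ⊗ A → A`, `a ⊗ t ⊗ b ↦ ε(t) a b`, where `ε(t)` is the constant term of `t`. On
`A ⊗ J_0 ⊗ A = A ⊗ k ⊗ A` it is the multiplication of `A`, the augmentation of the complex. -/
noncomputable def bimodAug : Bimod R →ₗ[k] Alg R :=
  (TensorProduct.rid k (Alg R)).toLinearMap ∘ₗ
    TensorProduct.map (envToAlg R)
      (TensorAlgebra.algebraMapInv (R := k) (M := V)).toLinearMap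

theorem bimodAug_apply (a b : Alg R) (c : k) :
    bimodAug R (env R a b ⊗ₜ[k] algebraMap k _ c) = c • (a * b) := by
  simp [bimodAug, envToAlg_env]

/-- The component of total degree `m` of `A ⊗ T(V) ⊗ A`. -/
noncomputable def bimodGr (m : ℕ) : Submodule k (Bimod R) :=
  Submodule.span k {x | ∃ p n q, p + n + q = m ∧
    ∃ a ∈ gr R p, ∃ t ∈ tpow k V n, ∃ b ∈ gr R q, x = env R a b ⊗ₜ[k] t}

/-- The bimodule Koszul complex together with its augmentation is a complex of graded bimodules, with
differentials that are homogeneous of degree `0`, whose `i`-th term is projective and generated in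
degree `js` if `i = 2j` and in degree `js + 1` if `i = 2j + 1`. (The differentials are linear over
the enveloping algebra by construction.) -/
structure IsPureProjectiveComplex (s : ℕ) : Prop where
  /-- `A` is a graded algebra. -/
  alg_isInternal : DirectSum.IsInternal (gr R)
  /-- Each term is the direct sum of its homogeneous components. -/
  isInternal : ∀ i, DirectSum.IsInternal fun m =>
    (bimodGr R m).comap (((bimodK R s i).restrictScalars k).subtype)
  smul_mem : ∀ p q m, ∀ a ∈ gr R p, ∀ b ∈ gr R q, ∀ x ∈ bimodGr R m,
    env R a b • x ∈ bimodGr R (p + m + q)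
  projective : ∀ i, Module.Projective (Env R) (bimodK R s i)
  pure : ∀ i, Submodule.span (Env R)
    {x | x ∈ bimodK R s i ∧ x ∈ bimodGr R (koszulDegree s i)} = bimodK R s i
  map_le : ∀ i, (bimodK R s (i + 1)).map (bimodD R s (i + 1)) ≤ bimodK R s i
  map_gr : ∀ i m, ∀ x ∈ bimodK R s (i + 1), x ∈ bimodGr R m →
    bimodD R s (i + 1) x ∈ bimodGr R m
  comp_eq_zero : ∀ i, ∀ x ∈ bimodK R s (i + 2), bimodD R s (i + 1) (bimodD R s (i + 2) x) = 0
  aug_smul : ∀ (a b : Alg R) (x : Bimod R),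
    bimodAug R (env R a b • x) = a * bimodAug R x * b
  aug_gr : ∀ m, ∀ x ∈ bimodGr R m, bimodAug R x ∈ gr R m
  aug_comp_eq_zero : ∀ x ∈ bimodK R s 1, bimodAug R (bimodD R s 1 x) = 0

/-- The sequence `A ⊗ J_s ⊗ A → A ⊗ V ⊗ A → A ⊗ A → A → 0` with which the augmented bimodule Koszul
complex begins is exact (note that `J_s = R`). -/
structure IsExactInLowDegrees (s : ℕ) : Prop where
  surjective : ∀ a : Alg R, ∃ x ∈ bimodK R s 0, bimodAug R x = a
  exact_zero : ∀ x ∈ bimodK R s 0, bimodAug R x = 0 ↔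
    ∃ y ∈ bimodK R s 1, bimodD R s 1 y = x
  exact_one : ∀ x ∈ bimodK R s 1, bimodD R s 1 x = 0 ↔
    ∃ y ∈ bimodK R s 2, bimodD R s 2 y = x

/-- The augmented bimodule Koszul complex is an exact complex of graded bimodules with projective
terms, that is, the bimodule Koszul complex is a resolution of `A` by projective graded bimodules. -/
structure IsBimoduleKoszulResolution (s : ℕ) : Prop extends IsPureProjectiveComplex R s where
  surjective : ∀ a : Alg R, ∃ x ∈ bimodK R s 0, bimodAug R x = a
  exact_zero : ∀ x ∈ bimodK R s 0, bimodAug R x = 0 ↔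
    ∃ y ∈ bimodK R s 1, bimodD R s 1 y = x
  exact_succ : ∀ i, ∀ x ∈ bimodK R s (i + 1), bimodD R s (i + 1) x = 0 ↔
    ∃ y ∈ bimodK R s (i + 2), bimodD R s (i + 2) y = x

end Algebra

end HomogKoszul

/-! Everything is reduced to one condition, `LeftExact R s (i + 1)` for all `i`: the left Koszul
complex is exact in positive homological degrees. At their ends both complexes behave well for every
`A`. In particular the image of the first left differential is `A_+`, and exactness at `A ⊗ V` only
says that `R` generates the ideal of relations (`leftExact_one`).

Koszulity (`isKoszul_iff_leftExact`): the bar complex with coefficients in `K` computes `Tor^A(k,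
K)`, and it is contractible in positive degrees if `K = A ⊗ J_n`. Let `B_i` be the image of
`d_{i+1}` and `Z_i` the kernel of `d_i`. Dimension shifting gives `Tor_{j+i+1}(k, k) = Tor_j(k,
B_i)` as long as the left complex is exact at the terms `1, …, i`, and minimality gives `Tor_1(k,
B_i) = Z_{i+1} / A_+ Z_{i+1}`. If the complex is exact, then `Tor_{i+1}(k, k) = B_i / A_+ B_i` sits
in degree `n(i+1)`, because `B_i` is an image of `A ⊗ J_{n(i+1)}`. Conversely, if `Tor_{i+2}(k, k)`
is concentrated in degree `n(i+2)`, then graded Nakayama shows that `Z_{i+1}` is generated in that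
degree, where cycles are boundaries (`exists_leftD_eq_of_degree`): such a cycle comes from a `w` in
`V^{⊗r} ⊗ J_{n(i+1)}` that also lies in `R ⊗ V^{⊗…}`, and `w` belongs to `J_{n(i+2)}`. If `r = s -
1`, the intermediate positions of `R` are supplied by the extra condition
`mul_inf_mul_le_of_add_eq`, a consequence of exactness at the second term.

Bimodules: `d'd' = 0` holds because the product of two consecutive differentials is `δ_L^s - δ_R^s`.
In the filtration by the degree of the first two factors, `δ_L` preserves and `δ_R` lowers the
degree, so the leading part of `d'` is the left differential tensored with the right factor. Hence
left exactness at a term implies exactness there of every subcomplex `A ⊗ J ⊗ B` with `B` a left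
ideal (`exists_bimodD_eq`). Conversely, augmenting the right factor maps the bimodule complex onto
the left one with kernel `A ⊗ J ⊗ A_+`, and a diagram chase, inductive in the term, returns left
exactness (`LeftExact.succ`). -/

namespace HomogKoszul

universe u v w x

/-! ### Graded vector spaces, their tensor products and tensor algebras -/

section Grading

/-- A decomposition of a vector space into homogeneous components, given by the projections. -/
structure Grading (k : Type u) [Field k] (M : Type v) [AddCommGroup M] [Module k M] where
  π : ℕ → Module.End k M
  orth : ∀ i j x, π i (π j x) = if i = j then π j x else 0
  span : ∀ x, x ∈ ⨆ i, LinearMap.range (π i)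

variable {k : Type u} [Field k] {M : Type v} [AddCommGroup M] [Module k M]
  {N : Type w} [AddCommGroup N] [Module k N]

namespace Grading

variable (g : Grading k M) (h : Grading k N)

theorem idem (i : ℕ) (x : M) : g.π i (g.π i x) = g.π i x := by simp [g.orth]

theorem π_eq_zero {i j : ℕ} {x : M} (hx : g.π j x = x) (hij : i ≠ j) : g.π i x = 0 := by
  rw [← hx, g.orth, if_neg hij]

theorem π_eq_ite {j : ℕ} {x : M} (hx : g.π j x = x) (i : ℕ) :
    g.π i x = if i = j then x else 0 := by
  split_ifs with hij
  · rw [hij, hx]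
  · exact g.π_eq_zero hx hij

theorem induction {p : M → Prop} (zero : p 0) (add : ∀ x y, p x → p y → p (x + y))
    (hom : ∀ i x, g.π i x = x → p x) (x : M) : p x := by
  refine Submodule.iSup_induction (motive := p) _ (g.span x) ?_ zero add
  rintro i _ ⟨y, rfl⟩
  exact hom i _ (g.idem i y)

theorem sum_π (x : M) : ∃ n, ∀ m, n ≤ m → ∑ i ∈ Finset.range m, g.π i x = x := by
  induction x using g.induction with
  | zero => exact ⟨0, fun m _ => by simp⟩
  | add x y hx hy =>
    obtain ⟨a, ha⟩ := hx
    obtain ⟨b, hb⟩ := hy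
    refine ⟨max a b, fun m hm => ?_⟩
    simp only [map_add, Finset.sum_add_distrib]
    rw [ha m (le_trans (le_max_left _ _) hm), hb m (le_trans (le_max_right _ _) hm)]
  | hom i x hx =>
    refine ⟨i + 1, fun m hm => ?_⟩
    rw [Finset.sum_eq_single i]
    · exact hx
    · intro j _ hj
      exact g.π_eq_zero hx hj
    · intro hi
      exact absurd (Finset.mem_range.2 hm) hi

theorem mem_of_π_mem (K : Submodule k M) {x : M} (hx : ∀ i, g.π i x ∈ K) : x ∈ K := by
  obtain ⟨n, hn⟩ := g.sum_π x
  rw [← hn n le_rfl]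
  exact Submodule.sum_mem _ fun i _ => hx i

/-- Provides the top degree from which the induction in `exists_bimodD_eq` descends. -/
theorem exists_π_eq_zero (x : M) : ∃ n, ∀ m, n ≤ m → g.π m x = 0 := by
  obtain ⟨n, hn⟩ := g.sum_π x
  refine ⟨n, fun m hm => ?_⟩
  rw [← hn n le_rfl, map_sum]
  refine Finset.sum_eq_zero fun i hi => ?_
  rw [g.orth, if_neg]
  have := Finset.mem_range.1 hi
  omega

/-- A subspace that is stable under the projections is the direct sum of its components. -/
theorem isInternal {W : Type x} [AddCommGroup W] [Module k W] {f : W →ₗ[k] M}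
    (hf : Function.Injective f) (hK : ∀ i w, ∃ w', f w' = g.π i (f w)) (P : ℕ → Submodule k W)
    (hP : ∀ i w, w ∈ P i ↔ g.π i (f w) = f w) : DirectSum.IsInternal P := by
  rw [DirectSum.isInternal_submodule_iff_iSupIndep_and_iSup_eq_top]
  constructor
  · rw [iSupIndep_def]
    intro i
    rw [Submodule.disjoint_def]
    intro x hx hx'
    have h0 : g.π i (f x) = 0 := by
      have hle : (⨆ (j : ℕ) (_ : j ≠ i), P j) ≤ LinearMap.ker (g.π i ∘ₗ f) := by
        refine iSup_le fun j => iSup_le fun hj y hy => ?_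
        rw [LinearMap.mem_ker]
        exact g.π_eq_zero ((hP j y).1 hy) hj.symm
      exact hle hx'
    rw [(hP i x).1 hx] at h0
    exact (map_eq_zero_iff f hf).1 h0
  · rw [eq_top_iff]
    rintro x -
    choose p hp using hK
    obtain ⟨n, hn⟩ := g.sum_π (f x)
    have : x = ∑ i ∈ Finset.range n, p i x := by
      apply hf
      rw [map_sum]
      exact (hn n le_rfl).symm.trans (Finset.sum_congr rfl fun i _ => (hp i x).symm)
    rw [this]
    refine Submodule.sum_mem _ fun i _ => ?_
    refine Submodule.mem_iSup_of_mem i ?_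
    rw [hP, hp]
    exact g.idem i _

/-- The transport of a grading along an isomorphism. -/
def ofEquiv (e : M ≃ₗ[k] N) : Grading k N where
  π i := e.toLinearMap ∘ₗ g.π i ∘ₗ e.symm.toLinearMap
  orth i j x := by
    simp only [LinearMap.comp_apply, LinearEquiv.coe_coe, LinearEquiv.symm_apply_apply, g.orth]
    split_ifs
    · rfl
    · exact map_zero e
  span x := by
    obtain ⟨y, rfl⟩ := e.surjective x
    induction y using g.induction with
    | zero => rw [map_zero]; exact zero_mem _
    | add x y hx hy => rw [map_add]; exact add_mem hx hy
    | hom i y hy => exact Submodule.mem_iSup_of_mem i ⟨e y, by simp [hy]⟩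

theorem ofEquiv_apply (e : M ≃ₗ[k] N) (i : ℕ) (x : M) :
    (g.ofEquiv e).π i (e x) = e (g.π i x) := by
  simp [ofEquiv]

section Bilinear

variable {L : Type x} [AddCommGroup L] [Module k L] (β : M →ₗ[k] N →ₗ[k] L)
  (pM : ℕ → Module.End k M) (pN : ℕ → Module.End k N) (p : ℕ → Module.End k L)
  (hp : ∀ m x y, p m (β x y) =
    ∑ q ∈ Finset.HasAntidiagonal.antidiagonal m, β (pM q.1 x) (pN q.2 y))

include hp

/-- An arbitrary bilinear map is allowed so that the argument serves both tensor products and the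
product of a letter with a word. Orthogonality is required only at the given `x` and `y`, because in
the tensor algebra it is an induction hypothesis on the word. -/
theorem _root_.HomogKoszul.bilinear_orth {x : M} {y : N}
    (hx : ∀ i j, pM i (pM j x) = if i = j then pM j x else 0)
    (hy : ∀ i j, pN i (pN j y) = if i = j then pN j y else 0) (i j : ℕ) :
    p i (p j (β x y)) = if i = j then p j (β x y) else 0 := by
  simp only [hp, map_sum, hx, hy]
  split_ifs with hij
  · subst hij
    refine Finset.sum_congr rfl fun q hq => ?_
    rw [Finset.sum_eq_single q]
    · simp
    · intro p hp hpq
      by_cases h1 : p.1 = q.1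
      · have h2 : p.2 ≠ q.2 := fun h2 => hpq (Prod.ext h1 h2)
        simp [h2]
      · simp [h1]
    · intro hq'
      exact absurd hq hq'
  · refine Finset.sum_eq_zero fun q hq => Finset.sum_eq_zero fun p hp => ?_
    rw [Finset.HasAntidiagonal.mem_antidiagonal] at hp hq
    by_cases h1 : p.1 = q.1
    · have h2 : p.2 ≠ q.2 := by omega
      simp [h2]
    · simp [h1]

theorem _root_.HomogKoszul.bilinear_right {j : ℕ} {y : N}
    (hy : ∀ i, pN i y = if i = j then y else 0) (m : ℕ) (x : M) :
    p (m + j) (β x y) = β (pM m x) y := by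
  rw [hp, Finset.sum_eq_single (m, j)]
  · rw [hy, if_pos rfl]
  · rintro ⟨a, b⟩ hp hpq
    have h2 : b ≠ j := by
      rintro rfl
      rw [Finset.HasAntidiagonal.mem_antidiagonal] at hp
      exact hpq (Prod.ext (Nat.add_right_cancel hp) rfl)
    rw [hy, if_neg h2, map_zero]
  · intro hn
    simp at hn

/-- Complements `bilinear_right`, so that all degrees are covered without truncated subtraction. -/
theorem _root_.HomogKoszul.bilinear_right_of_lt {j : ℕ} {y : N}
    (hy : ∀ i, pN i y = if i = j then y else 0) {m : ℕ} (hm : m < j) (x : M) :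
    p m (β x y) = 0 := by
  rw [hp]
  refine Finset.sum_eq_zero fun q hq => ?_
  rw [Finset.HasAntidiagonal.mem_antidiagonal] at hq
  rw [hy, if_neg (by omega), map_zero]

end Bilinear

/-- The tensor product of two gradings. -/
noncomputable def tensor : Grading k (M ⊗[k] N) where
  π m := ∑ p ∈ Finset.HasAntidiagonal.antidiagonal m, TensorProduct.map (g.π p.1) (h.π p.2)
  orth i j x := by
    induction x with
    | zero => simp
    | add x y hx hy =>
      rw [map_add, map_add, hx, hy]
      split_ifs
      · rfl
      · exact add_zero 0
    | tmul x y =>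
      exact bilinear_orth (TensorProduct.mk k M N) g.π h.π
        (fun m => ∑ p ∈ Finset.HasAntidiagonal.antidiagonal m,
          TensorProduct.map (g.π p.1) (h.π p.2))
        (by simp) (fun i j => g.orth i j x) (fun i j => h.orth i j y) i j
  span x := by
    induction x with
    | zero => exact zero_mem _
    | add x y hx hy => exact add_mem hx hy
    | tmul x y =>
      induction x using g.induction with
      | zero => rw [TensorProduct.zero_tmul]; exact zero_mem _
      | add x x' hx hy => rw [TensorProduct.add_tmul]; exact add_mem hx hy
      | hom i x hx =>
        induction y using h.induction with
        | zero => rw [TensorProduct.tmul_zero]; exact zero_mem _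
        | add x x' hx hy => rw [TensorProduct.tmul_add]; exact add_mem hx hy
        | hom j y hy =>
          refine Submodule.mem_iSup_of_mem (i + j) ⟨x ⊗ₜ y, ?_⟩
          have := bilinear_right (TensorProduct.mk k M N) g.π h.π
            (fun m => ∑ p ∈ Finset.HasAntidiagonal.antidiagonal m,
              TensorProduct.map (g.π p.1) (h.π p.2)) (by simp) (h.π_eq_ite hy) i x
          rw [hx] at this
          exact this

theorem tensor_tmul (m : ℕ) (x : M) (y : N) : (g.tensor h).π m (x ⊗ₜ y) =
    ∑ p ∈ Finset.HasAntidiagonal.antidiagonal m, g.π p.1 x ⊗ₜ[k] h.π p.2 y := by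
  simp [tensor]

theorem tensor_tmul_right {j : ℕ} {y : N} (hy : h.π j y = y) (m : ℕ) (x : M) :
    (g.tensor h).π (m + j) (x ⊗ₜ y) = g.π m x ⊗ₜ y :=
  bilinear_right (TensorProduct.mk k M N) g.π h.π _ (g.tensor_tmul h) (h.π_eq_ite hy) m x

theorem tensor_tmul_right_of_lt {j : ℕ} {y : N} (hy : h.π j y = y) {m : ℕ} (hm : m < j) (x : M) :
    (g.tensor h).π m (x ⊗ₜ y) = 0 :=
  bilinear_right_of_lt (TensorProduct.mk k M N) g.π h.π _ (g.tensor_tmul h) (h.π_eq_ite hy) hm x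

theorem tensor_tmul_hom {i j : ℕ} {x : M} {y : N} (hx : g.π i x = x) (hy : h.π j y = y) :
    (g.tensor h).π (i + j) (x ⊗ₜ y) = x ⊗ₜ y := by
  rw [g.tensor_tmul_right h hy, hx]

/-- The grading of a graded vector space that is concentrated in degree `n`. -/
noncomputable def pure (n : ℕ) : Grading k M where
  π i := if i = n then LinearMap.id else 0
  orth i j x := by
    split_ifs <;> simp_all
  span x := Submodule.mem_iSup_of_mem n ⟨x, by simp⟩

theorem pure_π (n i : ℕ) (x : M) :
    (pure n : Grading k M).π i x = if i = n then x else 0 := by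
  simp only [pure]
  split_ifs <;> rfl

/-- Auxiliary: the algebra map `T(M) → T(M)⟦X⟧` that sends a homogeneous `x` in `M` to `x X^i`. -/
noncomputable def tensorAlgebraHom : TensorAlgebra k M →ₐ[k] PowerSeries (TensorAlgebra k M) :=
  TensorAlgebra.lift k
    { toFun := fun x => PowerSeries.mk fun i => TensorAlgebra.ι k (g.π i x)
      map_add' := fun x y => by ext i; simp
      map_smul' := fun c x => by ext i; simp }

/-- The grading of the tensor algebra of a graded vector space. -/
noncomputable def tensorAlgebraπ (m : ℕ) : Module.End k (TensorAlgebra k M) :=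
  (PowerSeries.coeff m).restrictScalars k ∘ₗ g.tensorAlgebraHom.toLinearMap

/-- The projections are the coefficients of an algebra map into power series, so this is the Cauchy
product. -/
theorem tensorAlgebraπ_mul (m : ℕ) (x y : TensorAlgebra k M) : g.tensorAlgebraπ m (x * y) =
    ∑ q ∈ Finset.HasAntidiagonal.antidiagonal m,
      g.tensorAlgebraπ q.1 x * g.tensorAlgebraπ q.2 y := by
  simp [tensorAlgebraπ, PowerSeries.coeff_mul]

theorem tensorAlgebraπ_ι (m : ℕ) (x : M) :
    g.tensorAlgebraπ m (TensorAlgebra.ι k x) = TensorAlgebra.ι k (g.π m x) := by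
  simp [tensorAlgebraπ, tensorAlgebraHom]

theorem tensorAlgebraπ_one (m : ℕ) :
    g.tensorAlgebraπ m (1 : TensorAlgebra k M) = if m = 0 then 1 else 0 := by
  simp [tensorAlgebraπ, PowerSeries.coeff_one]

/-- The induction principle for `T(M)` along words. -/
theorem _root_.HomogKoszul.word_induction {p : TensorAlgebra k M → Prop} (one : p 1)
    (smul : ∀ (c : k) t, p t → p (c • t))
    (add : ∀ s t, p s → p t → p (s + t)) (ι_mul : ∀ x t, p t → p (TensorAlgebra.ι k x * t))
    (t : TensorAlgebra k M) : p t := by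
  have h : ∀ t u : TensorAlgebra k M, p u → p (t * u) := by
    intro t
    induction t using TensorAlgebra.induction with
    | algebraMap r => intro u hu; rw [← Algebra.smul_def]; exact smul r u hu
    | ι m => intro u hu; exact ι_mul m u hu
    | mul a b ha hb => intro u hu; rw [mul_assoc]; exact ha _ (hb _ hu)
    | add a b ha hb => intro u hu; rw [add_mul]; exact add _ _ (ha _ hu) (hb _ hu)
  simpa using h t 1 one

/-- The induction principle for `T(M)` along words, from the right. -/
theorem _root_.HomogKoszul.word_induction_right {p : TensorAlgebra k M → Prop} (one : p 1)
    (smul : ∀ (c : k) t, p t → p (c • t))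
    (add : ∀ s t, p s → p t → p (s + t)) (mul_ι : ∀ x t, p t → p (t * TensorAlgebra.ι k x))
    (t : TensorAlgebra k M) : p t := by
  have h : ∀ t u : TensorAlgebra k M, p u → p (u * t) := by
    intro t
    induction t using TensorAlgebra.induction with
    | algebraMap r =>
      intro u hu; rw [← Algebra.commutes, ← Algebra.smul_def]; exact smul r u hu
    | ι m => intro u hu; exact mul_ι m u hu
    | mul a b ha hb => intro u hu; rw [← mul_assoc]; exact hb _ (ha _ hu)
    | add a b ha hb => intro u hu; rw [mul_add]; exact add _ _ (ha _ hu) (hb _ hu)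
  simpa using h t 1 one

theorem tensorAlgebraπ_ι_mul (m : ℕ) (x : M) (t : TensorAlgebra k M) :
    g.tensorAlgebraπ m ((LinearMap.mul k _ ∘ₗ TensorAlgebra.ι k) x t) =
      ∑ q ∈ Finset.HasAntidiagonal.antidiagonal m,
        (LinearMap.mul k _ ∘ₗ TensorAlgebra.ι k) (g.π q.1 x) (g.tensorAlgebraπ q.2 t) := by
  simp [tensorAlgebraπ_mul, tensorAlgebraπ_ι]

theorem tensorAlgebraπ_orth (i j : ℕ) (t : TensorAlgebra k M) :
    g.tensorAlgebraπ i (g.tensorAlgebraπ j t) = if i = j then g.tensorAlgebraπ j t else 0 := by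
  induction t using word_induction generalizing i j with
  | one =>
    rw [tensorAlgebraπ_one]
    split_ifs with h1 h2 h3
    · rw [tensorAlgebraπ_one, if_pos (h2.trans h1)]
    · rw [tensorAlgebraπ_one, if_neg (by omega)]
    all_goals simp
  | smul c t ht => simp [map_smul, ht]
  | add s t hs ht =>
    rw [map_add, map_add, hs, ht]
    split_ifs
    · rfl
    · exact add_zero 0
  | ι_mul x t ht =>
    exact bilinear_orth (LinearMap.mul k _ ∘ₗ TensorAlgebra.ι k) g.π g.tensorAlgebraπ _
      g.tensorAlgebraπ_ι_mul (fun i j => g.orth i j x) ht i j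

/-- The grading of the tensor algebra of a graded vector space. -/
noncomputable def tensorAlgebra : Grading k (TensorAlgebra k M) where
  π := g.tensorAlgebraπ
  orth := g.tensorAlgebraπ_orth
  span t := by
    induction t using word_induction with
    | one => exact Submodule.mem_iSup_of_mem 0 ⟨1, by rw [tensorAlgebraπ_one, if_pos rfl]⟩
    | smul c t ht => exact Submodule.smul_mem _ c ht
    | add s t hs ht => exact add_mem hs ht
    | ι_mul x t ht =>
      induction x using g.induction with
      | zero => rw [map_zero, zero_mul]; exact zero_mem _
      | add x x' hx hy => rw [map_add, add_mul]; exact add_mem hx hy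
      | hom i x hx =>
        refine Submodule.iSup_induction
          (motive := fun t => TensorAlgebra.ι k x * t ∈ ⨆ i, LinearMap.range (g.tensorAlgebraπ i))
          _ ht ?_ ?_ ?_
        · rintro j _ ⟨t, rfl⟩
          refine Submodule.mem_iSup_of_mem (i + j)
            ⟨TensorAlgebra.ι k x * g.tensorAlgebraπ j t, ?_⟩
          have := bilinear_right (LinearMap.mul k _ ∘ₗ TensorAlgebra.ι k) g.π g.tensorAlgebraπ _
            g.tensorAlgebraπ_ι_mul (fun i => g.tensorAlgebraπ_orth i j t) i x
          rw [hx] at this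
          exact this
        · rw [mul_zero]; exact zero_mem _
        · intro s t hs ht
          rw [mul_add]
          exact add_mem hs ht

theorem tensorAlgebra_one (m : ℕ) :
    g.tensorAlgebra.π m (1 : TensorAlgebra k M) = if m = 0 then 1 else 0 :=
  g.tensorAlgebraπ_one m

theorem tensorAlgebra_ι (m : ℕ) (x : M) :
    g.tensorAlgebra.π m (TensorAlgebra.ι k x) = TensorAlgebra.ι k (g.π m x) :=
  g.tensorAlgebraπ_ι m x

theorem tensorAlgebra_mul (m : ℕ) (x y : TensorAlgebra k M) : g.tensorAlgebra.π m (x * y) =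
    ∑ q ∈ Finset.HasAntidiagonal.antidiagonal m,
      g.tensorAlgebra.π q.1 x * g.tensorAlgebra.π q.2 y :=
  g.tensorAlgebraπ_mul m x y

theorem tensorAlgebra_mul_hom {i j : ℕ} {x y : TensorAlgebra k M}
    (hx : g.tensorAlgebra.π i x = x) (hy : g.tensorAlgebra.π j y = y) :
    g.tensorAlgebra.π (i + j) (x * y) = x * y := by
  have := bilinear_right (LinearMap.mul k _) _ _ _ g.tensorAlgebra_mul
    (g.tensorAlgebra.π_eq_ite hy) i x
  rw [hx] at this
  exact this

end Grading

end Grading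

/-! ### Subspaces of tensor products over a field -/

section Tens

variable {k : Type u} [Field k] {M : Type v} [AddCommGroup M] [Module k M]
  {N : Type w} [AddCommGroup N] [Module k N] {L : Type x} [AddCommGroup L] [Module k L]

/-- The subspace `P ⊗ Q` of `M ⊗ N`. -/
noncomputable def tens (P : Submodule k M) (Q : Submodule k N) : Submodule k (M ⊗[k] N) :=
  Submodule.map₂ (TensorProduct.mk k M N) P Q

theorem tmul_mem_tens {P : Submodule k M} {Q : Submodule k N} {x : M} {y : N} (hx : x ∈ P)
    (hy : y ∈ Q) : x ⊗ₜ[k] y ∈ tens P Q :=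
  Submodule.apply_mem_map₂ _ hx hy

theorem tens_le {P : Submodule k M} {Q : Submodule k N} {S : Submodule k (M ⊗[k] N)} :
    tens P Q ≤ S ↔ ∀ x ∈ P, ∀ y ∈ Q, x ⊗ₜ[k] y ∈ S :=
  Submodule.map₂_le

theorem map_mem_of_mem_tens {P : Submodule k M} {Q : Submodule k N} (F : M ⊗[k] N →ₗ[k] L)
    (S : Submodule k L) (h : ∀ x ∈ P, ∀ y ∈ Q, F (x ⊗ₜ[k] y) ∈ S) {z : M ⊗[k] N}
    (hz : z ∈ tens P Q) : F z ∈ S :=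
  (tens_le (S := S.comap F)).2 h hz

theorem tens_mono {P P' : Submodule k M} {Q Q' : Submodule k N} (h : P ≤ P') (h' : Q ≤ Q') :
    tens P Q ≤ tens P' Q' :=
  Submodule.map₂_le_map₂ h h'

/-- Over a field, `K → f(K)` has a linear section, which extends from `f(K)` to all of `N`. This is
the source of every flatness argument below. -/
theorem exists_section (f : M →ₗ[k] N) (K : Submodule k M) :
    ∃ h : N →ₗ[k] M, (∀ y, h y ∈ K) ∧ ∀ x ∈ K, f (h (f x)) = f x := by
  let f' : K →ₗ[k] LinearMap.range (f ∘ₗ K.subtype) := (f ∘ₗ K.subtype).rangeRestrict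
  obtain ⟨r, hr⟩ := f'.exists_rightInverse_of_surjective (LinearMap.range_rangeRestrict _)
  obtain ⟨h, hh⟩ := LinearMap.exists_extend r
  refine ⟨K.subtype ∘ₗ h, fun y => (h y).2, fun x hx => ?_⟩
  have h1 : h (f x) = r (f' ⟨x, hx⟩) := by
    rw [← hh]; rfl
  have h2 := LinearMap.congr_fun hr (f' ⟨x, hx⟩)
  have h3 := congrArg Subtype.val h2
  simp only [LinearMap.coe_comp, Function.comp_apply, Submodule.subtype_apply, h1]
  exact h3

/-- With `h` the section of `f` on `K`, the operator `(id - h f) ⊗ 1` fixes `z`, since `f ⊗ 1` kills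
`z`; and `id - h f` maps `K` into `K ∩ ker f`. This is exactness of the tensor product, in a form
that keeps track of subspaces. -/
theorem mem_tens_of_rTensor_eq_zero (f : M →ₗ[k] N) {K : Submodule k M} {B : Submodule k L}
    {z : M ⊗[k] L} (hz : z ∈ tens K B) (h0 : f.rTensor L z = 0) :
    z ∈ tens (K ⊓ LinearMap.ker f) B := by
  obtain ⟨h, hK, hh⟩ := exists_section f K
  have h1 : (LinearMap.id - h ∘ₗ f).rTensor L z = z := by
    rw [LinearMap.rTensor_sub, LinearMap.rTensor_comp, LinearMap.sub_apply,
      LinearMap.comp_apply, h0, map_zero, sub_zero, LinearMap.rTensor_id, LinearMap.id_apply]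
  rw [← h1]
  refine map_mem_of_mem_tens _ _ (fun x hx y hy => ?_) hz
  rw [LinearMap.rTensor_tmul]
  refine tmul_mem_tens ⟨sub_mem hx (hK _), ?_⟩ hy
  simp [hh x hx]

theorem mem_tens_of_lTensor_eq_zero (f : M →ₗ[k] N) {K : Submodule k M} {B : Submodule k L}
    {z : L ⊗[k] M} (hz : z ∈ tens B K) (h0 : f.lTensor L z = 0) :
    z ∈ tens B (K ⊓ LinearMap.ker f) := by
  obtain ⟨h, hK, hh⟩ := exists_section f K
  have h1 : (LinearMap.id - h ∘ₗ f).lTensor L z = z := by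
    rw [LinearMap.lTensor_sub, LinearMap.lTensor_comp, LinearMap.sub_apply,
      LinearMap.comp_apply, h0, map_zero, sub_zero, LinearMap.lTensor_id, LinearMap.id_apply]
  rw [← h1]
  refine map_mem_of_mem_tens _ _ (fun x hx y hy => ?_) hz
  rw [LinearMap.lTensor_tmul]
  refine tmul_mem_tens hx ⟨sub_mem hy (hK _), ?_⟩
  simp [hh y hy]

/-- `Y` is the kernel of its quotient map, so this is a case of `mem_tens_of_rTensor_eq_zero`. -/
theorem tens_inf_tens (X Y : Submodule k M) (B : Submodule k L) :
    tens X B ⊓ tens Y B ≤ tens (X ⊓ Y) B := by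
  rintro z ⟨hz, hz'⟩
  have h0 : Y.mkQ.rTensor L z = 0 := by
    refine tens_le (S := LinearMap.ker _) |>.2 (fun x hx y hy => ?_) hz'
    rw [LinearMap.mem_ker, LinearMap.rTensor_tmul, Submodule.mkQ_apply,
      (Submodule.Quotient.mk_eq_zero Y).2 hx, TensorProduct.zero_tmul]
  simpa using mem_tens_of_rTensor_eq_zero _ hz h0

end Tens

/-! ### Word length in the tensor algebra -/

section Words

variable (k : Type u) [Field k] (V : Type v) [AddCommGroup V] [Module k V]

/-- The grading of the tensor algebra by the length of words. -/
noncomputable def wordGr : Grading k (TensorAlgebra k V) := (Grading.pure 1).tensorAlgebra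

theorem tpow_zero : tpow k V 0 = 1 := pow_zero _

theorem tpow_one : tpow k V 1 = LinearMap.range (TensorAlgebra.ι k) := pow_one _

theorem tpow_add (m n : ℕ) : tpow k V (m + n) = tpow k V m * tpow k V n := pow_add _ _ _

variable {k V}

theorem one_mem_tpow : (1 : TensorAlgebra k V) ∈ tpow k V 0 := by
  rw [tpow_zero]
  exact Submodule.one_le.1 le_rfl

theorem ι_mem_tpow (v : V) : TensorAlgebra.ι k v ∈ tpow k V 1 := by
  rw [tpow_one]
  exact ⟨v, rfl⟩

theorem mul_mem_tpow {m n : ℕ} {a b : TensorAlgebra k V} (ha : a ∈ tpow k V m)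
    (hb : b ∈ tpow k V n) : a * b ∈ tpow k V (m + n) := by
  rw [tpow_add]
  exact Submodule.mul_mem_mul ha hb

theorem wordGr_one : (wordGr k V).π 0 1 = 1 := by
  rw [wordGr, Grading.tensorAlgebra_one, if_pos rfl]

theorem wordGr_ι (v : V) :
    (wordGr k V).π 1 (TensorAlgebra.ι k v) = TensorAlgebra.ι k v := by
  rw [wordGr, Grading.tensorAlgebra_ι, Grading.pure_π, if_pos rfl]

theorem wordGr_mul {i j : ℕ} {x y : TensorAlgebra k V} (hx : (wordGr k V).π i x = x)
    (hy : (wordGr k V).π j y = y) : (wordGr k V).π (i + j) (x * y) = x * y :=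
  Grading.tensorAlgebra_mul_hom _ hx hy

theorem wordGr_of_mem_tpow {n : ℕ} {t : TensorAlgebra k V} (ht : t ∈ tpow k V n) :
    (wordGr k V).π n t = t := by
  suffices h : tpow k V n ≤ LinearMap.ker ((wordGr k V).π n - LinearMap.id) by
    exact sub_eq_zero.1 (h ht)
  clear ht
  induction n with
  | zero =>
    rw [tpow_zero, Submodule.one_le, LinearMap.mem_ker, LinearMap.sub_apply, wordGr_one]
    simp
  | succ n ih =>
    rw [tpow_add, Submodule.mul_le]
    intro a ha b hb
    rw [tpow_one] at hb
    obtain ⟨v, rfl⟩ := hb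
    have ha' : (wordGr k V).π n a = a := sub_eq_zero.1 (ih ha)
    rw [LinearMap.mem_ker, LinearMap.sub_apply, wordGr_mul ha' (wordGr_ι v)]
    simp

theorem iSup_tpow : ⨆ n, tpow k V n = ⊤ := by
  rw [eq_top_iff]
  rintro t -
  induction t using word_induction with
  | one => exact Submodule.mem_iSup_of_mem 0 one_mem_tpow
  | smul c t ht => exact Submodule.smul_mem _ c ht
  | add s t hs ht => exact add_mem hs ht
  | ι_mul v t ht =>
    refine Submodule.iSup_induction
      (motive := fun t => TensorAlgebra.ι k v * t ∈ ⨆ n, tpow k V n) _ ht ?_ ?_ ?_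
    · intro n t ht
      exact Submodule.mem_iSup_of_mem (1 + n) (mul_mem_tpow (ι_mem_tpow v) ht)
    · rw [mul_zero]; exact zero_mem _
    · intro s t hs ht
      rw [mul_add]
      exact add_mem hs ht

theorem tpow_induction {p : TensorAlgebra k V → Prop} (zero : p 0)
    (add : ∀ s t, p s → p t → p (s + t)) (hom : ∀ n, ∀ t ∈ tpow k V n, p t)
    (t : TensorAlgebra k V) : p t := by
  have ht : t ∈ ⨆ n, tpow k V n := by rw [iSup_tpow]; trivial
  exact Submodule.iSup_induction (motive := p) _ ht hom zero add

theorem wordGr_π_mem_tpow (n : ℕ) (t : TensorAlgebra k V) : (wordGr k V).π n t ∈ tpow k V n := by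
  induction t using tpow_induction with
  | zero => rw [map_zero]; exact zero_mem _
  | add s t hs ht => rw [map_add]; exact add_mem hs ht
  | hom m t ht =>
    rw [(wordGr k V).π_eq_ite (wordGr_of_mem_tpow ht)]
    split_ifs with h
    · rwa [h]
    · exact zero_mem _

theorem map_mul'_tens (X Y : Submodule k (TensorAlgebra k V)) :
    (tens X Y).map (LinearMap.mul' k (TensorAlgebra k V)) = X * Y := by
  apply le_antisymm
  · rw [Submodule.map_le_iff_le_comap, tens_le]
    intro x hx y hy
    exact Submodule.mul_mem_mul hx hy
  · rw [Submodule.mul_le]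
    intro x hx y hy
    exact ⟨x ⊗ₜ y, tmul_mem_tens hx hy, rfl⟩

/-- The multiplication `T(V) ⊗ V → T(V)` is injective: `tail` recovers the tensor from the product.
So the intersection can be formed in `T(V) ⊗ V`, where `tens_inf_tens` applies. -/
theorem inf_mul_tpow_one (X Y : Submodule k (TensorAlgebra k V)) :
    X * tpow k V 1 ⊓ Y * tpow k V 1 ≤ (X ⊓ Y) * tpow k V 1 := by
  have key : ∀ X : Submodule k (TensorAlgebra k V), ∀ z ∈ X * tpow k V 1,
      tail k V z ∈ tens X ⊤ ∧
        LinearMap.mul' k _ ((TensorAlgebra.ι k).lTensor _ (tail k V z)) = z := by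
    intro X z hz
    rw [tpow_one] at hz
    refine Submodule.mul_induction_on hz ?_ ?_
    · rintro x hx _ ⟨v, rfl⟩
      rw [tail_mul_ι]
      exact ⟨tmul_mem_tens hx trivial, by simp⟩
    · rintro x y ⟨hx, hx'⟩ ⟨hy, hy'⟩
      simp only [map_add, hx', hy', and_true]
      exact add_mem hx hy
  rintro z ⟨hz, hz'⟩
  have h1 := tens_inf_tens _ _ _ ⟨(key X z hz).1, (key Y z hz').1⟩
  rw [← (key X z hz).2]
  refine map_mem_of_mem_tens (LinearMap.mul' k _ ∘ₗ (TensorAlgebra.ι k).lTensor _) _ ?_ h1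
  intro x hx v _
  exact Submodule.mul_mem_mul hx (ι_mem_tpow v)

theorem tpow_one_mul_inf (X Y : Submodule k (TensorAlgebra k V)) :
    tpow k V 1 * X ⊓ tpow k V 1 * Y ≤ tpow k V 1 * (X ⊓ Y) := by
  have key : ∀ X : Submodule k (TensorAlgebra k V), ∀ z ∈ tpow k V 1 * X,
      TensorProduct.comm k _ _ (head k V z) ∈ tens X ⊤ ∧
        LinearMap.mul' k _ ((TensorAlgebra.ι k).rTensor _ (head k V z)) = z := by
    intro X z hz
    rw [tpow_one] at hz
    refine Submodule.mul_induction_on hz ?_ ?_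
    · rintro _ ⟨v, rfl⟩ x hx
      rw [head_ι_mul]
      exact ⟨tmul_mem_tens hx trivial, by simp⟩
    · rintro x y ⟨hx, hx'⟩ ⟨hy, hy'⟩
      simp only [map_add, hx', hy', and_true]
      exact add_mem hx hy
  rintro z ⟨hz, hz'⟩
  have h1 := tens_inf_tens _ _ _ ⟨(key X z hz).1, (key Y z hz').1⟩
  rw [← (key X z hz).2, ← (TensorProduct.comm k _ _).symm_apply_apply (head k V z)]
  refine map_mem_of_mem_tens (LinearMap.mul' k _ ∘ₗ (TensorAlgebra.ι k).rTensor _ ∘ₗ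
    (TensorProduct.comm k _ _).symm.toLinearMap) _ ?_ h1
  intro x hx v _
  exact Submodule.mul_mem_mul (ι_mem_tpow v) hx

theorem inf_mul_tpow (X Y : Submodule k (TensorAlgebra k V)) (n : ℕ) :
    X * tpow k V n ⊓ Y * tpow k V n ≤ (X ⊓ Y) * tpow k V n := by
  induction n with
  | zero => rw [tpow_zero, mul_one, mul_one, mul_one]
  | succ n ih =>
    rw [tpow_add, ← mul_assoc, ← mul_assoc, ← mul_assoc]
    exact (inf_mul_tpow_one _ _).trans (mul_le_mul_left ih _)

end Words

/-! ### The homogeneous algebra: its ideal of relations, grading and augmentation -/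

section Algebra

variable {k : Type u} [Field k] {V : Type v} [AddCommGroup V] [Module k V]
variable (R : Submodule k (TensorAlgebra k V)) {s : ℕ}

theorem proj_surjective : Function.Surjective (proj R) := by
  intro x
  exact RingCon.mk'_surjective _ x

theorem proj_eq_zero_iff {t : TensorAlgebra k V} : proj R t = 0 ↔ t ∈ ⊤ * R * ⊤ := by
  have h1 : proj R t = 0 ↔ t ∈ TwoSidedIdeal.span (R : Set (TensorAlgebra k V)) := by
    rw [TwoSidedIdeal.mem_iff]
    exact RingCon.eq _
  rw [h1]
  constructor
  · intro h
    rw [TwoSidedIdeal.mem_span_iff_mem_addSubgroup_closure] at h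
    refine AddSubgroup.closure_induction (p := fun t _ => t ∈ ⊤ * R * ⊤) ?_ ?_ ?_ ?_ h
    · intro t ht
      obtain ⟨_, ⟨a, -, r, hr, rfl⟩, b, -, rfl⟩ := ht
      exact Submodule.mul_mem_mul (Submodule.mul_mem_mul trivial hr) trivial
    · exact zero_mem _
    · exact fun a b _ _ => add_mem
    · exact fun a _ => neg_mem
  · intro h
    refine Submodule.mul_induction_on h ?_ fun a b ha hb => add_mem ha hb
    intro a ha b _
    refine TwoSidedIdeal.mul_mem_right _ _ _ ?_
    refine Submodule.mul_induction_on ha ?_ fun a b ha hb => add_mem ha hb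
    intro a _ r hr
    exact TwoSidedIdeal.mul_mem_left _ _ _ (TwoSidedIdeal.subset_span hr)

theorem proj_mem {r : TensorAlgebra k V} (hr : r ∈ R) : proj R r = 0 := by
  rw [proj_eq_zero_iff]
  have := Submodule.mul_mem_mul (Submodule.mul_mem_mul
    (Submodule.mem_top (R := k) (x := (1 : TensorAlgebra k V))) hr)
    (Submodule.mem_top (R := k) (x := (1 : TensorAlgebra k V)))
  simpa using this

theorem gen_apply (v : V) : gen R v = proj R (TensorAlgebra.ι k v) := rfl

variable {R}

/-- The kernel of `T(V) → A` is spanned by products of homogeneous elements. -/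
theorem proj_eq_zero_induction {p : TensorAlgebra k V → Prop} (zero : p 0)
    (add : ∀ s t, p s → p t → p (s + t))
    (mul : ∀ i j, ∀ a ∈ tpow k V i, ∀ r ∈ R, ∀ b ∈ tpow k V j, p (a * r * b))
    {t : TensorAlgebra k V} (ht : proj R t = 0) : p t := by
  rw [proj_eq_zero_iff] at ht
  refine Submodule.mul_induction_on ht ?_ add
  intro a ha b _
  refine Submodule.mul_induction_on (C := fun a => p (a * b)) ha ?_
    fun x y hx hy => by rw [add_mul]; exact add _ _ hx hy
  intro a _ r hr
  induction a using tpow_induction with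
  | zero => simpa using zero
  | add x y hx hy => rw [add_mul, add_mul]; exact add _ _ (hx trivial) (hy trivial)
  | hom i a ha =>
    induction b using tpow_induction with
    | zero => simpa using zero
    | add x y hx hy => rw [mul_add]; exact add _ _ (hx trivial) (hy trivial)
    | hom j b hb => exact mul i j a ha r hr b hb

/-- The relations are homogeneous of degree `s`, hence so are the spanning products `a r b` with `a`
and `b` homogeneous. Therefore the projections of `T(V)` descend to `A`. -/
theorem proj_wordGr_eq_zero (hR : R ≤ tpow k V s) {t : TensorAlgebra k V} (ht : proj R t = 0)
    (m : ℕ) : proj R ((wordGr k V).π m t) = 0 := by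
  refine proj_eq_zero_induction (p := fun t => proj R ((wordGr k V).π m t) = 0) ?_ ?_ ?_ ht
  · simp
  · intro a b ha hb
    rw [map_add, map_add, ha, hb, add_zero]
  · intro i j a ha r hr b hb
    rw [(wordGr k V).π_eq_ite (wordGr_mul (wordGr_mul (wordGr_of_mem_tpow ha)
      (wordGr_of_mem_tpow (hR hr))) (wordGr_of_mem_tpow hb))]
    split_ifs
    · rw [map_mul, map_mul, proj_mem R hr, mul_zero, zero_mul]
    · exact map_zero _

theorem wordGr_eq_zero_of_lt (hR : R ≤ tpow k V s) {t : TensorAlgebra k V} (ht : proj R t = 0)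
    {m : ℕ} (hm : m < s) : (wordGr k V).π m t = 0 := by
  refine proj_eq_zero_induction (p := fun t => (wordGr k V).π m t = 0) ?_ ?_ ?_ ht
  · simp
  · intro a b ha hb
    rw [map_add, ha, hb, add_zero]
  · intro i j a ha r hr b hb
    exact (wordGr k V).π_eq_zero (wordGr_mul (wordGr_mul (wordGr_of_mem_tpow ha)
      (wordGr_of_mem_tpow (hR hr))) (wordGr_of_mem_tpow hb)) (by omega)

theorem wordGr_mem_of_eq (hR : R ≤ tpow k V s) {t : TensorAlgebra k V} (ht : proj R t = 0) :
    (wordGr k V).π s t ∈ R := by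
  refine proj_eq_zero_induction (p := fun t => (wordGr k V).π s t ∈ R) ?_ ?_ ?_ ht
  · rw [map_zero]; exact zero_mem _
  · intro a b ha hb
    rw [map_add]; exact add_mem ha hb
  · intro i j a ha r hr b hb
    rw [(wordGr k V).π_eq_ite (wordGr_mul (wordGr_mul (wordGr_of_mem_tpow ha)
      (wordGr_of_mem_tpow (hR hr))) (wordGr_of_mem_tpow hb))]
    split_ifs with h
    -- In degree `s` no room is left beside the relation: the outer factors are scalars.
    · obtain rfl : i = 0 := by omega
      obtain rfl : j = 0 := by omega
      rw [tpow_zero, Submodule.mem_one] at ha hb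
      obtain ⟨c, rfl⟩ := ha
      obtain ⟨d, rfl⟩ := hb
      rw [← Algebra.commutes d, ← Algebra.smul_def, ← Algebra.smul_def]
      exact R.smul_mem _ (R.smul_mem _ hr)
    · exact zero_mem _

theorem tpow_inf_ker_of_lt (hR : R ≤ tpow k V s) {m : ℕ} (hm : m < s) :
    tpow k V m ⊓ LinearMap.ker (proj R).toLinearMap = ⊥ := by
  rw [eq_bot_iff]
  rintro t ⟨ht, ht'⟩
  rw [Submodule.mem_bot, ← wordGr_of_mem_tpow ht]
  exact wordGr_eq_zero_of_lt hR ht' hm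

theorem tpow_inf_ker_le (hR : R ≤ tpow k V s) :
    tpow k V s ⊓ LinearMap.ker (proj R).toLinearMap ≤ R := by
  rintro t ⟨ht, ht'⟩
  rw [← wordGr_of_mem_tpow ht]
  exact wordGr_mem_of_eq hR ht'

/-- The linear map on `A` that is induced by a linear map on `T(V)` vanishing on the ideal. -/
noncomputable def descend {X : Type w} [AddCommGroup X] [Module k X]
    (f : TensorAlgebra k V →ₗ[k] X) (hf : ∀ t, proj R t = 0 → f t = 0) : Alg R →ₗ[k] X :=
  (LinearMap.ker (proj R).toLinearMap).liftQ f (fun t ht => hf t ht) ∘ₗ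
    ((proj R).toLinearMap.quotKerEquivOfSurjective (proj_surjective R)).symm.toLinearMap

theorem descend_proj {X : Type w} [AddCommGroup X] [Module k X]
    (f : TensorAlgebra k V →ₗ[k] X) (hf : ∀ t, proj R t = 0 → f t = 0)
    (t : TensorAlgebra k V) : descend f hf (proj R t) = f t := by
  have h : ((proj R).toLinearMap.quotKerEquivOfSurjective (proj_surjective R)).symm (proj R t) =
      Submodule.Quotient.mk t := by
    rw [LinearEquiv.symm_apply_eq]
    rfl
  simp only [descend, LinearMap.comp_apply, LinearEquiv.coe_coe]
  rw [h]
  rfl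

/-- The projection of `A` onto its component of degree `m`. -/
noncomputable def algπ (hR : R ≤ tpow k V s) (m : ℕ) : Module.End k (Alg R) :=
  descend ((proj R).toLinearMap ∘ₗ (wordGr k V).π m) fun t ht => by
    rw [LinearMap.comp_apply]
    exact proj_wordGr_eq_zero hR ht m

theorem algπ_proj (hR : R ≤ tpow k V s) (m : ℕ) (t : TensorAlgebra k V) :
    algπ hR m (proj R t) = proj R ((wordGr k V).π m t) :=
  descend_proj _ _ t

/-- The grading of `A`. -/
noncomputable def algGr (hR : R ≤ tpow k V s) : Grading k (Alg R) where
  π := algπ hR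
  orth i j a := by
    obtain ⟨t, rfl⟩ := proj_surjective R a
    rw [algπ_proj, algπ_proj, Grading.orth]
    split_ifs
    · rfl
    · exact map_zero _
  span a := by
    obtain ⟨t, rfl⟩ := proj_surjective R a
    induction t using (wordGr k V).induction with
    | zero => rw [map_zero]; exact zero_mem _
    | add x y hx hy => rw [map_add]; exact add_mem hx hy
    | hom i t ht => exact Submodule.mem_iSup_of_mem i ⟨proj R t, by rw [algπ_proj, ht]⟩

theorem algGr_proj (hR : R ≤ tpow k V s) (m : ℕ) (t : TensorAlgebra k V) :
    (algGr hR).π m (proj R t) = proj R ((wordGr k V).π m t) :=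
  algπ_proj hR m t

theorem mem_gr_iff (hR : R ≤ tpow k V s) {m : ℕ} {a : Alg R} :
    a ∈ gr R m ↔ (algGr hR).π m a = a := by
  constructor
  · rintro ⟨t, ht, rfl⟩
    rw [AlgHom.toLinearMap_apply, algGr_proj, wordGr_of_mem_tpow ht]
  · intro h
    obtain ⟨t, rfl⟩ := proj_surjective R a
    rw [← h, algGr_proj]
    exact ⟨_, wordGr_π_mem_tpow m t, rfl⟩

theorem algGr_π_mem (hR : R ≤ tpow k V s) (m : ℕ) (a : Alg R) : (algGr hR).π m a ∈ gr R m := by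
  rw [mem_gr_iff hR, Grading.idem]

theorem proj_mem_gr {m : ℕ} {t : TensorAlgebra k V} (ht : t ∈ tpow k V m) :
    proj R t ∈ gr R m := ⟨t, ht, rfl⟩

theorem mul_mem_gr {m n : ℕ} {a b : Alg R} (ha : a ∈ gr R m) (hb : b ∈ gr R n) :
    a * b ∈ gr R (m + n) := by
  rw [← gr_mul_gr]
  exact Submodule.mul_mem_mul ha hb

theorem gr_succ_le_aug (n : ℕ) : gr R (n + 1) ≤ aug R := le_iSup (fun n => gr R (n + 1)) n

theorem mem_aug_iff (hR : R ≤ tpow k V s) {a : Alg R} : a ∈ aug R ↔ (algGr hR).π 0 a = 0 := by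
  constructor
  · intro h
    have hle : aug R ≤ LinearMap.ker ((algGr hR).π 0) := by
      refine iSup_le fun n a ha => ?_
      rw [LinearMap.mem_ker]
      exact (algGr hR).π_eq_zero ((mem_gr_iff hR).1 ha) (by omega)
    exact hle h
  · intro h
    refine (algGr hR).mem_of_π_mem _ fun i => ?_
    cases i with
    | zero => rw [h]; exact zero_mem _
    | succ n => exact gr_succ_le_aug n (algGr_π_mem hR _ a)

theorem algebraMapInv_ι (v : V) :
    TensorAlgebra.algebraMapInv (R := k) (TensorAlgebra.ι k v) = 0 := by
  simp [TensorAlgebra.algebraMapInv]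

theorem algebraMapInv_of_mem_tpow {n : ℕ} (hn : n ≠ 0) {t : TensorAlgebra k V}
    (ht : t ∈ tpow k V n) : TensorAlgebra.algebraMapInv (R := k) t = 0 := by
  obtain ⟨m, rfl⟩ : ∃ m, n = m + 1 := ⟨n - 1, by omega⟩
  rw [tpow_add, tpow_one] at ht
  refine Submodule.mul_induction_on ht ?_ ?_
  · rintro a _ _ ⟨v, rfl⟩
    rw [map_mul, algebraMapInv_ι, mul_zero]
  · intro a b ha hb
    rw [map_add, ha, hb, add_zero]

/-- The augmentation `A → k`. -/
noncomputable def counit (hs : s ≠ 0) (hR : R ≤ tpow k V s) : Alg R →ₗ[k] k :=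
  descend (TensorAlgebra.algebraMapInv (R := k)).toLinearMap fun t ht => by
    refine proj_eq_zero_induction
      (p := fun t => (TensorAlgebra.algebraMapInv (R := k)).toLinearMap t = 0) ?_ ?_ ?_ ht
    · simp
    · intro a b ha hb
      rw [map_add, ha, hb, add_zero]
    · intro i j a _ r hr b _
      rw [AlgHom.toLinearMap_apply, map_mul, map_mul, algebraMapInv_of_mem_tpow hs (hR hr),
        mul_zero, zero_mul]

theorem counit_proj (hs : s ≠ 0) (hR : R ≤ tpow k V s) (t : TensorAlgebra k V) :
    counit hs hR (proj R t) = TensorAlgebra.algebraMapInv (R := k) t :=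
  descend_proj _ _ t

theorem counit_mul (hs : s ≠ 0) (hR : R ≤ tpow k V s) (a b : Alg R) :
    counit hs hR (a * b) = counit hs hR a * counit hs hR b := by
  obtain ⟨t, rfl⟩ := proj_surjective R a
  obtain ⟨u, rfl⟩ := proj_surjective R b
  rw [← map_mul, counit_proj, counit_proj, counit_proj, map_mul]

theorem counit_one (hs : s ≠ 0) (hR : R ≤ tpow k V s) : counit hs hR 1 = 1 := by
  rw [← map_one (proj R), counit_proj, map_one]

theorem algebraMap_algebraMapInv (t : TensorAlgebra k V) :
    algebraMap k _ (TensorAlgebra.algebraMapInv (R := k) t) = (wordGr k V).π 0 t := by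
  induction t using tpow_induction with
  | zero => simp
  | add s t hs ht => rw [map_add, map_add, map_add, hs, ht]
  | hom n t ht =>
    rcases eq_or_ne n 0 with rfl | hn
    · rw [wordGr_of_mem_tpow ht]
      rw [tpow_zero, Submodule.mem_one] at ht
      obtain ⟨c, rfl⟩ := ht
      rw [AlgHom.commutes]
      rfl
    · rw [algebraMapInv_of_mem_tpow hn ht, map_zero,
        (wordGr k V).π_eq_zero (wordGr_of_mem_tpow ht) hn.symm]

theorem algebraMap_counit (hs : s ≠ 0) (hR : R ≤ tpow k V s) (a : Alg R) :
    algebraMap k _ (counit hs hR a) = (algGr hR).π 0 a := by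
  obtain ⟨t, rfl⟩ := proj_surjective R a
  rw [counit_proj, algGr_proj, ← algebraMap_algebraMapInv, AlgHom.commutes]

theorem mem_aug_iff_counit (hs : s ≠ 0) (hR : R ≤ tpow k V s) {a : Alg R} :
    a ∈ aug R ↔ counit hs hR a = 0 := by
  rw [mem_aug_iff hR, ← algebraMap_counit hs hR]
  constructor
  · intro h
    have := congrArg (counit hs hR) h
    rw [map_zero, Algebra.algebraMap_eq_smul_one, map_smul, counit_one] at this
    simpa using this
  · intro h
    rw [h, map_zero]

theorem sub_counit_mem_aug (hs : s ≠ 0) (hR : R ≤ tpow k V s) (a : Alg R) :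
    a - algebraMap k _ (counit hs hR a) ∈ aug R := by
  rw [mem_aug_iff_counit hs hR, map_sub, Algebra.algebraMap_eq_smul_one, map_smul, counit_one]
  simp

end Algebra

/-! ### The spaces `J_n` and the left Koszul complex -/

section Left

variable {k : Type u} [Field k] {V : Type v} [AddCommGroup V] [Module k V]
variable {R : Submodule k (TensorAlgebra k V)} {s : ℕ}

/-- The terms of the complexes are submodules generated by `J_n`; this describes them as subspaces,
to which the flatness lemmas on `tens` apply. -/
theorem mem_baseChange_iff {B : Type w} [Ring B] [Algebra k B] {M : Type x} [AddCommGroup M]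
    [Module k M] {P : Submodule k M} {x : B ⊗[k] M} :
    x ∈ P.baseChange B ↔ x ∈ tens (⊤ : Submodule k B) P := by
  constructor
  · intro hx
    rw [Submodule.baseChange_eq_span] at hx
    induction hx using Submodule.span_induction with
    | mem y hy =>
      obtain ⟨z, hz, rfl⟩ := hy
      exact tmul_mem_tens trivial hz
    | zero => exact zero_mem _
    | add y z _ _ hy hz => exact add_mem hy hz
    | smul b y _ hy =>
      refine map_mem_of_mem_tens ((Algebra.lsmul k k (B ⊗[k] M)) b) _ ?_ hy
      intro c _ y hy
      exact tmul_mem_tens (x := b • c) trivial hy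
  · intro hx
    have hle : tens (⊤ : Submodule k B) P ≤ (P.baseChange B).restrictScalars k :=
      tens_le.2 fun b _ y hy => Submodule.tmul_mem_baseChange_of_mem b hy
    exact hle hx

theorem mem_mul_of_le {X Y Z : Submodule k (TensorAlgebra k V)} (h : X ≤ Y)
    {w : TensorAlgebra k V} (hw : w ∈ Z * X) : w ∈ Z * Y :=
  mul_le_mul_right h Z hw

/-! ### The subspaces `J_n` -/

theorem mem_J {n : ℕ} {t : TensorAlgebra k V} : t ∈ J R s n ↔
    t ∈ tpow k V n ∧ ∀ i j, i + s + j = n → t ∈ tpow k V i * R * tpow k V j := by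
  simp [J, Submodule.mem_iInf]

theorem J_le_tpow (n : ℕ) : J R s n ≤ tpow k V n := inf_le_left

theorem J_of_lt {n : ℕ} (hn : n < s) : J R s n = tpow k V n := by
  ext t
  rw [mem_J]
  exact ⟨And.left, fun h => ⟨h, fun i j hij => by omega⟩⟩

theorem J_self (hR : R ≤ tpow k V s) : J R s s = R := by
  ext t
  rw [mem_J]
  constructor
  · rintro ⟨-, h⟩
    simpa [tpow_zero] using h 0 0 (by omega)
  · intro h
    refine ⟨hR h, fun i j hij => ?_⟩
    obtain rfl : i = 0 := by omega
    obtain rfl : j = 0 := by omega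
    simpa [tpow_zero] using h

theorem J_le_mul_right {n : ℕ} (hn : s ≤ n) : J R s n ≤ R * tpow k V (n - s) := by
  intro t ht
  have := (mem_J.1 ht).2 0 (n - s) (by omega)
  simpa [tpow_zero] using this

theorem J_le_mul_left {n : ℕ} (hn : s ≤ n) : J R s n ≤ tpow k V (n - s) * R := by
  intro t ht
  have := (mem_J.1 ht).2 (n - s) 0 (by omega)
  simpa [tpow_zero] using this

theorem mem_tpow_one_mul_inf_iInf (S : Finset ℕ) (X : Submodule k (TensorAlgebra k V))
    (Y : ℕ → Submodule k (TensorAlgebra k V)) {t : TensorAlgebra k V} (hX : t ∈ tpow k V 1 * X)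
    (hY : ∀ i ∈ S, t ∈ tpow k V 1 * Y i) : t ∈ tpow k V 1 * (X ⊓ ⨅ i ∈ S, Y i) := by
  induction S using Finset.induction_on with
  | empty => simpa using hX
  | insert a S ha ih =>
    have h1 := ih fun i hi => hY i (Finset.mem_insert_of_mem hi)
    have h2 := tpow_one_mul_inf _ _ ⟨hY a (Finset.mem_insert_self a S), h1⟩
    rw [Finset.iInf_insert, inf_left_comm]
    exact h2

theorem mem_inf_iInf_mul_tpow_one (S : Finset ℕ) (X : Submodule k (TensorAlgebra k V))
    (Y : ℕ → Submodule k (TensorAlgebra k V)) {t : TensorAlgebra k V} (hX : t ∈ X * tpow k V 1)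
    (hY : ∀ i ∈ S, t ∈ Y i * tpow k V 1) : t ∈ (X ⊓ ⨅ i ∈ S, Y i) * tpow k V 1 := by
  induction S using Finset.induction_on with
  | empty => simpa using hX
  | insert a S ha ih =>
    have h1 := ih fun i hi => hY i (Finset.mem_insert_of_mem hi)
    have h2 := inf_mul_tpow_one _ _ ⟨hY a (Finset.mem_insert_self a S), h1⟩
    rw [Finset.iInf_insert, inf_left_comm]
    exact h2

/-- The conditions on `J_{n+1}` with `i ≥ 1` all have the left factor `V`, which can be taken out of
a finite intersection. What remains are the conditions on `J_n`. The factor `V^{⊗n}` is carried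
along separately, since there are no positions for `R` if `n < s`. -/
theorem J_succ_le (n : ℕ) : J R s (n + 1) ≤ tpow k V 1 * J R s n := by
  intro t ht
  rw [mem_J] at ht
  have h := mem_tpow_one_mul_inf_iInf ((Finset.range (n + 1)).filter fun i => i + s ≤ n)
    (tpow k V n) (fun i => tpow k V i * R * tpow k V (n - s - i)) (t := t)
    (by rw [← tpow_add, add_comm 1 n]; exact ht.1)
    (by
      intro i hi
      have hi' := (Finset.mem_filter.1 hi).2
      rw [← mul_assoc, ← mul_assoc, ← tpow_add]
      exact ht.2 _ _ (by omega))
  refine mul_le_mul_right ?_ (tpow k V 1) h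
  rintro u ⟨hu, hu'⟩
  rw [mem_J]
  refine ⟨hu, fun i j hij => ?_⟩
  have h2 := (Submodule.mem_iInf _).1 ((Submodule.mem_iInf _).1 hu' i)
    (Finset.mem_filter.2 ⟨Finset.mem_range.2 (by omega), by omega⟩)
  rwa [show n - s - i = j by omega] at h2

theorem J_succ_le' (n : ℕ) : J R s (n + 1) ≤ J R s n * tpow k V 1 := by
  intro t ht
  rw [mem_J] at ht
  have h := mem_inf_iInf_mul_tpow_one ((Finset.range (n + 1)).filter fun i => i + s ≤ n)
    (tpow k V n) (fun i => tpow k V i * R * tpow k V (n - s - i)) (t := t)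
    (by rw [← tpow_add]; exact ht.1)
    (by
      intro i hi
      have hi' := (Finset.mem_filter.1 hi).2
      rw [mul_assoc, ← tpow_add]
      exact ht.2 _ _ (by omega))
  refine mul_le_mul_left ?_ (tpow k V 1) h
  rintro u ⟨hu, hu'⟩
  rw [mem_J]
  refine ⟨hu, fun i j hij => ?_⟩
  have h2 := (Submodule.mem_iInf _).1 ((Submodule.mem_iInf _).1 hu' i)
    (Finset.mem_filter.2 ⟨Finset.mem_range.2 (by omega), by omega⟩)
  rwa [show n - s - i = j by omega] at h2

/-! ### The degrees of the terms -/

/-- The difference of the degrees in which the `i`-th and the `(i-1)`-st term are generated. -/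
def koszulStep (s i : ℕ) : ℕ := if Odd i then 1 else s - 1

/-- This is why the composite of two consecutive left differentials is `δ_L^s`. -/
theorem koszulStep_add (hs : 2 ≤ s) (i : ℕ) : koszulStep s i + koszulStep s (i + 1) = s := by
  unfold koszulStep
  rcases Nat.even_or_odd i with h | h
  · rw [if_neg (Nat.not_odd_iff_even.2 h), if_pos h.add_one]
    omega
  · rw [if_pos h, if_neg (Nat.not_odd_iff_even.2 h.add_one)]
    omega

theorem koszulStep_lt (hs : 2 ≤ s) (i : ℕ) : koszulStep s i < s := by
  unfold koszulStep
  split_ifs <;> omega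

theorem koszulDegree_succ (hs : 2 ≤ s) (i : ℕ) :
    koszulDegree s (i + 1) = koszulStep s (i + 1) + koszulDegree s i := by
  unfold koszulStep koszulDegree
  rcases Nat.even_or_odd' i with ⟨c, rfl | rfl⟩
  · rw [if_pos (even_two_mul c).add_one, show (2 * c + 1) / 2 = c by omega,
      show 2 * c / 2 = c by omega]
    omega
  · rw [if_neg (by rw [Nat.not_odd_iff_even]; exact ⟨c + 1, by omega⟩),
      show (2 * c + 1 + 1) / 2 = c + 1 by omega, show (2 * c + 1) / 2 = c by omega, add_mul]
    omega

theorem koszulDegree_zero : koszulDegree s 0 = 0 := by simp [koszulDegree]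

theorem koszulDegree_one : koszulDegree s 1 = 1 := by simp [koszulDegree]

theorem koszulDegree_two : koszulDegree s 2 = s := by simp [koszulDegree]

theorem le_koszulDegree (i : ℕ) : s ≤ koszulDegree s (i + 2) := by
  unfold koszulDegree
  rw [show (i + 2) / 2 = i / 2 + 1 by omega, add_mul]
  omega

theorem leftD_eq (i : ℕ) : leftD R s i = leftδ R ^ koszulStep s i := by
  unfold leftD koszulStep
  split_ifs <;> simp

/-! ### The map `δ_L` -/

theorem leftδ_pow_mul {r : ℕ} {w : TensorAlgebra k V} (hw : w ∈ tpow k V r) (a : Alg R)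
    (t : TensorAlgebra k V) :
    (leftδ R ^ r) (a ⊗ₜ[k] (w * t)) = (a * proj R w) ⊗ₜ[k] t := by
  induction r generalizing w a with
  | zero =>
    rw [tpow_zero, Submodule.mem_one] at hw
    obtain ⟨c, rfl⟩ := hw
    rw [pow_zero, Module.End.one_apply, AlgHom.commutes, ← Algebra.smul_def, ← Algebra.commutes,
      ← Algebra.smul_def, TensorProduct.smul_tmul]
  | succ r ih =>
    rw [add_comm, tpow_add, tpow_one] at hw
    refine Submodule.mul_induction_on
      (C := fun w => (leftδ R ^ (r + 1)) (a ⊗ₜ[k] (w * t)) = (a * proj R w) ⊗ₜ[k] t) hw ?_ ?_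
    · rintro _ ⟨v, rfl⟩ w hw
      rw [pow_succ, Module.End.mul_apply, mul_assoc, leftδ_apply, ih hw, map_mul, mul_assoc]
      rfl
    · intro x y hx hy
      rw [add_mul, TensorProduct.tmul_add, map_add, hx, hy, map_add, mul_add,
        TensorProduct.add_tmul]

theorem leftδ_mem {n : ℕ} {x : Alg R ⊗[k] TensorAlgebra k V}
    (hx : x ∈ (J R s (n + 1)).baseChange (Alg R)) : leftδ R x ∈ (J R s n).baseChange (Alg R) := by
  rw [mem_baseChange_iff] at hx ⊢
  refine map_mem_of_mem_tens ((leftδ R).restrictScalars k) _ ?_ hx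
  intro a _ t ht
  have h := J_succ_le n ht
  rw [tpow_one] at h
  refine Submodule.mul_induction_on
    (C := fun t => (leftδ R).restrictScalars k (a ⊗ₜ[k] t) ∈ tens ⊤ (J R s n)) h ?_ ?_
  · rintro _ ⟨v, rfl⟩ u hu
    rw [LinearMap.restrictScalars_apply, leftδ_apply]
    exact tmul_mem_tens trivial hu
  · intro x y hx hy
    rw [TensorProduct.tmul_add, map_add]
    exact add_mem hx hy

theorem leftδ_pow_mem {r n : ℕ} {x : Alg R ⊗[k] TensorAlgebra k V}
    (hx : x ∈ (J R s (r + n)).baseChange (Alg R)) :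
    (leftδ R ^ r) x ∈ (J R s n).baseChange (Alg R) := by
  induction r generalizing x with
  | zero => simpa using hx
  | succ r ih =>
    rw [pow_succ, Module.End.mul_apply]
    refine ih (leftδ_mem ?_)
    rwa [show r + n + 1 = r + 1 + n by omega]

/-- `J_n` lies in `R ⊗ V^{⊗(n-s)}`, and the first `s` letters, multiplied into `A`, form a relation.
-/
theorem leftδ_pow_eq_zero (hR : R ≤ tpow k V s) {n : ℕ} (hn : s ≤ n)
    {x : Alg R ⊗[k] TensorAlgebra k V}
    (hx : x ∈ (J R s n).baseChange (Alg R)) : (leftδ R ^ s) x = 0 := by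
  rw [mem_baseChange_iff] at hx
  refine (Submodule.mem_bot k).1
    (map_mem_of_mem_tens ((leftδ R ^ s).restrictScalars k) ⊥ ?_ hx)
  intro a _ t ht
  refine Submodule.mul_induction_on
    (C := fun t => (leftδ R ^ s).restrictScalars k (a ⊗ₜ[k] t) ∈ (⊥ : Submodule k _))
    (J_le_mul_right hn ht) ?_ ?_
  · intro r hr u _
    rw [LinearMap.restrictScalars_apply, leftδ_pow_mul (hR hr), proj_mem R hr, mul_zero,
      TensorProduct.zero_tmul]
    exact zero_mem _
  · intro x y hx hy
    rw [TensorProduct.tmul_add, map_add]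
    exact add_mem hx hy

theorem leftD_mem (hs : 2 ≤ s) {i : ℕ} {x : Alg R ⊗[k] TensorAlgebra k V}
    (hx : x ∈ leftK R s (i + 1)) : leftD R s (i + 1) x ∈ leftK R s i := by
  rw [leftD_eq]
  refine leftδ_pow_mem ?_
  rw [← koszulDegree_succ hs]
  exact hx

theorem leftD_leftD (hs : 2 ≤ s) (hR : R ≤ tpow k V s) {i : ℕ}
    {x : Alg R ⊗[k] TensorAlgebra k V} (hx : x ∈ leftK R s (i + 2)) :
    leftD R s (i + 1) (leftD R s (i + 2) x) = 0 := by
  rw [leftD_eq, leftD_eq, ← Module.End.mul_apply, ← pow_add, koszulStep_add hs]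
  exact leftδ_pow_eq_zero hR (le_koszulDegree i) hx

/-! ### The grading of `A ⊗ T(V)` -/

/-- The grading of `A ⊗ T(V)` by the total degree. -/
noncomputable def leftGr (hR : R ≤ tpow k V s) : Grading k (Alg R ⊗[k] TensorAlgebra k V) :=
  (algGr hR).tensor (wordGr k V)

theorem leftGr_tmul (hR : R ≤ tpow k V s) {p n : ℕ} {a : Alg R} {t : TensorAlgebra k V}
    (ha : a ∈ gr R p) (ht : t ∈ tpow k V n) :
    (leftGr hR).π (p + n) (a ⊗ₜ[k] t) = a ⊗ₜ[k] t :=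
  Grading.tensor_tmul_hom _ _ ((mem_gr_iff hR).1 ha) (wordGr_of_mem_tpow ht)

theorem tmul_word_induction (hR : R ≤ tpow k V s) {p : Alg R ⊗[k] TensorAlgebra k V → Prop}
    (zero : p 0)
    (add : ∀ x y, p x → p y → p (x + y))
    (one : ∀ n, ∀ a ∈ gr R n, p (a ⊗ₜ[k] 1))
    (ι_mul : ∀ n, ∀ a ∈ gr R n, ∀ v, ∀ m, ∀ t ∈ tpow k V m,
      p (a ⊗ₜ[k] (TensorAlgebra.ι k v * t)))
    (x : Alg R ⊗[k] TensorAlgebra k V) : p x := by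
  induction x with
  | zero => exact zero
  | add x y hx hy => exact add x y hx hy
  | tmul a t =>
    induction a using (algGr hR).induction with
    | zero => rw [TensorProduct.zero_tmul]; exact zero
    | add x y hx hy => rw [TensorProduct.add_tmul]; exact add _ _ hx hy
    | hom n a ha =>
      rw [← mem_gr_iff] at ha
      induction t using tpow_induction with
      | zero => rw [TensorProduct.tmul_zero]; exact zero
      | add x y hx hy => rw [TensorProduct.tmul_add]; exact add _ _ hx hy
      | hom m t ht =>
        cases m with
        | zero =>
          rw [tpow_zero, Submodule.mem_one] at ht
          obtain ⟨c, rfl⟩ := ht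
          rw [Algebra.algebraMap_eq_smul_one, ← TensorProduct.smul_tmul]
          exact one n _ (Submodule.smul_mem _ c ha)
        | succ m =>
          rw [add_comm, tpow_add, tpow_one] at ht
          refine Submodule.mul_induction_on (C := fun t => p (a ⊗ₜ[k] t)) ht ?_ ?_
          · rintro _ ⟨v, rfl⟩ t ht
            exact ι_mul n a ha v m t ht
          · intro x y hx hy
            rw [TensorProduct.tmul_add]
            exact add _ _ hx hy

theorem leftδ_π (hR : R ≤ tpow k V s) (m : ℕ) (x : Alg R ⊗[k] TensorAlgebra k V) :
    leftδ R ((leftGr hR).π m x) = (leftGr hR).π m (leftδ R x) := by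
  induction x using tmul_word_induction hR with
  | zero => simp
  | add x y hx hy => simp only [map_add, hx, hy]
  | one n a ha =>
    rw [(leftGr hR).π_eq_ite (leftGr_tmul hR ha one_mem_tpow), leftδ_apply_one, map_zero]
    split_ifs
    · exact leftδ_apply_one _ _
    · exact map_zero _
  | ι_mul n a ha v j t ht =>
    rw [(leftGr hR).π_eq_ite (leftGr_tmul hR ha (mul_mem_tpow (ι_mem_tpow v) ht)), leftδ_apply, gen_apply,
      (leftGr hR).π_eq_ite (leftGr_tmul hR (mul_mem_gr ha (proj_mem_gr (ι_mem_tpow v))) ht),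
      ← add_assoc]
    split_ifs
    · exact leftδ_apply _ _ _ _
    · exact map_zero _

theorem leftδ_pow_π (hR : R ≤ tpow k V s) (r m : ℕ) (x : Alg R ⊗[k] TensorAlgebra k V) :
    (leftδ R ^ r) ((leftGr hR).π m x) = (leftGr hR).π m ((leftδ R ^ r) x) := by
  induction r with
  | zero => simp
  | succ r ih => rw [pow_succ', Module.End.mul_apply, ih, leftδ_π, Module.End.mul_apply]

theorem leftD_π (hR : R ≤ tpow k V s) (i m : ℕ) (x : Alg R ⊗[k] TensorAlgebra k V) :
    leftD R s i ((leftGr hR).π m x) = (leftGr hR).π m (leftD R s i x) := by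
  rw [leftD_eq, leftδ_pow_π]

theorem leftGr_π_mem (hR : R ≤ tpow k V s) {n : ℕ} (m : ℕ) {x : Alg R ⊗[k] TensorAlgebra k V}
    (hx : x ∈ (J R s n).baseChange (Alg R)) :
    (leftGr hR).π m x ∈ (J R s n).baseChange (Alg R) := by
  rw [mem_baseChange_iff] at hx ⊢
  refine map_mem_of_mem_tens ((leftGr hR).π m) _ ?_ hx
  intro a _ t ht
  have ht' := wordGr_of_mem_tpow (J_le_tpow n ht)
  rcases lt_or_ge m n with h | h
  · rw [leftGr, Grading.tensor_tmul_right_of_lt _ _ ht' h]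
    exact zero_mem _
  · obtain ⟨p, rfl⟩ := Nat.exists_eq_add_of_le' h
    rw [leftGr, Grading.tensor_tmul_right _ _ ht']
    exact tmul_mem_tens trivial ht

theorem leftGr_π_eq_zero (hR : R ≤ tpow k V s) {n m : ℕ} (h : m < n)
    {x : Alg R ⊗[k] TensorAlgebra k V}
    (hx : x ∈ (J R s n).baseChange (Alg R)) : (leftGr hR).π m x = 0 := by
  rw [mem_baseChange_iff] at hx
  refine (Submodule.mem_bot k).1 (map_mem_of_mem_tens ((leftGr hR).π m) ⊥ ?_ hx)
  intro a _ t ht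
  rw [leftGr, Grading.tensor_tmul_right_of_lt _ _ (wordGr_of_mem_tpow (J_le_tpow n ht)) h]
  exact zero_mem _

/-! ### Kernels in low degrees -/

variable (R) in
/-- The map `T(V) → A ⊗ T(V)` that sends `w t`, with `w` of length `r`, to `w ⊗ t`. -/
noncomputable def splitOff (r : ℕ) : TensorAlgebra k V →ₗ[k] Alg R ⊗[k] TensorAlgebra k V :=
  (leftδ R ^ r).restrictScalars k ∘ₗ TensorProduct.mk k _ _ 1

theorem splitOff_apply (r : ℕ) (t : TensorAlgebra k V) :
    splitOff R r t = (leftδ R ^ r) (1 ⊗ₜ[k] t) := rfl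

theorem splitOff_mul {r : ℕ} {w : TensorAlgebra k V} (hw : w ∈ tpow k V r)
    (t : TensorAlgebra k V) : splitOff R r (w * t) = proj R w ⊗ₜ[k] t := by
  rw [splitOff_apply, leftδ_pow_mul hw, one_mul]

theorem leftδ_pow_splitOff (q r : ℕ) (t : TensorAlgebra k V) :
    (leftδ R ^ q) (splitOff R r t) = splitOff R (q + r) t := by
  rw [splitOff_apply, splitOff_apply, pow_add, Module.End.mul_apply]

/-- Under the multiplication map, `splitOff R r` corresponds on `X ⊗ Y` to `proj ⊗ 1`, whose kernel
is known by flatness. -/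
theorem mem_mul_of_splitOff_eq_zero {r : ℕ} {X Y : Submodule k (TensorAlgebra k V)}
    (hX : X ≤ tpow k V r) {w : TensorAlgebra k V} (hw : w ∈ X * Y) (h0 : splitOff R r w = 0) :
    w ∈ (X ⊓ LinearMap.ker (proj R).toLinearMap) * Y := by
  rw [← map_mul'_tens] at hw ⊢
  obtain ⟨z, hz, rfl⟩ := hw
  have h1 : splitOff R r (LinearMap.mul' k _ z) = (proj R).toLinearMap.rTensor _ z := by
    refine sub_eq_zero.1 ((Submodule.mem_bot k).1 (map_mem_of_mem_tens
      (splitOff R r ∘ₗ LinearMap.mul' k _ - (proj R).toLinearMap.rTensor _) ⊥ ?_ hz))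
    intro x hx y _
    rw [Submodule.mem_bot, LinearMap.sub_apply, LinearMap.comp_apply, LinearMap.mul'_apply,
      splitOff_mul (hX hx), LinearMap.rTensor_tmul, AlgHom.toLinearMap_apply, sub_self]
  exact ⟨z, mem_tens_of_rTensor_eq_zero _ hz (h1.symm.trans h0), rfl⟩

/-- Fewer than `s` letters reach `A`, and in degrees below `s` the algebra `A` coincides with
`T(V)`. -/
theorem eq_zero_of_splitOff_eq_zero (hR : R ≤ tpow k V s) {r n : ℕ} (hr : r < s)
    {w : TensorAlgebra k V} (hw : w ∈ tpow k V (r + n)) (h0 : splitOff R r w = 0) : w = 0 := by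
  rw [tpow_add] at hw
  have := mem_mul_of_splitOff_eq_zero le_rfl hw h0
  rwa [tpow_inf_ker_of_lt hR hr, Submodule.bot_mul, Submodule.mem_bot] at this

theorem mem_mul_of_splitOff_s_eq_zero (hR : R ≤ tpow k V s) {n : ℕ}
    {w : TensorAlgebra k V} (hw : w ∈ tpow k V (s + n)) (h0 : splitOff R s w = 0) :
    w ∈ R * tpow k V n := by
  rw [tpow_add] at hw
  exact mul_le_mul_left (tpow_inf_ker_le hR) _ (mem_mul_of_splitOff_eq_zero le_rfl hw h0)

/-- In total degree `r + n` the module `A ⊗ J_n` is `A_r ⊗ J_n`, and `V^{⊗r}` covers `A_r`.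
Exactness in a single degree thereby becomes a question on subspaces of `T(V)`. -/
theorem exists_splitOff_eq (hR : R ≤ tpow k V s) {r n : ℕ} {x : Alg R ⊗[k] TensorAlgebra k V}
    (hx : x ∈ (J R s n).baseChange (Alg R)) (hx' : (leftGr hR).π (r + n) x = x) :
    ∃ w ∈ tpow k V r * J R s n, splitOff R r w = x := by
  rw [mem_baseChange_iff] at hx
  rw [← hx']
  refine map_mem_of_mem_tens ((leftGr hR).π (r + n)) ((tpow k V r * J R s n).map (splitOff R r))
    ?_ hx
  intro a _ t ht
  rw [leftGr, Grading.tensor_tmul_right _ _ (wordGr_of_mem_tpow (J_le_tpow n ht))]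
  obtain ⟨w, hw, hw'⟩ := algGr_π_mem hR r a
  refine ⟨w * t, Submodule.mul_mem_mul hw ht, ?_⟩
  rw [splitOff_mul hw, ← hw', AlgHom.toLinearMap_apply]

/-- The left Koszul complex is minimal. -/
theorem eq_zero_of_leftD_eq_zero (hs : 2 ≤ s) (hR : R ≤ tpow k V s) {i : ℕ}
    {x : Alg R ⊗[k] TensorAlgebra k V} (hx : x ∈ leftK R s (i + 1))
    (hx' : (leftGr hR).π (koszulDegree s (i + 1)) x = x) (h0 : leftD R s (i + 1) x = 0) :
    x = 0 := by
  -- In the degree of the generators, `x` is `1 ⊗ w`; the differential moves fewer than `s` letters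
  -- into `A`, so it loses nothing.
  obtain ⟨w, hw, rfl⟩ := exists_splitOff_eq hR (r := 0) hx (by rwa [zero_add])
  rw [tpow_zero, one_mul] at hw
  rw [leftD_eq, leftδ_pow_splitOff, add_zero] at h0
  have hw' := J_le_tpow _ hw
  rw [koszulDegree_succ hs] at hw'
  rw [eq_zero_of_splitOff_eq_zero hR (koszulStep_lt hs _) hw' h0, map_zero]

/-- The left Koszul complex is exact at its `i`-th term. -/
def LeftExact (R : Submodule k (TensorAlgebra k V)) (s i : ℕ) : Prop :=
  ∀ x ∈ leftK R s i, leftD R s i x = 0 → ∃ y ∈ leftK R s (i + 1), leftD R s (i + 1) y = x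

theorem exists_leftD_eq_of_mem_J {i : ℕ} {w : TensorAlgebra k V}
    (hw : w ∈ J R s (koszulDegree s (i + 1))) :
    ∃ y ∈ leftK R s (i + 1), leftD R s (i + 1) y = splitOff R (koszulStep s (i + 1)) w :=
  ⟨1 ⊗ₜ[k] w, Submodule.tmul_mem_baseChange_of_mem 1 hw, by rw [leftD_eq, splitOff_apply]⟩

/-- An element `w` of the intersection gives a cycle in `A_{j+1} ⊗ R`. By exactness at the second
term it is the boundary of an element of `A_j ⊗ J_{s+1}`; lifted to words, this says that `w` lies
in `V^{⊗j} J_{s+1}`, which is contained in `V^{⊗j} R V`. -/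
theorem mul_inf_mul_le (hR : R ≤ tpow k V s) (h2 : LeftExact R s 2) {j : ℕ}
    (hj : j + 1 < s) :
    R * tpow k V (j + 1) ⊓ tpow k V (j + 1) * R ≤ tpow k V j * R * tpow k V 1 := by
  rintro w ⟨hw, hw'⟩
  have hx : splitOff R (j + 1) w ∈ leftK R s 2 := by
    rw [leftK, koszulDegree_two, J_self hR, mem_baseChange_iff]
    refine Submodule.mul_induction_on
      (C := fun w => splitOff R (j + 1) w ∈ tens (⊤ : Submodule k (Alg R)) R) hw' ?_ ?_
    · intro u hu r hr
      rw [splitOff_mul hu]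
      exact tmul_mem_tens trivial hr
    · intro x y hx hy
      rw [map_add]
      exact add_mem hx hy
  have h0 : leftD R s 2 (splitOff R (j + 1) w) = 0 := by
    rw [leftD_eq, leftδ_pow_splitOff]
    have h1 : splitOff R s w = 0 := by
      refine Submodule.mul_induction_on (C := fun w => splitOff R s w = 0) hw ?_ ?_
      · intro r hr u _
        rw [splitOff_mul (hR hr), proj_mem R hr, TensorProduct.zero_tmul]
      · intro x y hx hy
        rw [map_add, hx, hy, add_zero]
    -- In all, `j + s` letters are split off, and the first `s` of them already form a relation.
    have h3 : koszulStep s 2 + (j + 1) = j + s := by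
      simp only [koszulStep, if_neg (by decide : ¬ Odd 2)]
      omega
    rw [h3, ← leftδ_pow_splitOff, h1, map_zero]
  obtain ⟨y, hy, hyx⟩ := h2 _ hx h0
  have hdeg : koszulDegree s 3 = s + 1 := by simp [koszulDegree]
  rw [leftK, hdeg] at hy
  -- The preimage `y` need not be homogeneous; only its component in the degree of `w` matters.
  obtain ⟨u, hu, huy⟩ := exists_splitOff_eq hR (r := j) (leftGr_π_mem hR (j + (s + 1)) hy)
    ((leftGr hR).idem _ _)
  have hwt : w ∈ tpow k V (j + 1 + s) := by
    rw [tpow_add]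
    exact mul_le_mul_right hR _ hw'
  have hut : u ∈ tpow k V (j + 1 + s) := by
    rw [show j + 1 + s = j + (s + 1) by omega, tpow_add]
    exact mul_le_mul_right (J_le_tpow _) _ hu
  have hxdeg : (leftGr hR).π (j + (s + 1)) (splitOff R (j + 1) w) = splitOff R (j + 1) w := by
    rw [splitOff_apply, ← leftδ_pow_π]
    have := leftGr_tmul hR (by simpa using proj_mem_gr (R := R) one_mem_tpow : (1 : Alg R) ∈ gr R 0)
      hwt
    rw [show j + (s + 1) = 0 + (j + 1 + s) by omega, this]
  have heq : splitOff R (j + 1) (w - u) = 0 := by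
    have h1 := leftδ_pow_splitOff (R := R) 1 j u
    rw [huy, pow_one, leftδ_π] at h1
    rw [leftD_eq, koszulStep, if_pos (by decide), pow_one] at hyx
    rw [hyx, hxdeg, add_comm 1 j] at h1
    rw [map_sub, h1, sub_self]
  -- The two words agree after `j + 1 < s` letters are sent to `A`, hence they are equal.
  have hwu := eq_zero_of_splitOff_eq_zero hR hj (sub_mem hwt hut) heq
  rw [sub_eq_zero.1 hwu, mul_assoc]
  refine mem_mul_of_le ?_ hu
  have := J_le_mul_right (R := R) (show s ≤ s + 1 by omega)
  rwa [Nat.add_sub_cancel_left] at this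

/-- The extra condition of Koszul algebras. -/
theorem mul_inf_mul_le_of_add_eq (hR : R ≤ tpow k V s) (h2 : LeftExact R s 2)
    {i j : ℕ} (hij : i + j + 1 = s) :
    R * tpow k V (s - 1) ⊓ tpow k V (s - 1) * R ≤ tpow k V i * R * tpow k V j := by
  induction j generalizing i with
  | zero =>
    rw [tpow_zero, mul_one, show s - 1 = i by omega]
    exact inf_le_right
  | succ j ih =>
    intro w hw
    have h1 := ih (i := i + 1) (by omega) hw
    have h3 := hw.1
    rw [show s - 1 = i + 1 + j by omega, tpow_add, ← mul_assoc] at h3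
    -- Both memberships have the right factor `V^{⊗j}`; once it is cancelled, `mul_inf_mul_le` moves
    -- `R` one place to the left.
    have h4 := mul_le_mul_left (mul_inf_mul_le hR h2 (j := i) (by omega)) _
      (inf_mul_tpow _ _ _ ⟨h3, h1⟩)
    rwa [mul_assoc, ← tpow_add, add_comm 1 j] at h4

/-- In the degree in which the next term is generated, the left Koszul complex is exact. -/
theorem exists_leftD_eq_of_degree (hs : 2 ≤ s) (hR : R ≤ tpow k V s) {i : ℕ}
    (h2 : 2 ≤ i → LeftExact R s 2) {x : Alg R ⊗[k] TensorAlgebra k V}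
    (hx : x ∈ leftK R s (i + 1)) (hx' : (leftGr hR).π (koszulDegree s (i + 2)) x = x)
    (h0 : leftD R s (i + 1) x = 0) :
    ∃ y ∈ leftK R s (i + 2), leftD R s (i + 2) y = x := by
  have hdeg : koszulDegree s (i + 2) = koszulStep s (i + 2) + koszulDegree s (i + 1) :=
    koszulDegree_succ hs (i + 1)
  rw [hdeg] at hx'
  obtain ⟨w, hw, rfl⟩ := exists_splitOff_eq hR hx hx'
  refine exists_leftD_eq_of_mem_J ?_
  change w ∈ J R s (koszulDegree s (i + 2))
  rw [leftD_eq, leftδ_pow_splitOff, koszulStep_add hs] at h0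
  have hwt : w ∈ tpow k V (koszulDegree s (i + 2)) := by
    rw [hdeg, tpow_add]
    exact mul_le_mul_right (J_le_tpow _) _ hw
  have hle := le_koszulDegree (s := s) i
  -- The next two differentials together split off `s` letters, so the cycle condition says that `w`
  -- begins with a relation.
  have hw0 : w ∈ R * tpow k V (koszulDegree s (i + 2) - s) := by
    refine mem_mul_of_splitOff_s_eq_zero hR ?_ h0
    rwa [Nat.add_sub_cancel' hle]
  rw [mem_J]
  refine ⟨hwt, fun a b hab => ?_⟩
  rcases Nat.eq_zero_or_pos a with rfl | ha
  · rw [tpow_zero, one_mul, show b = koszulDegree s (i + 2) - s by omega]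
    exact hw0
  -- Positions at or after the letters already moved into `A` are covered by the factor `J_{n(i+1)}`
  -- of `w`.
  rcases le_or_gt (koszulStep s (i + 2)) a with hra | hra
  · obtain ⟨c, rfl⟩ := Nat.exists_eq_add_of_le hra
    rw [tpow_add, mul_assoc, mul_assoc]
    refine mem_mul_of_le ?_ hw
    intro t ht
    rw [← mul_assoc]
    exact (mem_J.1 ht).2 _ _ (by omega)
  -- Positions strictly between the two ends occur only when the step is `s - 1`. There `w` begins
  -- with `R V^{⊗(s-1)}` and also with `V^{⊗(s-1)} R`, and the extra condition fills the gap. For `i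
  -- = 0` the word has length `s` and no such position exists.
  · have hstep : koszulStep s (i + 2) = s - 1 := by
      unfold koszulStep at hra ⊢
      split_ifs at hra ⊢
      · omega
      · rfl
    have hi1 : i ≠ 1 := by
      rintro rfl
      rw [koszulStep, if_pos (by decide)] at hra
      omega
    rw [hstep] at hra hw hdeg
    have hi : i ≠ 0 := by
      rintro rfl
      rw [koszulDegree_two] at hab
      omega
    have hn : s ≤ koszulDegree s (i + 1) := by
      obtain ⟨c, rfl⟩ := Nat.exists_eq_succ_of_ne_zero hi
      exact le_koszulDegree c
    have hw1 : w ∈ tpow k V (s - 1) * R * tpow k V (koszulDegree s (i + 1) - s) := by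
      rw [mul_assoc]
      exact mul_le_mul_right (J_le_mul_right hn) _ hw
    rw [show koszulDegree s (i + 2) - s = s - 1 + (koszulDegree s (i + 1) - s) by omega,
      tpow_add, ← mul_assoc] at hw0
    have h4 := mul_le_mul_left
      (mul_inf_mul_le_of_add_eq hR (h2 (by omega)) (i := a) (j := s - 1 - a) (by omega)) _
      (inf_mul_tpow _ _ _ ⟨hw0, hw1⟩)
    rwa [mul_assoc, ← tpow_add,
      show s - 1 - a + (koszulDegree s (i + 1) - s) = b by omega] at h4

/-! ### Exactness of the left Koszul complex at its first terms -/

theorem leftK_one (hs : 2 ≤ s) : leftK R s 1 = (tpow k V 1).baseChange (Alg R) := by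
  rw [leftK, koszulDegree_one, J_of_lt (by omega)]

theorem leftD_one : leftD R s 1 = leftδ R := by simp [leftD]

theorem exists_leftD_one_iff (hs : 2 ≤ s) (x : Alg R ⊗[k] TensorAlgebra k V) :
    x ∈ (leftK R s 1).map (leftD R s 1) ↔ ∃ a ∈ aug R, x = a ⊗ₜ[k] (1 : TensorAlgebra k V) := by
  rw [leftK_one hs, leftD_one]
  constructor
  · rintro ⟨y, hy, rfl⟩
    rw [SetLike.mem_coe, mem_baseChange_iff] at hy
    suffices h : leftδ R y ∈ (aug R).map ((TensorProduct.mk k (Alg R) (TensorAlgebra k V)).flip 1)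
      by
      obtain ⟨a, ha, h⟩ := h
      exact ⟨a, ha, h.symm⟩
    refine map_mem_of_mem_tens ((leftδ R).restrictScalars k) _ ?_ hy
    intro a _ t ht
    rw [tpow_one] at ht
    obtain ⟨v, rfl⟩ := ht
    have h1 := leftδ_apply R a v 1
    rw [mul_one] at h1
    rw [LinearMap.restrictScalars_apply, h1]
    refine ⟨a * gen R v, ?_, rfl⟩
    clear h1
    obtain ⟨t, rfl⟩ := proj_surjective R a
    induction t using tpow_induction with
    | zero => rw [map_zero, zero_mul]; exact zero_mem _
    | add x y hx hy => rw [map_add, add_mul]; exact add_mem (hx trivial) (hy trivial)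
    | hom n t ht =>
      exact gr_succ_le_aug n (mul_mem_gr (proj_mem_gr ht) (proj_mem_gr (ι_mem_tpow v)))
  · rintro ⟨a, ha, rfl⟩
    suffices h : aug R ≤ (((((tpow k V 1).baseChange (Alg R)).map (leftδ R)).restrictScalars k).comap
        ((TensorProduct.mk k (Alg R) (TensorAlgebra k V)).flip 1)) from h ha
    refine iSup_le fun n => ?_
    rw [← gr_mul_gr, Submodule.mul_le]
    rintro a _ _ ⟨t, ht, rfl⟩
    rw [SetLike.mem_coe, tpow_one] at ht
    obtain ⟨v, rfl⟩ := ht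
    refine ⟨a ⊗ₜ TensorAlgebra.ι k v, Submodule.tmul_mem_baseChange_of_mem _ (ι_mem_tpow v), ?_⟩
    have h1 := leftδ_apply R a v 1
    rw [mul_one] at h1
    rw [h1]
    rfl

theorem tmul_one_eq_zero {B : Type w} [AddCommGroup B] [Module k B] {b : B}
    (h : b ⊗ₜ[k] (1 : TensorAlgebra k V) = 0) : b = 0 := by
  have := congrArg (TensorProduct.rid k B ∘
    (TensorAlgebra.algebraMapInv (R := k) (M := V)).toLinearMap.lTensor B) h
  simpa using this

variable (R) in
/-- The map `T(V) → A ⊗ V` that splits off the last letter. -/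
noncomputable def splitLast : TensorAlgebra k V →ₗ[k] Alg R ⊗[k] TensorAlgebra k V :=
  TensorProduct.map (proj R).toLinearMap (TensorAlgebra.ι k) ∘ₗ tail k V

theorem splitLast_mul_ι (t : TensorAlgebra k V) (v : V) :
    splitLast R (t * TensorAlgebra.ι k v) = proj R t ⊗ₜ TensorAlgebra.ι k v := by
  simp [splitLast, tail_mul_ι]

/-- For `r = s - 1` and `u` in `R`, the right side is a value of the second differential. -/
theorem splitLast_mul (a : TensorAlgebra k V) {r : ℕ} {u : TensorAlgebra k V}
    (hu : u ∈ tpow k V (r + 1)) :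
    splitLast R (a * u) = (leftδ R ^ r) (proj R a ⊗ₜ[k] u) := by
  rw [tpow_add, tpow_one] at hu
  refine Submodule.mul_induction_on
    (C := fun u => splitLast R (a * u) = (leftδ R ^ r) (proj R a ⊗ₜ[k] u)) hu ?_ ?_
  · rintro w hw _ ⟨v, rfl⟩
    rw [← mul_assoc, splitLast_mul_ι, leftδ_pow_mul hw, map_mul]
  · intro x y hx hy
    rw [mul_add, map_add, hx, hy, TensorProduct.tmul_add, map_add]

/-- A cycle in `A ⊗ V` lifts to a word `t` whose image in `A` is its boundary, so `t` lies in the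
ideal generated by `R`. On a product `a r b`, splitting off the last letter gives zero if `b` has
positive length, and a boundary if `b` is a scalar. -/
theorem leftExact_one (hs : 2 ≤ s) (hR : R ≤ tpow k V s) : LeftExact R s 1 := by
  have hker : ∀ t, proj R t = 0 → splitLast R t ∈ (leftK R s 2).map (leftD R s 2) := by
    intro t ht
    refine proj_eq_zero_induction
      (p := fun t => splitLast R t ∈ (leftK R s 2).map (leftD R s 2)) ?_ ?_ ?_ ht
    · rw [map_zero]; exact zero_mem _
    · intro x y hx hy
      rw [map_add]
      exact add_mem hx hy
    · intro i j a _ r hr b hb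
      cases j with
      | zero =>
        rw [tpow_zero, Submodule.mem_one] at hb
        obtain ⟨c, rfl⟩ := hb
        rw [mul_assoc, ← Algebra.commutes, ← Algebra.smul_def]
        have hr' := R.smul_mem c hr
        refine ⟨proj R a ⊗ₜ (c • r), ?_, ?_⟩
        · refine Submodule.tmul_mem_baseChange_of_mem _ ?_
          rwa [koszulDegree_two, J_self hR]
        · rw [splitLast_mul a (r := s - 1), leftD_eq, koszulStep, if_neg (by decide)]
          rw [Nat.sub_add_cancel (by omega)]
          exact hR hr'
      | succ j =>
        rw [tpow_add, tpow_one] at hb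
        refine Submodule.mul_induction_on
          (C := fun b => splitLast R (a * r * b) ∈ (leftK R s 2).map (leftD R s 2)) hb ?_ ?_
        · rintro b _ _ ⟨v, rfl⟩
          rw [← mul_assoc, splitLast_mul_ι, map_mul, map_mul, proj_mem R hr, mul_zero, zero_mul,
            TensorProduct.zero_tmul]
          exact zero_mem _
        · intro x y hx hy
          rw [mul_add, map_add]
          exact add_mem hx hy
  intro x hx h0
  rw [leftK_one hs, mem_baseChange_iff] at hx
  -- The kernel condition excludes constant terms, which `splitLast` would kill although they
  -- survive in `A`.
  have h1 : x ∈ (LinearMap.ker ((leftδ R).restrictScalars k ∘ₗ splitLast R -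
      (TensorProduct.mk k (Alg R) (TensorAlgebra k V)).flip 1 ∘ₗ (proj R).toLinearMap)).map
      (splitLast R) := by
    refine map_mem_of_mem_tens LinearMap.id _ ?_ hx
    intro a _ t ht
    rw [tpow_one] at ht
    obtain ⟨v, rfl⟩ := ht
    obtain ⟨u, rfl⟩ := proj_surjective R a
    refine ⟨u * TensorAlgebra.ι k v, ?_, splitLast_mul_ι u v⟩
    have h2 := leftδ_apply R (proj R u) v 1
    rw [mul_one] at h2
    rw [SetLike.mem_coe, LinearMap.mem_ker, LinearMap.sub_apply, LinearMap.comp_apply,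
      splitLast_mul_ι, LinearMap.restrictScalars_apply, h2, sub_eq_zero]
    simp [gen_apply]
  obtain ⟨t, ht, rfl⟩ := h1
  rw [SetLike.mem_coe, LinearMap.mem_ker, LinearMap.sub_apply, sub_eq_zero, LinearMap.comp_apply,
    LinearMap.restrictScalars_apply, ← leftD_one (s := s), h0] at ht
  exact hker t (tmul_one_eq_zero ht.symm)

end Left

/-! ### Dimension shifting -/

section Shift

variable {k : Type u} [Field k] {U : Type v} [AddCommGroup U] [Module k U]
  {W : Type w} [AddCommGroup W] [Module k W]

/-- The endomorphism `e` of the complex `(C, D)` acts as zero on its `n`-th homology. -/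
def KillsHomology (e D : Module.End k U) (C : ℕ → Submodule k U) (n : ℕ) : Prop :=
  ∀ x ∈ C n, D x = 0 → ∃ y ∈ C (n + 1), D y = e x

/-- Dimension shifting. -/
theorem killsHomology_shift {e D : Module.End k U} {e' D' : Module.End k W} (φ : U →ₗ[k] W)
    {X Y : ℕ → Submodule k U} {Z : ℕ → Submodule k W} {n : ℕ}
    (hX : ∀ j, X j = Y j ⊓ LinearMap.ker φ) (hZ : ∀ j, Z j = (Y j).map φ)
    (hDY : ∀ j, ∀ y ∈ Y (j + 1), D y ∈ Y j) (hDD : ∀ y, D (D y) = 0)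
    (hφD : ∀ y, φ (D y) = D' (φ y)) (heD : ∀ y, D (e y) = e (D y))
    (hφe : ∀ y, φ (e y) = e' (φ y)) (heY : ∀ j, ∀ y ∈ Y j, e y ∈ Y j)
    (h1 : ∀ x ∈ X n, D x = 0 → ∃ y ∈ Y (n + 1), D y = x)
    (h2 : ∀ x ∈ Y (n + 1), D x = 0 → ∃ y ∈ Y (n + 2), D y = x) :
    KillsHomology e' D' Z (n + 1) ↔ KillsHomology e D X n := by
  constructor
  · intro h x hx hx0
    -- In the sequence `0 → X → Y → Z → 0`, the class of `φ y` is sent to that of `D y` by the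
    -- connecting map. Here `h1` says that `H_n(X) → H_n(Y)` is zero and `h2` that `H_{n+1}(Y)`
    -- vanishes; `H_n(Y)` itself may be nonzero.
    obtain ⟨y, hy, rfl⟩ := h1 x hx hx0
    rw [hX] at hx
    obtain ⟨z, hz, hz'⟩ := h (φ y) (by rw [hZ]; exact ⟨y, hy, rfl⟩) (by rw [← hφD]; exact hx.2)
    rw [hZ] at hz
    obtain ⟨y', hy', rfl⟩ := hz
    refine ⟨e y - D y', ?_, ?_⟩
    · rw [hX]
      refine ⟨sub_mem (heY _ _ hy) (hDY _ _ hy'), ?_⟩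
      rw [SetLike.mem_coe, LinearMap.mem_ker, map_sub, hφe, hφD, hz', sub_self]
    · rw [map_sub, hDD, sub_zero, heD]
  · intro h z hz hz0
    rw [hZ] at hz
    obtain ⟨y, hy, rfl⟩ := hz
    obtain ⟨x, hx, hx'⟩ := h (D y) (by rw [hX]; exact ⟨hDY _ _ hy, by
      rw [SetLike.mem_coe, LinearMap.mem_ker, hφD]; exact hz0⟩) (hDD y)
    rw [hX] at hx
    -- Both `e y` and `x` have the boundary `e (D y)`, and `x` disappears in `Z`.
    obtain ⟨y', hy', hy''⟩ := h2 (e y - x) (sub_mem (heY _ _ hy) hx.1) (by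
      rw [map_sub, hx', heD, sub_self])
    refine ⟨φ y', by rw [hZ]; exact ⟨y', hy', rfl⟩, ?_⟩
    rw [← hφD, hy'', map_sub, LinearMap.mem_ker.1 hx.2, sub_zero, hφe]

end Shift

/-! ### The reduced bar complex with coefficients in a module -/

section Bar

variable {k : Type u} [Field k] {V : Type v} [AddCommGroup V] [Module k V]
variable (R : Submodule k (TensorAlgebra k V)) {s : ℕ}
variable (N : Type w) [AddCommGroup N] [Module k N]

/-- Multiplication by a letter from the left, on the bar complex with coefficients. -/
noncomputable def coeffMul :
    aug R →ₗ[k] Module.End k (TensorAlgebra k (aug R) ⊗[k] N) where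
  toFun a := (LinearMap.mul k _ (TensorAlgebra.ι k a)).rTensor N
  map_add' a b := by simp [LinearMap.rTensor_add]
  map_smul' c a := by simp [LinearMap.rTensor_smul]

theorem coeffMul_tmul (a : aug R) (t : TensorAlgebra k (aug R)) (n : N) :
    coeffMul R N a (t ⊗ₜ n) = (TensorAlgebra.ι k a * t) ⊗ₜ n := rfl

variable {R N} in
/-- The induction principle for the bar complex with coefficients. -/
theorem coeff_induction {p : TensorAlgebra k (aug R) ⊗[k] N → Prop} (zero : p 0)
    (add : ∀ x y, p x → p y → p (x + y)) (one : ∀ n, p (1 ⊗ₜ n))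
    (mul : ∀ a t n, p (t ⊗ₜ n) → p (coeffMul R N a (t ⊗ₜ n)))
    (x : TensorAlgebra k (aug R) ⊗[k] N) : p x := by
  induction x with
  | zero => exact zero
  | add x y hx hy => exact add x y hx hy
  | tmul t n =>
    induction t using word_induction generalizing n with
    | one => exact one n
    | smul c t ht => rw [TensorProduct.smul_tmul]; exact ht _
    | add s t hs ht => rw [TensorProduct.add_tmul]; exact add _ _ (hs n) (ht n)
    | ι_mul a t ht => exact mul a t n (ht n)

variable [Module (Alg R) N] [IsScalarTower k (Alg R) N]

/-- The action of `A_+` on a module. -/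
noncomputable def augAct : aug R →ₗ[k] Module.End k N :=
  (Algebra.lsmul k k N).toLinearMap ∘ₗ (aug R).subtype

theorem augAct_apply (a : aug R) (n : N) : augAct R N a n = (a : Alg R) • n := rfl

/-- Multiplication of an element of `A_+` into the first letter, or into the coefficient
if there is no letter. -/
noncomputable def coeffContract :
    aug R →ₗ[k] Module.End k (TensorAlgebra k (aug R) ⊗[k] N) where
  toFun a := (barContract R a ∘ₗ head k (aug R)).rTensor N +
    TensorProduct.map (Algebra.linearMap k _ ∘ₗ
      (TensorAlgebra.algebraMapInv (R := k) (M := aug R)).toLinearMap) (augAct R N a)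
  map_add' a b := by
    rw [map_add, map_add, LinearMap.add_comp, LinearMap.rTensor_add, TensorProduct.map_add_right]
    abel
  map_smul' c a := by
    rw [map_smul, map_smul, LinearMap.smul_comp, LinearMap.rTensor_smul,
      TensorProduct.map_smul_right, RingHom.id_apply, smul_add]

theorem coeffContract_one (a : aug R) (n : N) :
    coeffContract R N a (1 ⊗ₜ n) = 1 ⊗ₜ ((a : Alg R) • n) := by
  simp [coeffContract, head_one, augAct_apply]

theorem coeffContract_ι_mul (a b : aug R) (t : TensorAlgebra k (aug R)) (n : N) :
    coeffContract R N a ((TensorAlgebra.ι k b * t) ⊗ₜ n) =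
      (TensorAlgebra.ι k (augMul R a b) * t) ⊗ₜ n := by
  simp [coeffContract, head_ι_mul, barContract_tmul, algebraMapInv_ι]

/-- Auxiliary: the letter `a` acts by `(u, w) ↦ (a u, a · u - a w)`. -/
noncomputable def coeffStep : aug R →ₗ[k] Module.End k
    ((TensorAlgebra k (aug R) ⊗[k] N) × (TensorAlgebra k (aug R) ⊗[k] N)) :=
  LinearMap.mk₂ k
    (fun a x => (coeffMul R N a x.1, coeffContract R N a x.1 - coeffMul R N a x.2))
    (fun a b x => by
      ext1
      · simp
      · simp only [map_add, LinearMap.add_apply, Prod.mk_add_mk]; abel)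
    (fun c a x => by simp [smul_sub])
    (fun a x y => by
      ext1
      · simp
      · simp only [map_add, Prod.mk_add_mk, Prod.fst_add, Prod.snd_add]; abel)
    (fun c a x => by simp [smul_sub])

theorem coeffStep_apply (a : aug R)
    (x : (TensorAlgebra k (aug R) ⊗[k] N) × (TensorAlgebra k (aug R) ⊗[k] N)) :
    coeffStep R N a x = (coeffMul R N a x.1, coeffContract R N a x.1 - coeffMul R N a x.2) := rfl

/-- The differential of the reduced bar complex with coefficients in `N`. -/
noncomputable def coeffD : Module.End k (TensorAlgebra k (aug R) ⊗[k] N) :=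
  TensorProduct.lift
    (LinearMap.lcomp k _ (LinearMap.inl k _ _ ∘ₗ TensorProduct.mk k (TensorAlgebra k (aug R)) N 1) ∘ₗ
      LinearMap.compRight k (LinearMap.snd k _ _) ∘ₗ
      (TensorAlgebra.lift k (coeffStep R N)).toLinearMap)

theorem coeffD_tmul (t : TensorAlgebra k (aug R)) (n : N) :
    coeffD R N (t ⊗ₜ n) = (TensorAlgebra.lift k (coeffStep R N) t (1 ⊗ₜ n, 0)).2 := rfl

theorem coeffD_one (n : N) : coeffD R N (1 ⊗ₜ n) = 0 := by simp [coeffD_tmul]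

theorem coeffD_ι_mul (a : aug R) (t : TensorAlgebra k (aug R)) (n : N) :
    coeffD R N ((TensorAlgebra.ι k a * t) ⊗ₜ n) =
      coeffContract R N a (t ⊗ₜ n) - coeffMul R N a (coeffD R N (t ⊗ₜ n)) := by
  have h : ∀ t : TensorAlgebra k (aug R),
      (TensorAlgebra.lift k (coeffStep R N) t (1 ⊗ₜ n, 0)).1 = t ⊗ₜ n := by
    intro t
    induction t using word_induction with
    | one => simp
    | smul c t ht => simp [ht, TensorProduct.smul_tmul']
    | add s t hs ht => simp [hs, ht, TensorProduct.add_tmul]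
    | ι_mul a t ht => simp [coeffStep_apply, ht, coeffMul_tmul]
  simp [coeffD_tmul, coeffStep_apply, h]

/-- This recursion, with `coeffD_one`, determines the differential; its properties are proved from
it by induction on words, without the alternating sum. -/
theorem coeffD_coeffMul (a : aug R) (u : TensorAlgebra k (aug R) ⊗[k] N) :
    coeffD R N (coeffMul R N a u) = coeffContract R N a u - coeffMul R N a (coeffD R N u) := by
  induction u with
  | zero => simp
  | add x y hx hy => simp only [map_add, hx, hy]; abel
  | tmul t n => rw [coeffMul_tmul, coeffD_ι_mul]

variable {R N}

theorem coeffContract_coeffMul (a b : aug R) (u : TensorAlgebra k (aug R) ⊗[k] N) :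
    coeffContract R N a (coeffMul R N b u) = coeffMul R N (augMul R a b) u := by
  induction u with
  | zero => simp
  | add x y hx hy => simp only [map_add, hx, hy]
  | tmul t n => rw [coeffMul_tmul, coeffContract_ι_mul, coeffMul_tmul]

theorem coeffContract_coeffContract (a b : aug R) (u : TensorAlgebra k (aug R) ⊗[k] N) :
    coeffContract R N a (coeffContract R N b u) = coeffContract R N (augMul R a b) u := by
  induction u using coeff_induction with
  | zero => simp
  | add x y hx hy => simp only [map_add, hx, hy]
  | one n =>
    rw [coeffContract_one, coeffContract_one, coeffContract_one, smul_smul]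
    rfl
  | mul c t n _ =>
    rw [coeffContract_coeffMul, coeffContract_coeffMul, coeffContract_coeffMul]
    congr 2
    exact Subtype.ext (mul_assoc _ _ _).symm

theorem coeffD_coeffContract (a : aug R) (u : TensorAlgebra k (aug R) ⊗[k] N) :
    coeffD R N (coeffContract R N a u) = coeffContract R N a (coeffD R N u) := by
  induction u using coeff_induction with
  | zero => simp
  | add x y hx hy => simp only [map_add, hx, hy]
  | one n => rw [coeffContract_one, coeffD_one, coeffD_one, map_zero]
  | mul b t n _ =>
    rw [coeffContract_coeffMul, coeffD_coeffMul, coeffD_coeffMul, map_sub,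
      coeffContract_coeffContract, coeffContract_coeffMul]

/-- The contraction commutes with `D`, so in `D (a · u - a D u)` the terms `a · D u` cancel and `a D
(D u)` is left. -/
theorem coeffD_coeffD (u : TensorAlgebra k (aug R) ⊗[k] N) : coeffD R N (coeffD R N u) = 0 := by
  induction u using coeff_induction with
  | zero => simp
  | add x y hx hy => simp only [map_add, hx, hy, add_zero]
  | one n => rw [coeffD_one, map_zero]
  | mul a t n h =>
    rw [coeffD_coeffMul, map_sub, coeffD_coeffContract, coeffD_coeffMul, h, map_zero, sub_zero,
      sub_self]

section Naturality

variable (f : N →ₗ[Alg R] N)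

theorem lTensor_coeffMul (a : aug R) (u : TensorAlgebra k (aug R) ⊗[k] N) :
    (f.restrictScalars k).lTensor _ (coeffMul R N a u) =
      coeffMul R N a ((f.restrictScalars k).lTensor _ u) := by
  induction u with
  | zero => simp
  | add x y hx hy => simp only [map_add, hx, hy]
  | tmul t n => rfl

theorem lTensor_coeffContract (a : aug R) (u : TensorAlgebra k (aug R) ⊗[k] N) :
    (f.restrictScalars k).lTensor _ (coeffContract R N a u) =
      coeffContract R N a ((f.restrictScalars k).lTensor _ u) := by
  induction u using coeff_induction with
  | zero => simp
  | add x y hx hy => simp only [map_add, hx, hy]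
  | one n => simp [coeffContract_one]
  | mul b t n _ => rw [coeffContract_coeffMul, lTensor_coeffMul, lTensor_coeffMul,
      coeffContract_coeffMul]

theorem lTensor_coeffD (u : TensorAlgebra k (aug R) ⊗[k] N) :
    (f.restrictScalars k).lTensor _ (coeffD R N u) =
      coeffD R N ((f.restrictScalars k).lTensor _ u) := by
  induction u using coeff_induction with
  | zero => simp
  | add x y hx hy => simp only [map_add, hx, hy]
  | one n => rw [coeffD_one, LinearMap.lTensor_tmul, coeffD_one, map_zero]
  | mul a t n h =>
    rw [lTensor_coeffMul, coeffD_coeffMul, coeffD_coeffMul, map_sub, lTensor_coeffContract,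
      lTensor_coeffMul, h]

end Naturality

/-- The term `A_+^{⊗ p} ⊗ M` of the bar complex. -/
noncomputable def barTerm (M : Submodule (Alg R) N) (p : ℕ) :
    Submodule k (TensorAlgebra k (aug R) ⊗[k] N) :=
  tens (tpow k (aug R) p) (M.restrictScalars k)

theorem coeffMul_mem_barTerm {M : Submodule (Alg R) N} {p : ℕ} (a : aug R)
    {u : TensorAlgebra k (aug R) ⊗[k] N} (hu : u ∈ barTerm M p) :
    coeffMul R N a u ∈ barTerm M (p + 1) := by
  refine map_mem_of_mem_tens (coeffMul R N a) _ ?_ hu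
  intro t ht n hn
  rw [coeffMul_tmul]
  refine tmul_mem_tens ?_ hn
  rw [add_comm]
  exact mul_mem_tpow (ι_mem_tpow a) ht

theorem mem_barTerm_zero {M : Submodule (Alg R) N} {u : TensorAlgebra k (aug R) ⊗[k] N} :
    u ∈ barTerm M 0 ↔ ∃ n ∈ M, u = 1 ⊗ₜ n := by
  constructor
  · intro hu
    suffices h : u ∈ (M.restrictScalars k).map (TensorProduct.mk k (TensorAlgebra k (aug R)) N 1) by
      obtain ⟨n, hn, rfl⟩ := h
      exact ⟨n, hn, rfl⟩
    refine map_mem_of_mem_tens LinearMap.id _ ?_ hu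
    intro t ht n hn
    rw [tpow_zero, Submodule.mem_one] at ht
    obtain ⟨c, rfl⟩ := ht
    refine ⟨c • n, Submodule.smul_mem _ c hn, ?_⟩
    rw [TensorProduct.mk_apply, ← TensorProduct.smul_tmul, Algebra.algebraMap_eq_smul_one]
    rfl
  · rintro ⟨n, hn, rfl⟩
    exact tmul_mem_tens one_mem_tpow hn

/-- The terms of positive length are spanned by the products of a letter with a shorter word. -/
theorem map_mem_of_mem_barTerm_succ {M : Submodule (Alg R) N} {p : ℕ} {L : Type x}
    [AddCommGroup L] [Module k L]
    (F : TensorAlgebra k (aug R) ⊗[k] N →ₗ[k] L) (S : Submodule k L)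
    (h : ∀ a, ∀ t ∈ tpow k (aug R) p, ∀ n ∈ M, F (coeffMul R N a (t ⊗ₜ n)) ∈ S)
    {u : TensorAlgebra k (aug R) ⊗[k] N}
    (hu : u ∈ barTerm M (p + 1)) : F u ∈ S := by
  refine map_mem_of_mem_tens F S ?_ hu
  intro t ht n hn
  rw [add_comm, tpow_add, tpow_one] at ht
  refine Submodule.mul_induction_on (C := fun t => F (t ⊗ₜ n) ∈ S) ht ?_ ?_
  · rintro _ ⟨a, rfl⟩ t ht
    exact h a t ht n hn
  · intro x y hx hy
    rw [TensorProduct.add_tmul, map_add]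
    exact add_mem hx hy

theorem coeffContract_mem_barTerm {M : Submodule (Alg R) N} {p : ℕ} (a : aug R)
    {u : TensorAlgebra k (aug R) ⊗[k] N} (hu : u ∈ barTerm M p) :
    coeffContract R N a u ∈ barTerm M p := by
  cases p with
  | zero =>
    rw [mem_barTerm_zero] at hu ⊢
    obtain ⟨n, hn, rfl⟩ := hu
    exact ⟨_, M.smul_mem a hn, coeffContract_one R N a n⟩
  | succ p =>
    refine map_mem_of_mem_barTerm_succ (coeffContract R N a) _ ?_ hu
    intro b t ht n hn
    rw [coeffContract_coeffMul]
    exact coeffMul_mem_barTerm _ (tmul_mem_tens ht hn)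

theorem coeffD_mem_barTerm {M : Submodule (Alg R) N} {p : ℕ}
    {u : TensorAlgebra k (aug R) ⊗[k] N} (hu : u ∈ barTerm M (p + 1)) :
    coeffD R N u ∈ barTerm M p := by
  induction p generalizing u with
  | zero =>
    refine map_mem_of_mem_barTerm_succ (coeffD R N) _ ?_ hu
    intro a t ht n hn
    have h1 : t ⊗ₜ n ∈ barTerm M 0 := tmul_mem_tens ht hn
    obtain ⟨n', hn', h2⟩ := mem_barTerm_zero.1 h1
    rw [coeffD_coeffMul, h2, coeffD_one, map_zero, sub_zero]
    exact coeffContract_mem_barTerm a (tmul_mem_tens one_mem_tpow hn')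
  | succ p ih =>
    refine map_mem_of_mem_barTerm_succ (coeffD R N) _ ?_ hu
    intro a t ht n hn
    rw [coeffD_coeffMul]
    exact sub_mem (coeffContract_mem_barTerm a (tmul_mem_tens ht hn))
      (coeffMul_mem_barTerm a (ih (tmul_mem_tens ht hn)))

end Bar

/-! ### Acyclicity of the bar complex with free coefficients -/

section Free

variable {k : Type u} [Field k] {V : Type v} [AddCommGroup V] [Module k V]
variable {R : Submodule k (TensorAlgebra k V)} {s : ℕ} (hs : s ≠ 0) (hR : R ≤ tpow k V s)

/-- The projection of `A` onto its augmentation ideal. -/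
noncomputable def toAug : Alg R →ₗ[k] aug R :=
  (LinearMap.id - Algebra.linearMap k (Alg R) ∘ₗ counit hs hR).codRestrict (aug R)
    (sub_counit_mem_aug hs hR)

theorem coe_toAug (a : Alg R) :
    (toAug hs hR a : Alg R) = a - algebraMap k _ (counit hs hR a) := rfl

section Homotopy

variable {N : Type x} [AddCommGroup N] [Module k N]
variable {Y : Type w} (η : Y → N) (β : N →ₗ[k] TensorAlgebra k (aug R) ⊗[k] N)

/-- The operator `[a₁|…|aₙ] ⊗ x ↦ (-1)^n [a₁|…|aₙ|β x]` on the bar complex. -/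
noncomputable def freeHomotopy : Module.End k (TensorAlgebra k (aug R) ⊗[k] N) :=
  TensorProduct.lift
    (LinearMap.lcomp k _ β ∘ₗ LinearMap.rTensorHom N ∘ₗ
      LinearMap.mul k (TensorAlgebra k (aug R)) ∘ₗ
        (TensorAlgebra.lift k (-TensorAlgebra.ι k (M := aug R))).toLinearMap)

theorem freeHomotopy_tmul (t : TensorAlgebra k (aug R)) (n : N) :
    freeHomotopy β (t ⊗ₜ n) =
      (LinearMap.mul k (TensorAlgebra k (aug R))
        (TensorAlgebra.lift k (-TensorAlgebra.ι k (M := aug R)) t)).rTensor N (β n) := rfl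

theorem freeHomotopy_one (n : N) : freeHomotopy β (1 ⊗ₜ n) = β n := by
  rw [freeHomotopy_tmul, map_one]
  have h1 : LinearMap.mul k (TensorAlgebra k (aug R)) 1 = LinearMap.id := by ext; simp
  rw [h1, LinearMap.rTensor_id, LinearMap.id_apply]

theorem freeHomotopy_coeffMul (a : aug R) (u : TensorAlgebra k (aug R) ⊗[k] N) :
    freeHomotopy β (coeffMul R _ a u) = - coeffMul R _ a (freeHomotopy β u) := by
  induction u with
  | zero => simp
  | add x y hx hy => simp only [map_add, hx, hy]; abel
  | tmul t n =>
    have h1 : ∀ x y : TensorAlgebra k (aug R), LinearMap.mul k (TensorAlgebra k (aug R)) (x * y) =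
        LinearMap.mul k _ x ∘ₗ LinearMap.mul k _ y := by
      intro x y
      apply LinearMap.ext
      intro z
      exact mul_assoc x y z
    rw [coeffMul_tmul, freeHomotopy_tmul, freeHomotopy_tmul, map_mul, TensorAlgebra.lift_ι_apply,
      LinearMap.neg_apply, neg_mul, map_neg, h1, LinearMap.rTensor_neg, LinearMap.rTensor_comp]
    rfl

variable [Module (Alg R) N] [IsScalarTower k (Alg R) N]

/-- The case of a single letter. Here `η y` plays the role of a free generator, and `β` turns the
coefficient `c • η y` into the letter `c - ε(c)` followed by `η y`. -/
theorem freeHomotopy_spec_one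
    (hβ : ∀ c y, β (c • η y) = coeffMul R N (toAug hs hR c) (1 ⊗ₜ η y)) (a : aug R) (c : Alg R)
    (y : Y) :
    coeffD R _ (freeHomotopy β (coeffMul R _ a (1 ⊗ₜ (c • η y)))) +
      freeHomotopy β (coeffD R _ (coeffMul R _ a (1 ⊗ₜ (c • η y)))) =
        coeffMul R _ a (1 ⊗ₜ (c • η y)) := by
  rw [freeHomotopy_coeffMul, freeHomotopy_one, hβ, map_neg, coeffD_coeffMul R _ a,
    coeffD_coeffMul R _ (toAug hs hR c), coeffD_coeffMul R _ a, coeffD_one, coeffD_one, map_zero,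
    map_zero, sub_zero, sub_zero, coeffContract_coeffMul, coeffContract_one, coeffContract_one,
    smul_smul, freeHomotopy_one, hβ]
  -- Since `a` is in `A_+`, so is `a c`, and `c` is the sum of its part in `A_+` and the scalar
  -- `ε(c)`.
  have h2 : toAug hs hR ((a : Alg R) * c) =
      augMul R a (toAug hs hR c) + counit hs hR c • a := by
    apply Subtype.ext
    have h3 : ((augMul R a (toAug hs hR c) : aug R) : Alg R) =
      (a : Alg R) * (toAug hs hR c : Alg R) := rfl
    rw [Submodule.coe_add, h3, coe_toAug, coe_toAug, counit_mul,
      (mem_aug_iff_counit hs hR).1 a.2, zero_mul, map_zero, mul_sub, ← Algebra.commutes,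
      ← Algebra.smul_def]
    simp
  have h6 : c • η y = (toAug hs hR c : Alg R) • η y + counit hs hR c • η y := by
    rw [coe_toAug, sub_smul, algebraMap_smul, sub_add_cancel]
  have h7 : (1 : TensorAlgebra k (aug R)) ⊗ₜ[k] (c • η y) =
      1 ⊗ₜ ((toAug hs hR c : Alg R) • η y) + counit hs hR c • (1 ⊗ₜ η y) := by
    rw [h6, TensorProduct.tmul_add, TensorProduct.tmul_smul (counit hs hR c)]
  have h8 : coeffMul R N (toAug hs hR ((a : Alg R) * c)) =
      coeffMul R N (augMul R a (toAug hs hR c)) + counit hs hR c • coeffMul R N a := by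
    rw [h2, (coeffMul R N).map_add, (coeffMul R N).map_smul]
  rw [h7, h8, LinearMap.add_apply, (coeffMul R N a).map_add, (coeffMul R N a).map_smul,
    LinearMap.smul_apply]
  abel

/-- The bar complex with free coefficients is contractible in positive degrees. -/
theorem freeHomotopy_spec
    (hβ : ∀ c y, β (c • η y) = coeffMul R N (toAug hs hR c) (1 ⊗ₜ η y))
    (hη : ∀ n : N, n ∈ Submodule.span k {n | ∃ (c : Alg R) (y : Y), n = c • η y}) (a : aug R)
    (u : TensorAlgebra k (aug R) ⊗[k] N) :
    coeffD R _ (freeHomotopy β (coeffMul R _ a u)) +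
      freeHomotopy β (coeffD R _ (coeffMul R _ a u)) = coeffMul R _ a u := by
  induction u using coeff_induction generalizing a with
  | zero => simp
  | add x y hx hy =>
    simp only [map_add] at hx hy ⊢
    rw [add_add_add_comm, hx, hy]
  | one n =>
    induction hη n using Submodule.span_induction with
    | mem n hn =>
      obtain ⟨c, y, rfl⟩ := hn
      exact freeHomotopy_spec_one hs hR η β hβ a c y
    | zero => simp
    | add x y _ _ hx hy =>
      simp only [map_add, TensorProduct.tmul_add] at hx hy ⊢
      rw [add_add_add_comm, hx, hy]
    | smul c x _ hx =>
      simp only [map_smul, TensorProduct.tmul_smul] at hx ⊢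
      rw [← smul_add, hx]
  | mul b t n h =>
    -- The homotopy anticommutes with prefixing a letter. The two terms in which `a` is multiplied
    -- into `b` therefore cancel, and what is left is `a` times the identity for the word that
    -- begins with `b`.
    have h1 := h b
    rw [freeHomotopy_coeffMul, map_neg, coeffD_coeffMul, coeffD_coeffMul R _ a, map_sub,
      freeHomotopy_coeffMul, coeffContract_coeffMul, freeHomotopy_coeffMul,
      freeHomotopy_coeffMul, map_neg, map_neg, coeffContract_coeffMul]
    rw [freeHomotopy_coeffMul, map_neg] at h1
    conv_rhs => rw [← h1]
    rw [map_add, map_neg]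
    abel

theorem freeHomotopy_mem {M : Submodule (Alg R) N} (hβ : ∀ n ∈ M, β n ∈ barTerm M 1) {p : ℕ}
    {u : TensorAlgebra k (aug R) ⊗[k] N} (hu : u ∈ barTerm M p) :
    freeHomotopy β u ∈ barTerm M (p + 1) := by
  induction p generalizing u with
  | zero =>
    rw [mem_barTerm_zero] at hu
    obtain ⟨n, hn, rfl⟩ := hu
    rw [freeHomotopy_one]
    exact hβ n hn
  | succ p ih =>
    refine map_mem_of_mem_barTerm_succ (freeHomotopy β) _ ?_ hu
    intro a t ht n hn
    rw [freeHomotopy_coeffMul]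
    exact neg_mem (coeffMul_mem_barTerm _ (ih (tmul_mem_tens ht hn)))

theorem exists_coeffD_eq_of_letter
    (hβ : ∀ c y, β (c • η y) = coeffMul R N (toAug hs hR c) (1 ⊗ₜ η y))
    (hη : ∀ n : N, n ∈ Submodule.span k {n | ∃ (c : Alg R) (y : Y), n = c • η y})
    {M : Submodule (Alg R) N} (hM : ∀ n ∈ M, β n ∈ barTerm M 1) {p : ℕ}
    {u : TensorAlgebra k (aug R) ⊗[k] N}
    (hu : u ∈ barTerm M (p + 1)) (h0 : coeffD R _ u = 0) :
    ∃ y ∈ barTerm M (p + 2), coeffD R _ y = u := by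
  refine ⟨freeHomotopy β u, freeHomotopy_mem β hM hu, ?_⟩
  have h1 : (coeffD R N ∘ₗ freeHomotopy β + freeHomotopy β ∘ₗ coeffD R N - LinearMap.id :
        Module.End k (TensorAlgebra k (aug R) ⊗[k] N)) u ∈ (⊥ : Submodule k _) := by
    refine map_mem_of_mem_barTerm_succ _ _ ?_ hu
    intro a t ht n hn
    rw [Submodule.mem_bot, LinearMap.sub_apply, LinearMap.add_apply, LinearMap.comp_apply,
      LinearMap.comp_apply, freeHomotopy_spec hs hR η β hβ hη, LinearMap.id_apply, sub_self]
  rw [Submodule.mem_bot, LinearMap.sub_apply, LinearMap.add_apply, LinearMap.comp_apply,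
    LinearMap.comp_apply, h0, map_zero, add_zero, sub_eq_zero] at h1
  exact h1

end Homotopy

variable (Y : Type w) [AddCommGroup Y] [Module k Y]

/-- The map `A ⊗ Y → A_+ ⊗ (A ⊗ Y)`, `c ⊗ y ↦ [c₊] ⊗ (1 ⊗ y)`. -/
noncomputable def freeLetter :
    Alg R ⊗[k] Y →ₗ[k] TensorAlgebra k (aug R) ⊗[k] (Alg R ⊗[k] Y) :=
  TensorProduct.map (TensorAlgebra.ι k ∘ₗ toAug hs hR) (TensorProduct.mk k (Alg R) Y 1)

theorem freeLetter_tmul (c : Alg R) (y : Y) : freeLetter hs hR Y (c ⊗ₜ y) =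
    TensorAlgebra.ι k (toAug hs hR c) ⊗ₜ ((1 : Alg R) ⊗ₜ y) := rfl

variable {Y} in
/-- The bar complex with free coefficients is exact in positive degrees. -/
theorem exists_coeffD_eq (hs : s ≠ 0) (hR : R ≤ tpow k V s) {P : Submodule k Y} {p : ℕ}
    {u : TensorAlgebra k (aug R) ⊗[k] (Alg R ⊗[k] Y)}
    (hu : u ∈ barTerm (P.baseChange (Alg R)) (p + 1)) (h0 : coeffD R _ u = 0) :
    ∃ y ∈ barTerm (P.baseChange (Alg R)) (p + 2), coeffD R _ y = u := by
  have h1 : ∀ (c : Alg R) (y : Y), c • ((1 : Alg R) ⊗ₜ[k] y) = c ⊗ₜ y := by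
    intro c y
    rw [TensorProduct.smul_tmul', smul_eq_mul, mul_one]
  refine exists_coeffD_eq_of_letter hs hR (fun y : Y => (1 : Alg R) ⊗ₜ[k] y) (freeLetter hs hR Y)
    ?_ ?_ ?_ hu h0
  · intro c y
    rw [h1, freeLetter_tmul, coeffMul_tmul, mul_one]
  · intro n
    induction n with
    | zero => exact zero_mem _
    | add x y hx hy => exact add_mem hx hy
    | tmul c y => exact Submodule.subset_span ⟨c, y, (h1 c y).symm⟩
  · intro n hn
    rw [mem_baseChange_iff] at hn
    refine map_mem_of_mem_tens (freeLetter hs hR Y) _ ?_ hn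
    intro c _ y hy
    rw [freeLetter_tmul]
    exact tmul_mem_tens (ι_mem_tpow _) (Submodule.tmul_mem_baseChange_of_mem 1 hy)

end Free

/-! ### Operators that raise the degree -/

section

variable {k : Type u} [Field k] {M : Type v} [AddCommGroup M] [Module k M]

/-- The endomorphism `F` raises degrees by `p`. -/
def Grading.IsHomog (g : Grading k M) (p : ℕ) (F : Module.End k M) : Prop :=
  ∀ m u, g.π m (F u) = if p ≤ m then F (g.π (m - p) u) else 0

namespace Grading

variable (g : Grading k M) {p : ℕ} {F : Module.End k M}

theorem homog_zero (m : ℕ) : g.π m (F 0) = if p ≤ m then F (g.π (m - p) 0) else 0 := by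
  simp

theorem homog_add {m : ℕ} {x y : M} (hx : g.π m (F x) = if p ≤ m then F (g.π (m - p) x) else 0)
    (hy : g.π m (F y) = if p ≤ m then F (g.π (m - p) y) else 0) :
    g.π m (F (x + y)) = if p ≤ m then F (g.π (m - p) (x + y)) else 0 := by
  rw [LinearMap.map_add, LinearMap.map_add, hx, hy, LinearMap.map_add]
  split_ifs
  · rw [LinearMap.map_add]
  · exact add_zero 0

theorem homog_of_hom {i : ℕ} {u : M} (hu : g.π i u = u) (hF : g.π (p + i) (F u) = F u) (m : ℕ) :
    g.π m (F u) = if p ≤ m then F (g.π (m - p) u) else 0 := by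
  rw [g.π_eq_ite hF, g.π_eq_ite hu]
  by_cases h : m = p + i
  · rw [if_pos h, if_pos (by omega), if_pos (by omega)]
  · rw [if_neg h]
    split_ifs
    · omega
    · rw [LinearMap.map_zero]
    · rfl

end Grading

end

/-! ### The internal grading and the augmentation of the bar complex -/

section BarGrading

variable {k : Type u} [Field k] {V : Type v} [AddCommGroup V] [Module k V]
variable {R : Submodule k (TensorAlgebra k V)} {s : ℕ}

theorem algGr_π_mem_aug (hR : R ≤ tpow k V s) (m : ℕ) {a : Alg R} (ha : a ∈ aug R) :
    (algGr hR).π m a ∈ aug R := by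
  rw [mem_aug_iff hR] at ha ⊢
  rw [Grading.orth]
  split_ifs with h
  · rw [← h, ha]
  · rfl

/-- The grading of `A_+`. -/
noncomputable def augGr (hR : R ≤ tpow k V s) : Grading k (aug R) where
  π m := ((algGr hR).π m).restrict fun _ ha => algGr_π_mem_aug hR m ha
  orth i j a := by
    apply Subtype.ext
    have h := (algGr hR).orth i j (a : Alg R)
    split_ifs at h ⊢ <;> exact h
  span a := by
    obtain ⟨n, hn⟩ := (algGr hR).sum_π (a : Alg R)
    have h : a = ∑ i ∈ Finset.range n, (⟨(algGr hR).π i a, algGr_π_mem_aug hR i a.2⟩ : aug R) := by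
      apply Subtype.ext
      rw [Submodule.coe_sum]
      exact (hn n le_rfl).symm
    rw [h]
    exact Submodule.sum_mem _ fun i _ => Submodule.mem_iSup_of_mem i ⟨a, rfl⟩

theorem coe_augGr_π (hR : R ≤ tpow k V s) (m : ℕ) (a : aug R) :
    ((augGr hR).π m a : Alg R) = (algGr hR).π m (a : Alg R) := rfl

theorem augGr_eq_iff (hR : R ≤ tpow k V s) {m : ℕ} {a : aug R} :
    (augGr hR).π m a = a ↔ (a : Alg R) ∈ gr R m := by
  rw [mem_gr_iff hR, ← coe_augGr_π, Subtype.ext_iff]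

/-- The grading of the bar complex by the internal degree. -/
noncomputable def barGr (hR : R ≤ tpow k V s) : Grading k (TensorAlgebra k (aug R)) :=
  (augGr hR).tensorAlgebra

theorem barPiece_succ (n m : ℕ) : barPiece R (n + 1) m = ⨆ (p : ℕ) (q : ℕ) (_ : p + q = m),
    (((gr R p).comap (aug R).subtype).map (TensorAlgebra.ι k)) * barPiece R n q := rfl

/-- With `barGr_π_mem` this identifies `barPiece R n m` with the degree `m` part of `A_+^{⊗n}`, so
that concentration of `Tor` can be expressed through projections. -/
theorem barPiece_le (hR : R ≤ tpow k V s) (n m : ℕ) {t : TensorAlgebra k (aug R)}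
    (ht : t ∈ barPiece R n m) : t ∈ tpow k (aug R) n ∧ (barGr hR).π m t = t := by
  suffices h : barPiece R n m ≤
      tpow k (aug R) n ⊓ LinearMap.ker ((barGr hR).π m - LinearMap.id) by
    exact ⟨(h ht).1, sub_eq_zero.1 (h ht).2⟩
  clear ht t
  induction n generalizing m with
  | zero =>
    rw [barPiece]
    split_ifs with h
    · subst h
      rw [Submodule.one_le]
      refine ⟨one_mem_tpow, ?_⟩
      rw [SetLike.mem_coe, LinearMap.mem_ker, LinearMap.sub_apply, barGr,
        Grading.tensorAlgebra_one, if_pos rfl]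
      simp
    · exact bot_le
  | succ n ih =>
    rw [barPiece_succ]
    refine iSup_le fun p => iSup_le fun q => iSup_le fun hpq => ?_
    subst hpq
    rw [Submodule.mul_le]
    rintro _ ⟨a, ha, rfl⟩ t ht
    have h1 : (augGr hR).π p a = a := (augGr_eq_iff hR).2 ha
    have h2 : (barGr hR).π q t = t := sub_eq_zero.1 (ih q ht).2
    refine ⟨?_, ?_⟩
    · rw [add_comm]
      exact mul_mem_tpow (ι_mem_tpow a) (ih q ht).1
    · rw [SetLike.mem_coe, LinearMap.mem_ker, LinearMap.sub_apply, barGr,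
        Grading.tensorAlgebra_mul_hom _ (by rw [Grading.tensorAlgebra_ι, h1]) h2]
      simp

theorem barGr_π_mem (hR : R ≤ tpow k V s) {n : ℕ} (m : ℕ) {t : TensorAlgebra k (aug R)}
    (ht : t ∈ tpow k (aug R) n) : (barGr hR).π m t ∈ barPiece R n m := by
  induction n generalizing m t with
  | zero =>
    rw [tpow_zero, Submodule.mem_one] at ht
    obtain ⟨c, rfl⟩ := ht
    rw [barPiece, Algebra.algebraMap_eq_smul_one, map_smul, barGr, Grading.tensorAlgebra_one]
    split_ifs
    · exact Submodule.smul_mem _ c (Submodule.one_le.1 le_rfl)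
    · rw [smul_zero]; exact zero_mem _
  | succ n ih =>
    rw [add_comm, tpow_add, tpow_one] at ht
    refine Submodule.mul_induction_on
      (C := fun t => (barGr hR).π m t ∈ barPiece R (n + 1) m) ht ?_ ?_
    · rintro _ ⟨a, rfl⟩ t ht
      rw [barGr, Grading.tensorAlgebra_mul]
      refine Submodule.sum_mem _ fun q hq => ?_
      rw [Finset.HasAntidiagonal.mem_antidiagonal] at hq
      rw [barPiece_succ, Grading.tensorAlgebra_ι]
      refine Submodule.mem_iSup_of_mem q.1 (Submodule.mem_iSup_of_mem q.2
        (Submodule.mem_iSup_of_mem hq (Submodule.mul_mem_mul ⟨_, ?_, rfl⟩ (ih q.2 ht))))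
      exact algGr_π_mem hR q.1 _
    · intro x y hx hy
      rw [map_add]
      exact add_mem hx hy

/-! ### Compatibility with the gradings -/

/-- The grading of the bar complex with coefficients in `A ⊗ T(V)`. -/
noncomputable def coeffGr (hR : R ≤ tpow k V s) :
    Grading k (TensorAlgebra k (aug R) ⊗[k] (Alg R ⊗[k] TensorAlgebra k V)) :=
  (barGr hR).tensor (leftGr hR)

theorem coeffGr_one (hR : R ≤ tpow k V s) (m : ℕ) (n : Alg R ⊗[k] TensorAlgebra k V) :
    (coeffGr hR).π m (1 ⊗ₜ n) = 1 ⊗ₜ (leftGr hR).π m n := by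
  rw [coeffGr, Grading.tensor_tmul, Finset.sum_eq_single (0, m)]
  · rw [barGr, Grading.tensorAlgebra_one, if_pos rfl]
  · rintro ⟨a, b⟩ hq hne
    rw [Finset.HasAntidiagonal.mem_antidiagonal] at hq
    have ha : a ≠ 0 := by
      rintro rfl
      rw [zero_add] at hq
      exact hne (Prod.ext rfl hq)
    rw [barGr, Grading.tensorAlgebra_one, if_neg ha, TensorProduct.zero_tmul]
  · intro h
    simp at h

theorem coeffMul_isHomog (hR : R ≤ tpow k V s) {p : ℕ} {a : aug R}
    (ha : (augGr hR).π p a = a) : (coeffGr hR).IsHomog p (coeffMul R _ a) := by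
  intro m u
  induction u with
  | zero => exact Grading.homog_zero _ m
  | add x y hx hy => exact Grading.homog_add _ hx hy
  | tmul t n =>
    induction t using (barGr hR).induction with
    | zero => rw [TensorProduct.zero_tmul]; exact Grading.homog_zero _ m
    | add x y hx hy => rw [TensorProduct.add_tmul]; exact Grading.homog_add _ hx hy
    | hom i t ht =>
      induction n using (leftGr hR).induction with
      | zero => rw [TensorProduct.tmul_zero]; exact Grading.homog_zero _ m
      | add x y hx hy => rw [TensorProduct.tmul_add]; exact Grading.homog_add _ hx hy
      | hom j n hn =>
        have h1 : (barGr hR).π (p + i) (TensorAlgebra.ι k a * t) = TensorAlgebra.ι k a * t :=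
          Grading.tensorAlgebra_mul_hom _ (by rw [Grading.tensorAlgebra_ι, ha]) ht
        refine Grading.homog_of_hom _ (Grading.tensor_tmul_hom _ _ ht hn) ?_ m
        rw [coeffMul_tmul, ← add_assoc]
        exact Grading.tensor_tmul_hom _ _ h1 hn

theorem leftGr_smul (hR : R ≤ tpow k V s) {p : ℕ} {a : Alg R} (ha : a ∈ gr R p) :
    (leftGr hR).IsHomog p (Algebra.lsmul k k _ a) := by
  intro m u
  induction u with
  | zero => exact Grading.homog_zero _ m
  | add x y hx hy => exact Grading.homog_add _ hx hy
  | tmul b t =>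
    induction b using (algGr hR).induction with
    | zero => rw [TensorProduct.zero_tmul]; exact Grading.homog_zero _ m
    | add x y hx hy => rw [TensorProduct.add_tmul]; exact Grading.homog_add _ hx hy
    | hom i b hb =>
      induction t using tpow_induction with
      | zero => rw [TensorProduct.tmul_zero]; exact Grading.homog_zero _ m
      | add x y hx hy => rw [TensorProduct.tmul_add]; exact Grading.homog_add _ hx hy
      | hom j t ht =>
        rw [← mem_gr_iff hR] at hb
        refine Grading.homog_of_hom _ (leftGr_tmul hR hb ht) ?_ m
        have := leftGr_tmul hR (mul_mem_gr ha hb) ht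
        rw [add_assoc] at this
        exact this

theorem coeffContract_isHomog (hR : R ≤ tpow k V s) {p : ℕ} {a : aug R}
    (ha : (augGr hR).π p a = a) : (coeffGr hR).IsHomog p (coeffContract R _ a) := by
  intro m u
  induction u using coeff_induction with
  | zero => exact Grading.homog_zero _ m
  | add x y hx hy => exact Grading.homog_add _ hx hy
  | one n =>
    have h := leftGr_smul hR ((augGr_eq_iff hR).1 ha) m n
    rw [Algebra.lsmul_coe] at h
    rw [coeffContract_one, coeffGr_one, coeffGr_one, h]
    split_ifs
    · rw [coeffContract_one]
    · rw [TensorProduct.tmul_zero]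
  | mul b t n _ =>
    induction b using (augGr hR).induction with
    | zero => rw [LinearMap.map_zero]; exact Grading.homog_zero _ m
    | add x y hx hy =>
      rw [LinearMap.map_add, LinearMap.add_apply]; exact Grading.homog_add _ hx hy
    | hom q b hb =>
      have h1 : (augGr hR).π (p + q) (augMul R a b) = augMul R a b := by
        rw [augGr_eq_iff]
        exact mul_mem_gr ((augGr_eq_iff hR).1 ha) ((augGr_eq_iff hR).1 hb)
      rw [coeffContract_coeffMul, coeffMul_isHomog hR h1, coeffMul_isHomog hR hb]
      by_cases h2 : p + q ≤ m
      · rw [if_pos h2, if_pos (by omega), if_pos (by omega), coeffContract_coeffMul,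
          Nat.sub_add_eq]
      · rw [if_neg h2]
        split_ifs
        · omega
        · rw [LinearMap.map_zero]
        · rfl

theorem coeffD_π (hR : R ≤ tpow k V s) (m : ℕ)
    (u : TensorAlgebra k (aug R) ⊗[k] (Alg R ⊗[k] TensorAlgebra k V)) :
    coeffD R _ ((coeffGr hR).π m u) = (coeffGr hR).π m (coeffD R _ u) := by
  induction u using coeff_induction generalizing m with
  | zero => simp
  | add x y hx hy => simp only [LinearMap.map_add, hx, hy]
  | one n => rw [coeffGr_one, coeffD_one, coeffD_one, LinearMap.map_zero]
  | mul a t n h =>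
    induction a using (augGr hR).induction with
    | zero => simp
    | add x y hx hy => simp only [LinearMap.map_add, LinearMap.add_apply, hx, hy]
    | hom p a ha =>
      rw [coeffMul_isHomog hR ha, coeffD_coeffMul, LinearMap.map_sub, coeffMul_isHomog hR ha,
        coeffContract_isHomog hR ha]
      split_ifs
      · rw [coeffD_coeffMul, h]
      · rw [LinearMap.map_zero, sub_zero]

theorem lTensor_π (hR : R ≤ tpow k V s)
    {f : Module.End (Alg R) (Alg R ⊗[k] TensorAlgebra k V)}
    (hf : ∀ m x, f ((leftGr hR).π m x) = (leftGr hR).π m (f x)) (m : ℕ)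
    (u : TensorAlgebra k (aug R) ⊗[k] (Alg R ⊗[k] TensorAlgebra k V)) :
    (f.restrictScalars k).lTensor _ ((coeffGr hR).π m u) =
      (coeffGr hR).π m ((f.restrictScalars k).lTensor _ u) := by
  induction u with
  | zero => simp
  | add x y hx hy => simp only [LinearMap.map_add, hx, hy]
  | tmul t n =>
    rw [coeffGr, Grading.tensor_tmul, LinearMap.lTensor_tmul, Grading.tensor_tmul, map_sum]
    refine Finset.sum_congr rfl fun q _ => ?_
    rw [LinearMap.lTensor_tmul, LinearMap.restrictScalars_apply, hf]
    rfl

theorem coeffGr_π_mem (hR : R ≤ tpow k V s) {K : Submodule (Alg R) (Alg R ⊗[k] TensorAlgebra k V)}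
    (hK : ∀ m, ∀ x ∈ K, (leftGr hR).π m x ∈ K) {p : ℕ} (m : ℕ)
    {u : TensorAlgebra k (aug R) ⊗[k] (Alg R ⊗[k] TensorAlgebra k V)} (hu : u ∈ barTerm K p) :
    (coeffGr hR).π m u ∈ barTerm K p := by
  refine map_mem_of_mem_tens ((coeffGr hR).π m) _ ?_ hu
  intro t ht n hn
  rw [coeffGr, Grading.tensor_tmul]
  exact Submodule.sum_mem _ fun q _ =>
    tmul_mem_tens (barPiece_le hR _ _ (barGr_π_mem hR q.1 ht)).1 (hK _ _ hn)

/-! ### The augmentation of the bar complex with coefficients in `A` -/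

/-- The augmentation `A ⊗ T(V) → k`. -/
noncomputable def leftCounit (hs : s ≠ 0) (hR : R ≤ tpow k V s) :
    Alg R ⊗[k] TensorAlgebra k V →ₗ[k] k :=
  LinearMap.mul' k k ∘ₗ TensorProduct.map (counit hs hR)
    (TensorAlgebra.algebraMapInv (R := k) (M := V)).toLinearMap

theorem leftCounit_tmul (hs : s ≠ 0) (hR : R ≤ tpow k V s) (a : Alg R) (t : TensorAlgebra k V) :
    leftCounit hs hR (a ⊗ₜ t) = counit hs hR a * TensorAlgebra.algebraMapInv (R := k) t := rfl

theorem leftCounit_smul (hs : s ≠ 0) (hR : R ≤ tpow k V s) (a : aug R)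
    (n : Alg R ⊗[k] TensorAlgebra k V) : leftCounit hs hR ((a : Alg R) • n) = 0 := by
  induction n with
  | zero => simp
  | add x y hx hy => rw [smul_add, map_add, hx, hy, add_zero]
  | tmul b t =>
    rw [TensorProduct.smul_tmul', leftCounit_tmul, smul_eq_mul, counit_mul,
      (mem_aug_iff_counit hs hR).1 a.2, zero_mul, zero_mul]

theorem leftCounit_π (hs : s ≠ 0) (hR : R ≤ tpow k V s) (m : ℕ)
    (n : Alg R ⊗[k] TensorAlgebra k V) :
    leftCounit hs hR ((leftGr hR).π m n) = if m = 0 then leftCounit hs hR n else 0 := by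
  induction n using tmul_word_induction hR with
  | zero => simp
  | add x y hx hy =>
    rw [map_add, map_add, map_add, hx, hy]
    split_ifs
    · rfl
    · exact add_zero 0
  | one j a ha =>
    rw [(leftGr hR).π_eq_ite (leftGr_tmul hR ha one_mem_tpow)]
    rcases eq_or_ne j 0 with rfl | hj
    · simp only [add_zero]
      split_ifs
      · rfl
      · exact map_zero _
    · have h0 : leftCounit hs hR (a ⊗ₜ[k] (1 : TensorAlgebra k V)) = 0 := by
        obtain ⟨i, rfl⟩ := Nat.exists_eq_succ_of_ne_zero hj
        rw [leftCounit_tmul, (mem_aug_iff_counit hs hR).1 (gr_succ_le_aug i ha), zero_mul]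
      split_ifs <;> simp [h0]
  | ι_mul j a ha v i t ht =>
    rw [(leftGr hR).π_eq_ite (leftGr_tmul hR ha (mul_mem_tpow (ι_mem_tpow v) ht))]
    have h0 : leftCounit hs hR (a ⊗ₜ[k] (TensorAlgebra.ι k v * t)) = 0 := by
      rw [leftCounit_tmul, map_mul, algebraMapInv_ι, zero_mul, mul_zero]
    split_ifs <;> simp [h0]

/-- The augmentation `[a₁|…|aₙ] ⊗ x ↦ ε(x) [a₁|…|aₙ]`. -/
noncomputable def barAug (hs : s ≠ 0) (hR : R ≤ tpow k V s) :
    TensorAlgebra k (aug R) ⊗[k] (Alg R ⊗[k] TensorAlgebra k V) →ₗ[k] TensorAlgebra k (aug R) :=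
  (TensorProduct.rid k _).toLinearMap ∘ₗ (leftCounit hs hR).lTensor _

theorem barAug_tmul (hs : s ≠ 0) (hR : R ≤ tpow k V s) (t : TensorAlgebra k (aug R))
    (n : Alg R ⊗[k] TensorAlgebra k V) :
    barAug hs hR (t ⊗ₜ n) = leftCounit hs hR n • t := by
  simp [barAug]

theorem barAug_coeffMul (hs : s ≠ 0) (hR : R ≤ tpow k V s) (a : aug R)
    (u : TensorAlgebra k (aug R) ⊗[k] (Alg R ⊗[k] TensorAlgebra k V)) :
    barAug hs hR (coeffMul R _ a u) = TensorAlgebra.ι k a * barAug hs hR u := by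
  induction u with
  | zero => simp
  | add x y hx hy => rw [LinearMap.map_add, LinearMap.map_add, hx, hy, LinearMap.map_add, mul_add]
  | tmul t n => rw [coeffMul_tmul, barAug_tmul, barAug_tmul, mul_smul_comm]

theorem barAug_coeffContract (hs : s ≠ 0) (hR : R ≤ tpow k V s) (a : aug R)
    (u : TensorAlgebra k (aug R) ⊗[k] (Alg R ⊗[k] TensorAlgebra k V)) :
    barAug hs hR (coeffContract R _ a u) = barContract R a (head k _ (barAug hs hR u)) := by
  induction u using coeff_induction with
  | zero => simp
  | add x y hx hy => simp only [LinearMap.map_add, hx, hy]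
  | one n =>
    rw [coeffContract_one, barAug_tmul, barAug_tmul, leftCounit_smul, zero_smul,
      LinearMap.map_smul, head_one, smul_zero, LinearMap.map_zero]
  | mul b t n _ =>
    rw [coeffContract_coeffMul, barAug_coeffMul, barAug_coeffMul, head_ι_mul, barContract_tmul]

theorem barAug_coeffD (hs : s ≠ 0) (hR : R ≤ tpow k V s)
    (u : TensorAlgebra k (aug R) ⊗[k] (Alg R ⊗[k] TensorAlgebra k V)) :
    barAug hs hR (coeffD R _ u) = barD R (barAug hs hR u) := by
  induction u using coeff_induction with
  | zero => simp
  | add x y hx hy => simp only [LinearMap.map_add, hx, hy]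
  | one n =>
    rw [coeffD_one, LinearMap.map_zero, barAug_tmul, LinearMap.map_smul, barD_one, smul_zero]
  | mul a t n h =>
    rw [coeffD_coeffMul, LinearMap.map_sub, barAug_coeffMul, barAug_coeffMul, barD_ι_mul, h,
      barAug_coeffContract]

theorem barAug_π (hs : s ≠ 0) (hR : R ≤ tpow k V s) (m : ℕ)
    (u : TensorAlgebra k (aug R) ⊗[k] (Alg R ⊗[k] TensorAlgebra k V)) :
    barAug hs hR ((coeffGr hR).π m u) = (barGr hR).π m (barAug hs hR u) := by
  induction u with
  | zero => simp
  | add x y hx hy => simp only [LinearMap.map_add, hx, hy]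
  | tmul t n =>
    rw [coeffGr, Grading.tensor_tmul, barAug_tmul, map_sum, Finset.sum_eq_single (m, 0)]
    · rw [barAug_tmul, leftCounit_π, if_pos rfl, LinearMap.map_smul]
    · rintro ⟨a, b⟩ hq hne
      rw [Finset.HasAntidiagonal.mem_antidiagonal] at hq
      have hb : b ≠ 0 := by
        rintro rfl
        exact hne (Prod.ext hq rfl)
      rw [barAug_tmul, leftCounit_π, if_neg hb, zero_smul]
    · intro h
      simp at h

theorem barAug_one_tmul_one (hs : s ≠ 0) (hR : R ≤ tpow k V s) (t : TensorAlgebra k (aug R)) :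
    barAug hs hR (t ⊗ₜ ((1 : Alg R) ⊗ₜ (1 : TensorAlgebra k V))) = t := by
  rw [barAug_tmul, leftCounit_tmul, counit_one, map_one, mul_one, one_smul]

/-- Every `t` is the augmentation of `t ⊗ (1 ⊗ 1)`, so homogeneity is inherited from the bar complex
with coefficients. -/
theorem barD_π (hs : s ≠ 0) (hR : R ≤ tpow k V s) (m : ℕ) (t : TensorAlgebra k (aug R)) :
    barD R ((barGr hR).π m t) = (barGr hR).π m (barD R t) := by
  rw [← barAug_one_tmul_one hs hR t, ← barAug_π, ← barAug_coeffD, ← barAug_coeffD, coeffD_π,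
    barAug_π]

/-- Brings the definition of `Tor` into the form to which `killsHomology_shift` applies; the
projection to degree `m` plays the role of the endomorphism. -/
theorem torConcentrated_iff (hs : s ≠ 0) (hR : R ≤ tpow k V s) (n m₀ : ℕ) :
    TorConcentrated R n m₀ ↔ ∀ m, m ≠ m₀ →
      KillsHomology ((barGr hR).π m) (barD R) (tpow k (aug R)) n := by
  constructor
  · intro h m hm x hx h0
    obtain ⟨y, hy, hy'⟩ := h m hm ⟨barGr_π_mem hR m hx, by
      rw [SetLike.mem_coe, LinearMap.mem_ker, barD_π hs, h0, map_zero]⟩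
    exact ⟨y, (barPiece_le hR _ _ hy).1, hy'⟩
  · rintro h m hm x ⟨hx, h0⟩
    obtain ⟨y, hy, hy'⟩ := h m hm x (barPiece_le hR _ _ hx).1 h0
    refine ⟨(barGr hR).π m y, barGr_π_mem hR m hy, ?_⟩
    rw [barD_π hs, hy', Grading.idem, (barPiece_le hR _ _ hx).2]

end BarGrading

/-! ### Koszulity and exactness of the left Koszul complex -/

section Koszul

variable {k : Type u} [Field k] {V : Type v} [AddCommGroup V] [Module k V]
variable {R : Submodule k (TensorAlgebra k V)} {s : ℕ}

section AugSMul

variable {N : Type w} [AddCommGroup N] [Module k N] [Module (Alg R) N]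

/-- The subspace `A_+ K` of a module. -/
def augSMul (K : Submodule (Alg R) N) : Submodule k N :=
  Submodule.span k {x | ∃ a : aug R, ∃ n ∈ K, x = (a : Alg R) • n}

theorem smul_mem_augSMul {K : Submodule (Alg R) N} (a : aug R) {n : N} (hn : n ∈ K) :
    (a : Alg R) • n ∈ augSMul K :=
  Submodule.subset_span ⟨a, n, hn, rfl⟩

variable [IsScalarTower k (Alg R) N]

theorem one_tmul_eq_zero {M : Type x} [AddCommGroup M] [Module k M] {n : N}
    (h : (1 : TensorAlgebra k M) ⊗ₜ[k] n = 0) : n = 0 := by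
  have := congrArg (TensorProduct.lid k N ∘
    (TensorAlgebra.algebraMapInv (R := k) (M := M)).toLinearMap.rTensor N) h
  simpa using this

/-- In homological degree zero the bar complex computes `K / A_+ K`. -/
theorem exists_coeffD_eq_one_iff {K : Submodule (Alg R) N} {n : N} :
    (∃ y ∈ barTerm K 1, coeffD R N y = 1 ⊗ₜ n) ↔ n ∈ augSMul K := by
  constructor
  · rintro ⟨y, hy, h⟩
    have h1 : coeffD R N y ∈
        (augSMul K).map (TensorProduct.mk k (TensorAlgebra k (aug R)) N 1) := by
      refine map_mem_of_mem_barTerm_succ (coeffD R N) _ ?_ hy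
      intro a t ht n hn
      have h1 : t ⊗ₜ n ∈ barTerm K 0 := tmul_mem_tens ht hn
      obtain ⟨n', hn', h2⟩ := mem_barTerm_zero.1 h1
      rw [coeffD_coeffMul, h2, coeffD_one, map_zero, sub_zero, coeffContract_one]
      exact ⟨_, smul_mem_augSMul a hn', rfl⟩
    rw [h] at h1
    obtain ⟨n', hn', h2⟩ := h1
    have h3 : n' - n = 0 := one_tmul_eq_zero (k := k) (M := aug R)
      ((TensorProduct.tmul_sub _ _ _).trans (sub_eq_zero.2 h2))
    rwa [← sub_eq_zero.1 h3]
  · intro hn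
    suffices h : augSMul K ≤ ((barTerm K 1).map (coeffD R N)).comap
        (TensorProduct.mk k (TensorAlgebra k (aug R)) N 1) from h hn
    refine Submodule.span_le.2 ?_
    rintro _ ⟨a, n, hn, rfl⟩
    refine ⟨coeffMul R N a (1 ⊗ₜ n), coeffMul_mem_barTerm a (mem_barTerm_zero.2 ⟨n, hn, rfl⟩), ?_⟩
    rw [coeffD_coeffMul, coeffD_one, map_zero, sub_zero, coeffContract_one]
    rfl

theorem map_mem_augSMul {K : Submodule (Alg R) N} (f : N →ₗ[Alg R] N) {n : N}
    (hn : n ∈ augSMul K) : f n ∈ augSMul (K.map f) := by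
  suffices h : augSMul K ≤ (augSMul (K.map f)).comap (f.restrictScalars k) from h hn
  refine Submodule.span_le.2 ?_
  rintro _ ⟨a, n, hn, rfl⟩
  rw [SetLike.mem_coe, Submodule.mem_comap, LinearMap.restrictScalars_apply, map_smul]
  exact smul_mem_augSMul a ⟨n, hn, rfl⟩

theorem barTerm_map (K : Submodule (Alg R) N) (f : N →ₗ[Alg R] N) (j : ℕ) :
    barTerm (K.map f) j = (barTerm K j).map ((f.restrictScalars k).lTensor _) := by
  apply le_antisymm
  · refine tens_le.2 ?_
    rintro t ht _ ⟨n, hn, rfl⟩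
    exact ⟨t ⊗ₜ n, tmul_mem_tens ht hn, rfl⟩
  · rintro _ ⟨u, hu, rfl⟩
    refine map_mem_of_mem_tens ((f.restrictScalars k).lTensor _) _ ?_ hu
    intro t ht n hn
    exact tmul_mem_tens ht ⟨n, hn, rfl⟩

/-- Together with `barTerm_map`: the bar complexes of the kernel of `f` on `K`, of `K` and of `f(K)`
form a short exact sequence, because the tensor product is over a field. -/
theorem barTerm_inf_ker (K : Submodule (Alg R) N) (f : N →ₗ[Alg R] N) (j : ℕ) :
    barTerm (K ⊓ LinearMap.ker f) j =
      barTerm K j ⊓ LinearMap.ker ((f.restrictScalars k).lTensor _) := by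
  apply le_antisymm
  · refine tens_le.2 ?_
    rintro t ht n ⟨hn, hn'⟩
    refine ⟨tmul_mem_tens ht hn, ?_⟩
    rw [SetLike.mem_coe, LinearMap.mem_ker] at hn' ⊢
    rw [LinearMap.lTensor_tmul, LinearMap.restrictScalars_apply, hn', TensorProduct.tmul_zero]
  · rintro u ⟨hu, hu'⟩
    have h := mem_tens_of_lTensor_eq_zero (f.restrictScalars k) hu hu'
    exact h

end AugSMul

/-- The free module `A ⊗ J_n` is generated in degree `n`: below it vanishes, and above it
coefficients lie in `A_+`. -/
theorem leftGr_π_mem_augSMul (hR : R ≤ tpow k V s) {n m : ℕ} (h : m ≠ n)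
    {x : Alg R ⊗[k] TensorAlgebra k V} (hx : x ∈ (J R s n).baseChange (Alg R)) :
    (leftGr hR).π m x ∈ augSMul ((J R s n).baseChange (Alg R)) := by
  rcases lt_or_gt_of_ne h with h | h
  · rw [leftGr_π_eq_zero hR h hx]
    exact zero_mem _
  · obtain ⟨p, rfl⟩ := Nat.exists_eq_add_of_lt h
    rw [mem_baseChange_iff] at hx
    refine map_mem_of_mem_tens ((leftGr hR).π (n + p + 1)) _ ?_ hx
    intro a _ t ht
    rw [show n + p + 1 = (p + 1) + n by omega, leftGr,
      Grading.tensor_tmul_right _ _ (wordGr_of_mem_tpow (J_le_tpow n ht))]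
    have h1 := smul_mem_augSMul (⟨_, gr_succ_le_aug p (algGr_π_mem hR (p + 1) a)⟩ : aug R)
      (Submodule.tmul_mem_baseChange_of_mem (1 : Alg R) ht)
    rwa [TensorProduct.smul_tmul', smul_eq_mul, mul_one] at h1

/-- The internal degree `m` part of the homology of the bar complex with coefficients in `K`
vanishes in homological degree `j`. -/
def BarKills (hR : R ≤ tpow k V s) (m : ℕ) (K : Submodule (Alg R) (Alg R ⊗[k] TensorAlgebra k V))
    (j : ℕ) : Prop :=
  KillsHomology ((coeffGr hR).π m) (coeffD R _) (barTerm K) j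

theorem barKills_zero_iff (hR : R ≤ tpow k V s) {m : ℕ}
    {K : Submodule (Alg R) (Alg R ⊗[k] TensorAlgebra k V)} :
    BarKills hR m K 0 ↔ ∀ x ∈ K, (leftGr hR).π m x ∈ augSMul K := by
  constructor
  · intro h x hx
    rw [← exists_coeffD_eq_one_iff, ← coeffGr_one hR]
    exact h _ (mem_barTerm_zero.2 ⟨x, hx, rfl⟩) (coeffD_one R _ x)
  · intro h u hu _
    obtain ⟨x, hx, rfl⟩ := mem_barTerm_zero.1 hu
    rw [coeffGr_one]
    exact exists_coeffD_eq_one_iff.2 (h x hx)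

/-- Dimension shifting along `f`. The bar complex of the free module is acyclic only in positive
degrees; for `j = 0` minimality takes over: by `hmin` the kernel of `f` has no component in degree
`n`, so it lies in `A_+ (A ⊗ J_n)` and maps to zero in `Tor_0`. -/
theorem barKills_shift (hs : s ≠ 0) (hR : R ≤ tpow k V s) {n : ℕ}
    {f : Module.End (Alg R) (Alg R ⊗[k] TensorAlgebra k V)}
    (hf : ∀ m x, f ((leftGr hR).π m x) = (leftGr hR).π m (f x))
    (hmin : ∀ x ∈ (J R s n).baseChange (Alg R), (leftGr hR).π n x = x → f x = 0 → x = 0)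
    (m j : ℕ) :
    BarKills hR m (((J R s n).baseChange (Alg R)).map f) (j + 1) ↔
      BarKills hR m ((J R s n).baseChange (Alg R) ⊓ LinearMap.ker f) j := by
  have hX := barTerm_inf_ker ((J R s n).baseChange (Alg R)) f
  have hZ := barTerm_map ((J R s n).baseChange (Alg R)) f
  have hD : ∀ j, ∀ y ∈ barTerm ((J R s n).baseChange (Alg R)) (j + 1),
      coeffD R _ y ∈ barTerm ((J R s n).baseChange (Alg R)) j := fun j y hy => coeffD_mem_barTerm hy
  have he : ∀ j, ∀ y ∈ barTerm ((J R s n).baseChange (Alg R)) j,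
      (coeffGr hR).π m y ∈ barTerm ((J R s n).baseChange (Alg R)) j :=
    fun j y hy => coeffGr_π_mem hR (fun m x hx => leftGr_π_mem hR m hx) m hy
  have hE : ∀ x ∈ barTerm ((J R s n).baseChange (Alg R)) (j + 1), coeffD R _ x = 0 →
      ∃ y ∈ barTerm ((J R s n).baseChange (Alg R)) (j + 2), coeffD R _ y = x :=
    fun x hx h0 => exists_coeffD_eq hs hR hx h0
  refine killsHomology_shift ((f.restrictScalars k).lTensor (TensorAlgebra k (aug R))) hX hZ hD
    coeffD_coeffD (lTensor_coeffD f) (coeffD_π hR m) (lTensor_π hR hf m) he ?_ hE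
  intro u hu h0
  rw [barTerm_inf_ker] at hu
  cases j with
  | succ j => exact exists_coeffD_eq hs hR hu.1 h0
  | zero =>
    rw [← barTerm_inf_ker] at hu
    obtain ⟨x, ⟨hx, hx0⟩, rfl⟩ := mem_barTerm_zero.1 hu
    rw [SetLike.mem_coe, LinearMap.mem_ker] at hx0
    refine exists_coeffD_eq_one_iff.2 ((leftGr hR).mem_of_π_mem _ fun i => ?_)
    rcases eq_or_ne i n with rfl | hi
    · rw [hmin _ (leftGr_π_mem hR i hx) ((leftGr hR).idem i x) (by rw [hf, hx0, map_zero])]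
      exact zero_mem _
    · exact leftGr_π_mem_augSMul hR hi hx

variable (R s) in
/-- The image of the differential of the left Koszul complex. -/
noncomputable def leftB (i : ℕ) : Submodule (Alg R) (Alg R ⊗[k] TensorAlgebra k V) :=
  (leftK R s (i + 1)).map (leftD R s (i + 1))

theorem mem_leftK_zero (hs : 2 ≤ s) {x : Alg R ⊗[k] TensorAlgebra k V} :
    x ∈ leftK R s 0 ↔ ∃ a : Alg R, x = a ⊗ₜ 1 := by
  rw [leftK, koszulDegree_zero, J_of_lt (by omega), mem_baseChange_iff]
  constructor
  · intro hx
    suffices h : x ∈ LinearMap.range ((TensorProduct.mk k (Alg R) (TensorAlgebra k V)).flip 1) by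
      obtain ⟨a, rfl⟩ := h
      exact ⟨a, rfl⟩
    refine map_mem_of_mem_tens LinearMap.id _ ?_ hx
    intro a _ t ht
    rw [tpow_zero, Submodule.mem_one] at ht
    obtain ⟨c, rfl⟩ := ht
    refine ⟨c • a, ?_⟩
    rw [LinearMap.flip_apply, TensorProduct.mk_apply, Algebra.algebraMap_eq_smul_one,
      TensorProduct.smul_tmul]
    rfl
  · rintro ⟨a, rfl⟩
    exact tmul_mem_tens trivial one_mem_tpow

theorem mem_leftB_zero_iff (hs : 2 ≤ s) (hs' : s ≠ 0) (hR : R ≤ tpow k V s)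
    {x : Alg R ⊗[k] TensorAlgebra k V} :
    x ∈ leftB R s 0 ↔ x ∈ leftK R s 0 ∧ leftCounit hs' hR x = 0 := by
  rw [leftB, exists_leftD_one_iff hs, mem_leftK_zero hs]
  constructor
  · rintro ⟨a, ha, rfl⟩
    refine ⟨⟨a, rfl⟩, ?_⟩
    rw [leftCounit_tmul, (mem_aug_iff_counit hs' hR).1 ha, zero_mul]
  · rintro ⟨⟨a, rfl⟩, h⟩
    rw [leftCounit_tmul, map_one, mul_one] at h
    exact ⟨a, (mem_aug_iff_counit hs' hR).2 h, rfl⟩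

/-- The same shift for `0 → A_+ → A → k → 0`: the bar complex of `k` is the image under the
augmentation of that with coefficients in `A`. For `j = 0` one uses that `a ⊗ 1 = a • (1 ⊗ 1)` lies
in `A_+ (A ⊗ 1)`. -/
theorem barKills_leftB_zero (hs : 2 ≤ s) (hR : R ≤ tpow k V s) (m j : ℕ) :
    KillsHomology ((barGr hR).π m) (barD R) (tpow k (aug R)) (j + 1) ↔
      BarKills hR m (leftB R s 0) j := by
  have hs' : s ≠ 0 := by omega
  have hX : ∀ j, barTerm (leftB R s 0) j =
      barTerm (leftK R s 0) j ⊓ LinearMap.ker (barAug hs' hR) := by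
    intro j
    apply le_antisymm
    · refine tens_le.2 ?_
      intro t ht n hn
      have hn' := (mem_leftB_zero_iff hs hs' hR).1 hn
      refine ⟨tmul_mem_tens ht hn'.1, ?_⟩
      rw [SetLike.mem_coe, LinearMap.mem_ker, barAug_tmul, hn'.2, zero_smul]
    · rintro u ⟨hu, hu'⟩
      have h0 : (leftCounit hs' hR).lTensor (TensorAlgebra k (aug R)) u = 0 :=
        (TensorProduct.rid k _).map_eq_zero_iff.1 hu'
      refine tens_mono le_rfl ?_ (mem_tens_of_lTensor_eq_zero _ hu h0)
      rintro x ⟨hx, hx0⟩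
      exact (mem_leftB_zero_iff hs hs' hR).2 ⟨hx, hx0⟩
  refine killsHomology_shift (Y := barTerm (leftK R s 0)) (barAug hs' hR) hX ?_
    (fun j y hy => coeffD_mem_barTerm hy) coeffD_coeffD (barAug_coeffD hs' hR) (coeffD_π hR m)
    (barAug_π hs' hR m) (fun j y hy => coeffGr_π_mem hR (fun m x hx => leftGr_π_mem hR m hx) m hy)
    ?_ (fun x hx h0 => exists_coeffD_eq hs' hR hx h0)
  · intro j
    apply le_antisymm
    · intro t ht
      exact ⟨t ⊗ₜ (1 ⊗ₜ 1), tmul_mem_tens ht ((mem_leftK_zero hs).2 ⟨1, rfl⟩),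
        barAug_one_tmul_one hs' hR t⟩
    · rintro _ ⟨u, hu, rfl⟩
      refine map_mem_of_mem_tens (barAug hs' hR) _ ?_ hu
      intro t ht n _
      rw [barAug_tmul]
      exact Submodule.smul_mem _ _ ht
  · intro u hu h0
    cases j with
    | succ j =>
      rw [hX] at hu
      exact exists_coeffD_eq hs' hR hu.1 h0
    | zero =>
      obtain ⟨x, hx, rfl⟩ := mem_barTerm_zero.1 hu
      obtain ⟨a, ha, rfl⟩ := (exists_leftD_one_iff hs x).1 hx
      refine exists_coeffD_eq_one_iff.2 ?_
      have h1 := smul_mem_augSMul (⟨a, ha⟩ : aug R)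
        ((mem_leftK_zero (R := R) (s := s) hs).2 ⟨1, rfl⟩)
      rwa [TensorProduct.smul_tmul', smul_eq_mul, mul_one] at h1

theorem barKills_leftB_succ (hs : 2 ≤ s) (hR : R ≤ tpow k V s) (m i j : ℕ) :
    BarKills hR m (leftB R s i) (j + 1) ↔
      BarKills hR m (leftK R s (i + 1) ⊓ LinearMap.ker (leftD R s (i + 1))) j :=
  barKills_shift (by omega) hR (leftD_π hR (i + 1))
    (fun _ hx hx' h0 => eq_zero_of_leftD_eq_zero hs hR hx hx' h0) m j

theorem leftExact_iff (hs : 2 ≤ s) (hR : R ≤ tpow k V s) (i : ℕ) :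
    LeftExact R s (i + 1) ↔
      leftB R s (i + 1) = leftK R s (i + 1) ⊓ LinearMap.ker (leftD R s (i + 1)) := by
  constructor
  · intro h
    apply le_antisymm
    · rintro _ ⟨y, hy, rfl⟩
      exact ⟨leftD_mem hs hy, leftD_leftD hs hR hy⟩
    · rintro x ⟨hx, hx0⟩
      exact h x hx hx0
  · intro h x hx hx0
    have h1 : x ∈ leftB R s (i + 1) := by
      rw [h]
      exact ⟨hx, hx0⟩
    exact h1

/-- Each shift trades `B_i` for the cycles of the next term, and exactness identifies these with
`B_{i+1}`; iteration gives `Tor_{j+i+1}(k, k) = Tor_j(k, B_i)`. -/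
theorem killsHomology_iff_barKills (hs : 2 ≤ s) (hR : R ≤ tpow k V s) {i : ℕ}
    (h : ∀ j < i, LeftExact R s (j + 1)) (m j : ℕ) :
    KillsHomology ((barGr hR).π m) (barD R) (tpow k (aug R)) (j + i + 1) ↔
      BarKills hR m (leftB R s i) j := by
  induction i generalizing j with
  | zero => exact barKills_leftB_zero hs hR m j
  | succ i ih =>
    rw [show j + (i + 1) + 1 = j + 1 + i + 1 by omega, ih fun j hj => h j (by omega),
      barKills_leftB_succ hs hR, (leftExact_iff hs hR i).1 (h i (by omega))]

/-- The inductive step of graded Nakayama: the degree `m` component of an element of `A_+ K`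
involves only elements of `K` of degree less than `m`. -/
theorem leftGr_π_mem_of_mem_augSMul (hR : R ≤ tpow k V s)
    {K : Submodule (Alg R) (Alg R ⊗[k] TensorAlgebra k V)}
    (hK : ∀ m, ∀ x ∈ K, (leftGr hR).π m x ∈ K)
    {B : Submodule (Alg R) (Alg R ⊗[k] TensorAlgebra k V)} {m : ℕ}
    (hB : ∀ j < m, ∀ x ∈ K, (leftGr hR).π j x = x → x ∈ B)
    {x : Alg R ⊗[k] TensorAlgebra k V} (hx : x ∈ augSMul K) : (leftGr hR).π m x ∈ B := by
  suffices h : augSMul K ≤ (B.restrictScalars k).comap ((leftGr hR).π m) from h hx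
  refine Submodule.span_le.2 ?_
  rintro _ ⟨a, n, hn, rfl⟩
  rw [SetLike.mem_coe, Submodule.mem_comap, Submodule.restrictScalars_mem]
  induction a using (augGr hR).induction with
  | zero => rw [Submodule.coe_zero, zero_smul, map_zero]; exact zero_mem _
  | add x y hx hy =>
    rw [Submodule.coe_add, add_smul, map_add]
    exact add_mem hx hy
  | hom p a ha =>
    have h1 := leftGr_smul hR ((augGr_eq_iff hR).1 ha) m n
    rw [Algebra.lsmul_coe] at h1
    change (leftGr hR).π m ((fun x => (a : Alg R) • x) n) ∈ B
    rw [h1]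
    split_ifs with hp
    -- Multiplication by `a` raises the degree strictly, as `A_+` has no nonzero element of degree
    -- zero.
    · rcases Nat.eq_zero_or_pos p with rfl | hp'
      · have ha0 : (a : Alg R) = 0 := by
          rw [← (mem_gr_iff hR).1 ((augGr_eq_iff hR).1 ha)]
          exact (mem_aug_iff hR).1 a.2
        change (a : Alg R) • _ ∈ B
        rw [ha0, zero_smul]
        exact zero_mem _
      · exact B.smul_mem _ (hB (m - p) (by omega) _ (hK _ _ hn) ((leftGr hR).idem _ _))
    · exact zero_mem _

/-- `Tor_{i+2}(k, k)` is `K / A_+ K` for the module `K` of cycles. Off degree `n(i+2)` every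
component of a cycle thus lies in `A_+ K`, hence is a boundary by induction on the degree; in degree
`n(i+2)` it is one by `exists_leftD_eq_of_degree`. -/
theorem leftExact_succ_of_torConcentrated (hs : 2 ≤ s) (hR : R ≤ tpow k V s) {i : ℕ}
    (hi : ∀ j < i, LeftExact R s (j + 1))
    (h : TorConcentrated R (i + 2) (koszulDegree s (i + 2))) : LeftExact R s (i + 1) := by
  set K := leftK R s (i + 1) ⊓ LinearMap.ker (leftD R s (i + 1)) with hKdef
  have h1 : ∀ m, m ≠ koszulDegree s (i + 2) → ∀ x ∈ K, (leftGr hR).π m x ∈ augSMul K := by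
    intro m hm
    have h2 := (torConcentrated_iff (by omega) hR _ _).1 h m hm
    rw [show i + 2 = 1 + i + 1 by omega, killsHomology_iff_barKills hs hR hi,
      ← zero_add 1, barKills_leftB_succ hs hR] at h2
    exact (barKills_zero_iff hR).1 h2
  have hK : ∀ m, ∀ x ∈ K, (leftGr hR).π m x ∈ K := by
    rintro m x ⟨hx, hx0⟩
    refine ⟨leftGr_π_mem hR m hx, ?_⟩
    rw [SetLike.mem_coe, LinearMap.mem_ker] at hx0 ⊢
    rw [leftD_π, hx0, map_zero]
  have h3 : ∀ m, ∀ x ∈ K, (leftGr hR).π m x = x → x ∈ leftB R s (i + 1) := by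
    intro m
    induction m using Nat.strong_induction_on with
    | _ m ih =>
      intro x hx hx'
      rcases eq_or_ne m (koszulDegree s (i + 2)) with rfl | hm
      · exact exists_leftD_eq_of_degree hs hR (fun h2 => hi 1 (by omega)) hx.1 hx' hx.2
      · rw [← hx']
        refine leftGr_π_mem_of_mem_augSMul hR hK ih ?_
        rw [← hx']
        exact h1 m hm x hx
  intro x hx hx0
  have hxK : x ∈ K := ⟨hx, hx0⟩
  exact (leftGr hR).mem_of_π_mem ((leftB R s (i + 1)).restrictScalars k)
    fun m => h3 m _ (hK m x hxK) ((leftGr hR).idem m x)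

theorem torConcentrated_zero : TorConcentrated R 0 0 := by
  rintro m hm x ⟨hx, -⟩
  rw [barPiece, if_neg hm] at hx
  rw [(Submodule.mem_bot k).1 hx]
  exact zero_mem _

/-- `Tor_{i+1}(k, k)` is `B_i / A_+ B_i`, and `B_i` is the image of a module generated in degree
`n(i+1)`. -/
theorem torConcentrated_of_leftExact (hs : 2 ≤ s) (hR : R ≤ tpow k V s) {i : ℕ}
    (hi : ∀ j < i, LeftExact R s (j + 1)) :
    TorConcentrated R (i + 1) (koszulDegree s (i + 1)) := by
  rw [torConcentrated_iff (by omega) hR]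
  intro m hm
  rw [show i + 1 = 0 + i + 1 by omega, killsHomology_iff_barKills hs hR hi, barKills_zero_iff]
  rintro _ ⟨y, hy, rfl⟩
  rw [← leftD_π]
  exact map_mem_augSMul _ (leftGr_π_mem_augSMul hR hm hy)

/-- An `s`-homogeneous algebra is Koszul if and only if its left Koszul complex is exact in positive
degrees. -/
theorem isKoszul_iff_leftExact (hs : 2 ≤ s) (hR : R ≤ tpow k V s) :
    IsKoszul R s ↔ ∀ i, LeftExact R s (i + 1) := by
  constructor
  · intro h i
    induction i using Nat.strong_induction_on with
    -- Exactness at the term `i + 1` is governed by `Tor_{i+2}`.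
    | _ i ih => exact leftExact_succ_of_torConcentrated hs hR ih (h (i + 2))
  · intro h i
    cases i with
    | zero =>
      rw [koszulDegree_zero]
      exact torConcentrated_zero
    | succ i => exact torConcentrated_of_leftExact hs hR fun j _ => h j

theorem isLeftKoszulResolution_iff (hs : 2 ≤ s) (hR : R ≤ tpow k V s) :
    IsLeftKoszulResolution R s ↔ ∀ i, LeftExact R s (i + 1) := by
  constructor
  · intro h i
    exact (leftExact_iff hs hR i).2 (h.exact_succ i)
  · intro h
    exact ⟨exists_leftD_one_iff hs, fun i => (leftExact_iff hs hR i).1 (h i)⟩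

end Koszul

/-! ### The bimodule Koszul complex -/

section Bimodule

variable {k : Type u} [Field k] {V : Type v} [AddCommGroup V] [Module k V]
variable {R : Submodule k (TensorAlgebra k V)} {s : ℕ}

/-! ### The bimodule `A ⊗ T(V) ⊗ A` -/

variable (R) in
/-- The isomorphism that moves the right factor of `A ⊗ T(V) ⊗ A` to the end. -/
noncomputable def bimodEquiv : (Alg R ⊗[k] TensorAlgebra k V) ⊗[k] Alg R ≃ₗ[k] Bimod R :=
  (TensorProduct.congr (LinearEquiv.refl k _) (MulOpposite.opLinearEquiv k) ≪≫ₗ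
    TensorProduct.rightComm k (Alg R) (TensorAlgebra k V) (Alg R)ᵐᵒᵖ :
      (Alg R ⊗[k] TensorAlgebra k V) ⊗[k] Alg R ≃ₗ[k]
        (Alg R ⊗[k] (Alg R)ᵐᵒᵖ) ⊗[k] TensorAlgebra k V)

theorem bimodEquiv_tmul (a b : Alg R) (t : TensorAlgebra k V) :
    bimodEquiv R ((a ⊗ₜ t) ⊗ₜ b) = env R a b ⊗ₜ t := rfl

/-- The sub-bimodule `A ⊗ P ⊗ B` of `A ⊗ T(V) ⊗ A`. -/
noncomputable def bimodSub (P : Submodule k (TensorAlgebra k V)) (B : Submodule k (Alg R)) :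
    Submodule k (Bimod R) :=
  (tens ((P.baseChange (Alg R)).restrictScalars k) B).map (bimodEquiv R).toLinearMap

theorem env_tmul_mem_bimodSub {P : Submodule k (TensorAlgebra k V)} {B : Submodule k (Alg R)}
    (a : Alg R) {b : Alg R} {t : TensorAlgebra k V} (ht : t ∈ P) (hb : b ∈ B) :
    env R a b ⊗ₜ t ∈ bimodSub P B :=
  ⟨(a ⊗ₜ t) ⊗ₜ b, tmul_mem_tens (Submodule.tmul_mem_baseChange_of_mem a ht) hb, rfl⟩

theorem map_mem_of_mem_bimodSub {L : Type x} [AddCommGroup L] [Module k L]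
    {P : Submodule k (TensorAlgebra k V)} {B : Submodule k (Alg R)} (F : Bimod R →ₗ[k] L)
    (S : Submodule k L) (h : ∀ a, ∀ t ∈ P, ∀ b ∈ B, F (env R a b ⊗ₜ t) ∈ S) {x : Bimod R}
    (hx : x ∈ bimodSub P B) : F x ∈ S := by
  obtain ⟨z, hz, rfl⟩ := hx
  refine map_mem_of_mem_tens (F ∘ₗ (bimodEquiv R).toLinearMap) S ?_ hz
  intro y hy b hb
  have hy' : y ∈ tens (⊤ : Submodule k (Alg R)) P := mem_baseChange_iff.1 hy
  exact map_mem_of_mem_tens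
    (F ∘ₗ (bimodEquiv R).toLinearMap ∘ₗ (TensorProduct.mk k _ (Alg R)).flip b) S
    (fun a _ t ht => h a t ht b hb) hy'

theorem env_induction {p : Env R → Prop} (zero : p 0) (add : ∀ x y, p x → p y → p (x + y))
    (env : ∀ a b, p (env R a b)) (x : Env R) : p x := by
  change Alg R ⊗[k] (Alg R)ᵐᵒᵖ at x
  induction x using TensorProduct.induction_on with
  | zero => exact zero
  | add x y hx hy => exact add x y hx hy
  | tmul a b => exact env a (unop b)

theorem bimod_induction {p : Bimod R → Prop} (zero : p 0) (add : ∀ x y, p x → p y → p (x + y))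
    (tmul : ∀ a b t, p (env R a b ⊗ₜ t)) (x : Bimod R) : p x := by
  induction x using TensorProduct.induction_on with
  | zero => exact zero
  | add x y hx hy => exact add x y hx hy
  | tmul e t =>
    induction e using env_induction with
    | zero => rw [TensorProduct.zero_tmul]; exact zero
    | add x y hx hy => rw [TensorProduct.add_tmul]; exact add _ _ hx hy
    | env a b => exact tmul a b t

theorem env_zero_left (b : Alg R) : env R 0 b = 0 := TensorProduct.zero_tmul _ _

theorem env_zero_right (a : Alg R) : env R a 0 = 0 := TensorProduct.tmul_zero _ _

theorem env_add_left (a a' b : Alg R) : env R (a + a') b = env R a b + env R a' b :=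
  TensorProduct.add_tmul _ _ _

theorem env_add_right (a b b' : Alg R) : env R a (b + b') = env R a b + env R a b' :=
  TensorProduct.tmul_add _ _ _

theorem env_mul_env (a b a' b' : Alg R) : env R a b * env R a' b' = env R (a * a') (b' * b) := by
  have h : (a ⊗ₜ[k] op b : Alg R ⊗[k] (Alg R)ᵐᵒᵖ) * (a' ⊗ₜ[k] op b') =
    (a * a') ⊗ₜ[k] op (b' * b) := by simp
  exact h

theorem env_smul_env_tmul (a b a' b' : Alg R) (t : TensorAlgebra k V) :
    env R a b • (env R a' b' ⊗ₜ[k] t : Bimod R) = env R (a * a') (b' * b) ⊗ₜ t := by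
  rw [TensorProduct.smul_tmul', smul_eq_mul, env_mul_env]

theorem bimod_hom_induction (hR : R ≤ tpow k V s) {p : Bimod R → Prop} (zero : p 0)
    (add : ∀ x y, p x → p y → p (x + y))
    (hom : ∀ i j n, ∀ a ∈ gr R i, ∀ b ∈ gr R j, ∀ t ∈ tpow k V n, p (env R a b ⊗ₜ t))
    (x : Bimod R) : p x := by
  induction x using bimod_induction with
  | zero => exact zero
  | add x y hx hy => exact add x y hx hy
  | tmul a b t =>
    induction a using (algGr hR).induction with
    | zero => rw [env_zero_left, TensorProduct.zero_tmul]; exact zero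
    | add x y hx hy => rw [env_add_left, TensorProduct.add_tmul]; exact add _ _ hx hy
    | hom i a ha =>
      induction b using (algGr hR).induction with
      | zero => rw [env_zero_right, TensorProduct.zero_tmul]; exact zero
      | add x y hx hy => rw [env_add_right, TensorProduct.add_tmul]; exact add _ _ hx hy
      | hom j b hb =>
        induction t using tpow_induction with
        | zero => rw [TensorProduct.tmul_zero]; exact zero
        | add x y hx hy => rw [TensorProduct.tmul_add]; exact add _ _ hx hy
        | hom n t ht => exact hom i j n a ((mem_gr_iff hR).2 ha) b ((mem_gr_iff hR).2 hb) t ht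

theorem mem_baseChange_env_iff {P : Submodule k (TensorAlgebra k V)} {x : Bimod R} :
    x ∈ P.baseChange (Env R) ↔ x ∈ bimodSub P (⊤ : Submodule k (Alg R)) := by
  rw [mem_baseChange_iff]
  constructor
  · intro hx
    refine map_mem_of_mem_tens LinearMap.id _ ?_ hx
    intro e _ t ht
    rw [LinearMap.id_apply]
    induction e using env_induction with
    | zero => rw [TensorProduct.zero_tmul]; exact zero_mem _
    | add x y hx hy => rw [TensorProduct.add_tmul]; exact add_mem (hx trivial) (hy trivial)
    | env a b => exact env_tmul_mem_bimodSub a ht trivial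
  · intro hx
    exact map_mem_of_mem_bimodSub LinearMap.id _ (fun a t ht b _ =>
      tmul_mem_tens (Submodule.mem_top (x := env R a b)) ht) hx

theorem bimodSub_mono {P : Submodule k (TensorAlgebra k V)} {B B' : Submodule k (Alg R)}
    (h : B ≤ B') : bimodSub P B ≤ bimodSub P B' :=
  Submodule.map_mono (tens_mono le_rfl h)

/-! ### The maps `δ'_L` and `δ'_R` -/

theorem δL_tmul (e : Env R) (v : V) (t : TensorAlgebra k V) :
    δL R (e ⊗ₜ[k] (TensorAlgebra.ι k v * t)) = (e * envLeft R (gen R v)) ⊗ₜ[k] t := by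
  simp [δL, extend_tmul, head_ι_mul, TensorProduct.smul_tmul']

theorem δR_tmul (e : Env R) (v : V) (t : TensorAlgebra k V) :
    δR R (e ⊗ₜ[k] (t * TensorAlgebra.ι k v)) = (e * envRight R (op (gen R v))) ⊗ₜ[k] t := by
  simp [δR, extend_tmul, tail_mul_ι, TensorProduct.smul_tmul']

/-- On words with at least two letters the maps act at opposite ends. The empty word and single
letters are treated apart: both composites vanish there. -/
theorem δL_δR (x : Bimod R) : δL R (δR R x) = δR R (δL R x) := by
  induction x using bimod_induction with
  | zero => simp
  | add x y hx hy => simp only [LinearMap.map_add, hx, hy]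
  | tmul a b t =>
    induction t using word_induction with
    | one => rw [δR_apply_one, δL_apply_one, map_zero, map_zero]
    | smul c t ht => simp only [TensorProduct.tmul_smul, LinearMap.map_smul_of_tower, ht]
    | add s t hs ht => simp only [TensorProduct.tmul_add, LinearMap.map_add, hs, ht]
    | ι_mul v t ih =>
      clear ih
      induction t using word_induction_right with
      | one =>
        have h1 := δL_apply R a b v 1
        have h2 := δR_apply R a b v 1
        rw [one_mul] at h2
        rw [h1, mul_one, h2, δL_apply_one, δR_apply_one]
      | smul c t ht =>
        simp only [mul_smul_comm, TensorProduct.tmul_smul, LinearMap.map_smul_of_tower, ht]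
      | add s t hs ht => simp only [mul_add, TensorProduct.tmul_add, LinearMap.map_add, hs, ht]
      | mul_ι w t _ => rw [← mul_assoc, δR_apply, mul_assoc, δL_apply, δL_apply, δR_apply]

theorem commute_δL_δR : Commute (δL R) (δR R) := LinearMap.ext δL_δR

theorem δL_pow_mul {r : ℕ} {w : TensorAlgebra k V} (hw : w ∈ tpow k V r) (e : Env R)
    (t : TensorAlgebra k V) :
    (δL R ^ r) (e ⊗ₜ[k] (w * t)) = (e * envLeft R (proj R w)) ⊗ₜ[k] t := by
  induction r generalizing w e with
  | zero =>
    rw [tpow_zero, Submodule.mem_one] at hw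
    obtain ⟨c, rfl⟩ := hw
    rw [pow_zero, Module.End.one_apply, AlgHom.commutes, AlgHom.commutes, ← Algebra.smul_def,
      ← Algebra.commutes, ← Algebra.smul_def, TensorProduct.smul_tmul]
  | succ r ih =>
    rw [add_comm, tpow_add, tpow_one] at hw
    refine Submodule.mul_induction_on
      (C := fun w => (δL R ^ (r + 1)) (e ⊗ₜ[k] (w * t)) = (e * envLeft R (proj R w)) ⊗ₜ[k] t)
      hw ?_ ?_
    · rintro _ ⟨v, rfl⟩ w hw
      rw [pow_succ, Module.End.mul_apply, mul_assoc, δL_tmul, ih hw, map_mul, map_mul, mul_assoc]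
      rfl
    · intro x y hx hy
      rw [add_mul, TensorProduct.tmul_add, LinearMap.map_add, hx, hy, map_add, map_add, mul_add,
        TensorProduct.add_tmul]

theorem δR_pow_mul {r : ℕ} {w : TensorAlgebra k V} (hw : w ∈ tpow k V r) (e : Env R)
    (t : TensorAlgebra k V) :
    (δR R ^ r) (e ⊗ₜ[k] (t * w)) = (e * envRight R (op (proj R w))) ⊗ₜ[k] t := by
  induction r generalizing w e with
  | zero =>
    rw [tpow_zero, Submodule.mem_one] at hw
    obtain ⟨c, rfl⟩ := hw
    have h1 : op (algebraMap k (Alg R) c) = algebraMap k (Alg R)ᵐᵒᵖ c := rfl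
    rw [pow_zero, Module.End.one_apply, AlgHom.commutes, h1, AlgHom.commutes, ← Algebra.commutes,
      ← Algebra.commutes, ← Algebra.smul_def, ← Algebra.smul_def, TensorProduct.smul_tmul]
  | succ r ih =>
    rw [tpow_add, tpow_one] at hw
    refine Submodule.mul_induction_on
      (C := fun w => (δR R ^ (r + 1)) (e ⊗ₜ[k] (t * w)) =
        (e * envRight R (op (proj R w))) ⊗ₜ[k] t) hw ?_ ?_
    · rintro w hw _ ⟨v, rfl⟩
      rw [pow_succ, Module.End.mul_apply, ← mul_assoc, δR_tmul, ih hw, map_mul,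
        MulOpposite.op_mul, map_mul, mul_assoc]
      rfl
    · intro x y hx hy
      rw [mul_add, TensorProduct.tmul_add, LinearMap.map_add, hx, hy, map_add, MulOpposite.op_add,
        map_add, mul_add, TensorProduct.add_tmul]

/-- The hypothesis that `B` is stable under multiplication by letters from the left. -/
def LetterStable (B : Submodule k (Alg R)) : Prop := ∀ v, ∀ b ∈ B, gen R v * b ∈ B

theorem δL_mem_bimodSub {B : Submodule k (Alg R)} {n : ℕ} {x : Bimod R}
    (hx : x ∈ bimodSub (J R s (n + 1)) B) : δL R x ∈ bimodSub (J R s n) B := by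
  refine map_mem_of_mem_bimodSub ((δL R).restrictScalars k) _ ?_ hx
  intro a t ht b hb
  have h := J_succ_le n ht
  rw [tpow_one] at h
  refine Submodule.mul_induction_on (C := fun t =>
    (δL R).restrictScalars k (env R a b ⊗ₜ[k] t) ∈ bimodSub (J R s n) B) h ?_ ?_
  · rintro _ ⟨v, rfl⟩ u hu
    rw [LinearMap.restrictScalars_apply, δL_apply]
    exact env_tmul_mem_bimodSub _ hu hb
  · intro x y hx hy
    rw [TensorProduct.tmul_add, LinearMap.map_add]
    exact add_mem hx hy

/-- A letter enters the right factor from the left, so `B` has to be stable under letters; `δ_L`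
does not touch `B`. -/
theorem δR_mem_bimodSub {B : Submodule k (Alg R)} (hB : LetterStable B) {n : ℕ} {x : Bimod R}
    (hx : x ∈ bimodSub (J R s (n + 1)) B) : δR R x ∈ bimodSub (J R s n) B := by
  refine map_mem_of_mem_bimodSub ((δR R).restrictScalars k) _ ?_ hx
  intro a t ht b hb
  have h := J_succ_le' n ht
  rw [tpow_one] at h
  refine Submodule.mul_induction_on (C := fun t =>
    (δR R).restrictScalars k (env R a b ⊗ₜ[k] t) ∈ bimodSub (J R s n) B) h ?_ ?_
  · rintro u hu _ ⟨v, rfl⟩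
    rw [LinearMap.restrictScalars_apply, δR_apply]
    exact env_tmul_mem_bimodSub _ hu (hB v b hb)
  · intro x y hx hy
    rw [TensorProduct.tmul_add, LinearMap.map_add]
    exact add_mem hx hy

theorem δL_pow_mem_bimodSub {B : Submodule k (Alg R)} {r n : ℕ} {x : Bimod R}
    (hx : x ∈ bimodSub (J R s (r + n)) B) : (δL R ^ r) x ∈ bimodSub (J R s n) B := by
  induction r generalizing x with
  | zero => simpa using hx
  | succ r ih =>
    rw [pow_succ, Module.End.mul_apply]
    refine ih (δL_mem_bimodSub ?_)
    rwa [show r + n + 1 = r + 1 + n by omega]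

theorem δR_pow_mem_bimodSub {B : Submodule k (Alg R)} (hB : LetterStable B) {r n : ℕ}
    {x : Bimod R} (hx : x ∈ bimodSub (J R s (r + n)) B) : (δR R ^ r) x ∈ bimodSub (J R s n) B := by
  induction r generalizing x with
  | zero => simpa using hx
  | succ r ih =>
    rw [pow_succ, Module.End.mul_apply]
    refine ih (δR_mem_bimodSub hB ?_)
    rwa [show r + n + 1 = r + 1 + n by omega]

theorem δL_pow_eq_zero (hR : R ≤ tpow k V s) {n : ℕ} (hn : s ≤ n) {x : Bimod R}
    (hx : x ∈ bimodSub (J R s n) ⊤) : (δL R ^ s) x = 0 := by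
  refine (Submodule.mem_bot k).1
    (map_mem_of_mem_bimodSub ((δL R ^ s).restrictScalars k) ⊥ ?_ hx)
  intro a t ht b _
  refine Submodule.mul_induction_on
    (C := fun t => (δL R ^ s).restrictScalars k (env R a b ⊗ₜ[k] t) ∈ (⊥ : Submodule k _))
    (J_le_mul_right hn ht) ?_ ?_
  · intro r hr u _
    rw [LinearMap.restrictScalars_apply, δL_pow_mul (hR hr), proj_mem R hr, map_zero, mul_zero,
      TensorProduct.zero_tmul]
    exact zero_mem _
  · intro x y hx hy
    rw [TensorProduct.tmul_add, LinearMap.map_add]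
    exact add_mem hx hy

theorem δR_pow_eq_zero (hR : R ≤ tpow k V s) {n : ℕ} (hn : s ≤ n) {x : Bimod R}
    (hx : x ∈ bimodSub (J R s n) ⊤) : (δR R ^ s) x = 0 := by
  refine (Submodule.mem_bot k).1
    (map_mem_of_mem_bimodSub ((δR R ^ s).restrictScalars k) ⊥ ?_ hx)
  intro a t ht b _
  refine Submodule.mul_induction_on
    (C := fun t => (δR R ^ s).restrictScalars k (env R a b ⊗ₜ[k] t) ∈ (⊥ : Submodule k _))
    (J_le_mul_left hn ht) ?_ ?_
  · intro u _ r hr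
    rw [LinearMap.restrictScalars_apply, δR_pow_mul (hR hr), proj_mem R hr, MulOpposite.op_zero,
      map_zero, mul_zero, TensorProduct.zero_tmul]
    exact zero_mem _
  · intro x y hx hy
    rw [TensorProduct.tmul_add, LinearMap.map_add]
    exact add_mem hx hy

/-! ### The differentials -/

theorem bimodD_of_odd {i : ℕ} (hi : Odd i) : bimodD R s i = δL R - δR R := if_pos hi

theorem bimodD_of_not_odd {i : ℕ} (hi : ¬ Odd i) :
    bimodD R s i = ∑ j ∈ Finset.range s, δL R ^ (s - 1 - j) * δR R ^ j := if_neg hi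

/-- A property of operators that is shared by the `δ_L^a δ_R^b` with `a + b = r` is shared by the
differential. -/
theorem bimodD_apply_mem (hs : 2 ≤ s) (i : ℕ) (S : Submodule k (Bimod R)) (x : Bimod R)
    (h : ∀ a b, a + b = koszulStep s i → (δL R ^ a) ((δR R ^ b) x) ∈ S) :
    bimodD R s i x ∈ S := by
  unfold koszulStep at h
  by_cases hi : Odd i
  · rw [if_pos hi] at h
    rw [bimodD_of_odd hi, LinearMap.sub_apply]
    refine sub_mem ?_ ?_
    · simpa using h 1 0 rfl
    · simpa using h 0 1 rfl
  · rw [if_neg hi] at h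
    rw [bimodD_of_not_odd hi, LinearMap.sum_apply]
    refine Submodule.sum_mem _ fun j hj => ?_
    have := Finset.mem_range.1 hj
    exact h _ _ (by omega)

theorem bimodD_mem_bimodSub (hs : 2 ≤ s) {B : Submodule k (Alg R)} (hB : LetterStable B) {i : ℕ}
    {x : Bimod R} (hx : x ∈ bimodSub (J R s (koszulDegree s (i + 1))) B) :
    bimodD R s (i + 1) x ∈ bimodSub (J R s (koszulDegree s i)) B := by
  refine bimodD_apply_mem hs _ _ _ fun a b hab => ?_
  rw [koszulDegree_succ hs, ← hab, add_comm a b, add_assoc] at hx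
  exact δL_pow_mem_bimodSub (δR_pow_mem_bimodSub hB hx)

/-- For commuting operators, `(x - y) ∑ x^{s-1-j} y^j = x^s - y^s`. Both powers vanish on `A ⊗ J_n ⊗
A` if `n ≥ s`, whence `d'd' = 0`. -/
theorem bimodD_mul_bimodD (i : ℕ) :
    bimodD R s i * bimodD R s (i + 1) = δL R ^ s - δR R ^ s := by
  have hc : Commute (δL R) (δR R) := commute_δL_δR
  have h1 : ∑ j ∈ Finset.range s, δL R ^ (s - 1 - j) * δR R ^ j =
      ∑ j ∈ Finset.range s, δR R ^ j * δL R ^ (s - 1 - j) :=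
    Finset.sum_congr rfl fun j _ => (hc.pow_pow _ _).eq
  have h2 : (δL R - δR R) * ∑ j ∈ Finset.range s, δL R ^ (s - 1 - j) * δR R ^ j =
      δL R ^ s - δR R ^ s := by
    rw [h1, hc.symm.mul_neg_geom_sum₂]
  rcases Nat.even_or_odd i with hi | hi
  · rw [bimodD_of_not_odd (Nat.not_odd_iff_even.2 hi), bimodD_of_odd hi.add_one, ← h2]
    refine (Commute.sum_left _ _ _ fun j _ => ?_).eq
    refine Commute.mul_left ?_ ?_
    · exact ((Commute.refl _).sub_right hc).pow_left _
    · exact (hc.symm.sub_right (Commute.refl _)).pow_left _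
  · rw [bimodD_of_odd hi, bimodD_of_not_odd (Nat.not_odd_iff_even.2 hi.add_one), h2]

theorem letterStable_top : LetterStable (⊤ : Submodule k (Alg R)) := fun _ _ _ => trivial

theorem mem_bimodK_iff {i : ℕ} {x : Bimod R} :
    x ∈ bimodK R s i ↔ x ∈ bimodSub (J R s (koszulDegree s i)) (⊤ : Submodule k (Alg R)) :=
  mem_baseChange_env_iff

theorem bimodD_mem (hs : 2 ≤ s) {i : ℕ} {x : Bimod R} (hx : x ∈ bimodK R s (i + 1)) :
    bimodD R s (i + 1) x ∈ bimodK R s i := by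
  rw [mem_bimodK_iff] at hx ⊢
  exact bimodD_mem_bimodSub hs letterStable_top hx

theorem bimodD_bimodD (hR : R ≤ tpow k V s) {i : ℕ} {x : Bimod R}
    (hx : x ∈ bimodK R s (i + 2)) : bimodD R s (i + 1) (bimodD R s (i + 2) x) = 0 := by
  rw [mem_bimodK_iff] at hx
  rw [← Module.End.mul_apply, bimodD_mul_bimodD, LinearMap.sub_apply,
    δL_pow_eq_zero hR (le_koszulDegree i) hx, δR_pow_eq_zero hR (le_koszulDegree i) hx, sub_zero]

end Bimodule

/-! ### Grading and augmentation of the bimodule Koszul complex -/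

section BimoduleGrading

variable {k : Type u} [Field k] {V : Type v} [AddCommGroup V] [Module k V]
variable {R : Submodule k (TensorAlgebra k V)} {s : ℕ}

/-- The grading of `A ⊗ T(V) ⊗ A` by the total degree. -/
noncomputable def bimodGrading (hR : R ≤ tpow k V s) : Grading k (Bimod R) :=
  ((leftGr hR).tensor (algGr hR)).ofEquiv (bimodEquiv R)

theorem bimodGrading_hom (hR : R ≤ tpow k V s) {i j n : ℕ} {a b : Alg R} {t : TensorAlgebra k V}
    (ha : a ∈ gr R i) (hb : b ∈ gr R j) (ht : t ∈ tpow k V n) :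
    (bimodGrading hR).π (i + n + j) (env R a b ⊗ₜ t) = env R a b ⊗ₜ t := by
  rw [← bimodEquiv_tmul, bimodGrading, Grading.ofEquiv_apply,
    Grading.tensor_tmul_hom _ _ (leftGr_tmul hR ha ht) ((mem_gr_iff hR).1 hb)]

theorem env_tmul_mem_bimodGr {i j n : ℕ} {a b : Alg R} {t : TensorAlgebra k V}
    (ha : a ∈ gr R i) (hb : b ∈ gr R j) (ht : t ∈ tpow k V n) :
    env R a b ⊗ₜ t ∈ bimodGr R (i + n + j) :=
  Submodule.subset_span ⟨i, n, j, rfl, a, ha, t, ht, b, hb, rfl⟩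

theorem mem_bimodGr_iff (hR : R ≤ tpow k V s) {m : ℕ} {x : Bimod R} :
    x ∈ bimodGr R m ↔ (bimodGrading hR).π m x = x := by
  constructor
  · intro hx
    suffices h : bimodGr R m ≤ LinearMap.ker ((bimodGrading hR).π m - LinearMap.id) from
      sub_eq_zero.1 (h hx)
    refine Submodule.span_le.2 ?_
    rintro _ ⟨i, n, j, rfl, a, ha, t, ht, b, hb, rfl⟩
    rw [SetLike.mem_coe, LinearMap.mem_ker, LinearMap.sub_apply, bimodGrading_hom hR ha hb ht,
      LinearMap.id_apply, sub_self]
  · intro hx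
    rw [← hx]
    clear hx
    induction x using bimod_hom_induction hR with
    | zero => rw [map_zero]; exact zero_mem _
    | add x y hx hy => rw [map_add]; exact add_mem hx hy
    | hom i j n a ha b hb t ht =>
      rw [(bimodGrading hR).π_eq_ite (bimodGrading_hom hR ha hb ht)]
      split_ifs with h
      · rw [h]
        exact env_tmul_mem_bimodGr ha hb ht
      · exact zero_mem _

theorem bimodGrading_π_mem (hR : R ≤ tpow k V s) {i : ℕ} (m : ℕ) {x : Bimod R}
    (hx : x ∈ bimodK R s i) : (bimodGrading hR).π m x ∈ bimodK R s i := by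
  rw [mem_bimodK_iff] at hx ⊢
  obtain ⟨z, hz, rfl⟩ := hx
  rw [LinearEquiv.coe_coe, bimodGrading, Grading.ofEquiv_apply]
  refine Submodule.mem_map_of_mem (f := (bimodEquiv R).toLinearMap) ?_
  refine map_mem_of_mem_tens (((leftGr hR).tensor (algGr hR)).π m) _ ?_ hz
  intro y hy b _
  rw [Grading.tensor_tmul]
  exact Submodule.sum_mem _ fun q _ => tmul_mem_tens (leftGr_π_mem hR q.1 hy) trivial

theorem δL_mem_bimodGr {m : ℕ} {x : Bimod R} (hx : x ∈ bimodGr R m) : δL R x ∈ bimodGr R m := by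
  suffices h : bimodGr R m ≤ (bimodGr R m).comap ((δL R).restrictScalars k) from h hx
  refine Submodule.span_le.2 ?_
  rintro _ ⟨i, n, j, rfl, a, ha, t, ht, b, hb, rfl⟩
  rw [SetLike.mem_coe, Submodule.mem_comap, LinearMap.restrictScalars_apply]
  cases n with
  | zero =>
    rw [tpow_zero, Submodule.mem_one] at ht
    obtain ⟨c, rfl⟩ := ht
    rw [Algebra.algebraMap_eq_smul_one, ← TensorProduct.smul_tmul, δL_apply_one]
    exact zero_mem _
  | succ n =>
    rw [add_comm n, tpow_add, tpow_one] at ht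
    refine Submodule.mul_induction_on
      (C := fun t => δL R (env R a b ⊗ₜ t) ∈ bimodGr R (i + (n + 1) + j)) ht ?_ ?_
    · rintro _ ⟨v, rfl⟩ t ht
      rw [δL_apply]
      have h := env_tmul_mem_bimodGr (mul_mem_gr ha (proj_mem_gr (ι_mem_tpow v))) hb ht
      rwa [show i + 1 + n + j = i + (n + 1) + j by omega] at h
    · intro x y hx hy
      rw [TensorProduct.tmul_add, LinearMap.map_add]
      exact add_mem hx hy

theorem δR_mem_bimodGr {m : ℕ} {x : Bimod R} (hx : x ∈ bimodGr R m) : δR R x ∈ bimodGr R m := by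
  suffices h : bimodGr R m ≤ (bimodGr R m).comap ((δR R).restrictScalars k) from h hx
  refine Submodule.span_le.2 ?_
  rintro _ ⟨i, n, j, rfl, a, ha, t, ht, b, hb, rfl⟩
  rw [SetLike.mem_coe, Submodule.mem_comap, LinearMap.restrictScalars_apply]
  cases n with
  | zero =>
    rw [tpow_zero, Submodule.mem_one] at ht
    obtain ⟨c, rfl⟩ := ht
    rw [Algebra.algebraMap_eq_smul_one, ← TensorProduct.smul_tmul, δR_apply_one]
    exact zero_mem _
  | succ n =>
    rw [tpow_add, tpow_one] at ht
    refine Submodule.mul_induction_on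
      (C := fun t => δR R (env R a b ⊗ₜ t) ∈ bimodGr R (i + (n + 1) + j)) ht ?_ ?_
    · rintro t ht _ ⟨v, rfl⟩
      rw [δR_apply]
      have h := env_tmul_mem_bimodGr ha (mul_mem_gr (proj_mem_gr (ι_mem_tpow v)) hb) ht
      rwa [show i + n + (1 + j) = i + (n + 1) + j by omega] at h
    · intro x y hx hy
      rw [TensorProduct.tmul_add, LinearMap.map_add]
      exact add_mem hx hy

theorem bimodD_mem_bimodGr (hs : 2 ≤ s) (i : ℕ) {m : ℕ} {x : Bimod R} (hx : x ∈ bimodGr R m) :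
    bimodD R s i x ∈ bimodGr R m := by
  refine bimodD_apply_mem hs i _ x fun a b hab => ?_
  clear hab
  have h1 : ∀ b, (δR R ^ b) x ∈ bimodGr R m := by
    intro b
    induction b with
    | zero => exact hx
    | succ b ih => rw [pow_succ', Module.End.mul_apply]; exact δR_mem_bimodGr ih
  induction a with
  | zero => exact h1 b
  | succ a ih => rw [pow_succ', Module.End.mul_apply]; exact δL_mem_bimodGr ih

/-! ### The augmentation -/

theorem bimodAug_tmul (a b : Alg R) (t : TensorAlgebra k V) :
    bimodAug R (env R a b ⊗ₜ t) = TensorAlgebra.algebraMapInv (R := k) t • (a * b) := by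
  simp [bimodAug, envToAlg_env]

theorem bimodAug_smul (a b : Alg R) (x : Bimod R) :
    bimodAug R (env R a b • x) = a * bimodAug R x * b := by
  induction x using bimod_induction with
  | zero => simp
  | add x y hx hy => rw [smul_add, map_add, map_add, hx, hy, mul_add, add_mul]
  | tmul a' b' t =>
    rw [env_smul_env_tmul, bimodAug_tmul, bimodAug_tmul, mul_smul_comm, smul_mul_assoc]
    simp only [mul_assoc]

theorem bimodAug_mem_gr {m : ℕ} {x : Bimod R} (hx : x ∈ bimodGr R m) :
    bimodAug R x ∈ gr R m := by
  suffices h : bimodGr R m ≤ (gr R m).comap (bimodAug R) from h hx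
  refine Submodule.span_le.2 ?_
  rintro _ ⟨i, n, j, rfl, a, ha, t, ht, b, hb, rfl⟩
  rw [SetLike.mem_coe, Submodule.mem_comap, bimodAug_tmul]
  rcases eq_or_ne n 0 with rfl | hn
  · exact Submodule.smul_mem _ _ (mul_mem_gr ha hb)
  · rw [algebraMapInv_of_mem_tpow hn ht, zero_smul]
    exact zero_mem _

theorem bimodD_one_tmul (s : ℕ) (a b : Alg R) (v : V) :
    bimodD R s 1 (env R a b ⊗ₜ TensorAlgebra.ι k v) =
      env R (a * gen R v) b ⊗ₜ 1 - env R a (gen R v * b) ⊗ₜ 1 := by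
  have h1 := δL_apply R a b v 1
  have h2 := δR_apply R a b v 1
  rw [mul_one] at h1
  rw [one_mul] at h2
  rw [bimodD_of_odd (by decide), LinearMap.sub_apply, h1, h2]

theorem J_one (hs : 2 ≤ s) : J R s (koszulDegree s 1) = LinearMap.range (TensorAlgebra.ι k) := by
  rw [koszulDegree_one, J_of_lt (by omega), tpow_one]

theorem J_zero (hs : 2 ≤ s) : J R s (koszulDegree s 0) = 1 := by
  rw [koszulDegree_zero, J_of_lt (by omega), tpow_zero]

theorem bimodAug_bimodD (hs : 2 ≤ s) {x : Bimod R} (hx : x ∈ bimodK R s 1) :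
    bimodAug R (bimodD R s 1 x) = 0 := by
  rw [mem_bimodK_iff, J_one hs] at hx
  refine (Submodule.mem_bot k).1
    (map_mem_of_mem_bimodSub (bimodAug R ∘ₗ (bimodD R s 1).restrictScalars k) ⊥ ?_ hx)
  rintro a _ ⟨v, rfl⟩ b _
  rw [Submodule.mem_bot, LinearMap.comp_apply, LinearMap.restrictScalars_apply, bimodD_one_tmul,
    map_sub, bimodAug_tmul, bimodAug_tmul, mul_assoc, sub_self]

theorem env_tmul_one_mem_bimodK_zero (hs : 2 ≤ s) (a b : Alg R) :
    env R a b ⊗ₜ 1 ∈ bimodK R s 0 := by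
  rw [mem_bimodK_iff, J_zero hs]
  exact env_tmul_mem_bimodSub a (Submodule.one_le.1 le_rfl) trivial

theorem exists_bimodAug_eq (hs : 2 ≤ s) (a : Alg R) : ∃ x ∈ bimodK R s 0, bimodAug R x = a :=
  ⟨env R a 1 ⊗ₜ 1, env_tmul_one_mem_bimodK_zero hs a 1, by simp [bimodAug_tmul]⟩

/-- Modulo the image of `d'_1`, letters pass one by one from the left factor to the right factor, so
`a ⊗ 1 ⊗ b` is congruent to `1 ⊗ 1 ⊗ ab`. Hence every `x` is congruent to `1 ⊗ 1 ⊗ μ(x)`, where `μ`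
is the augmentation. -/
theorem bimodAug_eq_zero_iff (hs : 2 ≤ s) {x : Bimod R} (hx : x ∈ bimodK R s 0) :
    bimodAug R x = 0 ↔ ∃ y ∈ bimodK R s 1, bimodD R s 1 y = x := by
  constructor
  · intro h0
    let F : Alg R →ₗ[k] Bimod R := (bimodEquiv R).toLinearMap ∘ₗ TensorProduct.mk k _ _ (1 ⊗ₜ 1)
    have hF : ∀ b, F b = env R 1 b ⊗ₜ 1 := fun _ => rfl
    have h1 : ∀ a b : Alg R, env R a b ⊗ₜ 1 - F (a * b) ∈
        ((bimodK R s 1).map (bimodD R s 1)).restrictScalars k := by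
      intro a b
      obtain ⟨t, rfl⟩ := proj_surjective R a
      induction t using word_induction_right generalizing b with
      | one =>
        rw [map_one, one_mul, hF, sub_self]
        exact zero_mem _
      | smul c t ht =>
        have h2 : env R (proj R (c • t)) b = c • env R (proj R t) b := by
          rw [map_smul]
          exact (TensorProduct.smul_tmul' _ _ _).symm
        have h3 : F (proj R (c • t) * b) = c • F (proj R t * b) := by
          rw [map_smul, smul_mul_assoc, map_smul]
        rw [h2, h3, ← TensorProduct.smul_tmul', ← smul_sub]
        exact Submodule.smul_mem _ c (ht b)
      | add t u ht hu =>
        rw [map_add, env_add_left, TensorProduct.add_tmul, add_mul, map_add, add_sub_add_comm]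
        exact add_mem (ht b) (hu b)
      | mul_ι v t ht =>
        have h2 := ht (gen R v * b)
        have h3 : bimodD R s 1 (env R (proj R t) b ⊗ₜ TensorAlgebra.ι k v) ∈
            ((bimodK R s 1).map (bimodD R s 1)).restrictScalars k := by
          refine ⟨_, ?_, rfl⟩
          rw [SetLike.mem_coe, mem_bimodK_iff, J_one hs]
          exact env_tmul_mem_bimodSub _ ⟨v, rfl⟩ trivial
        rw [bimodD_one_tmul] at h3
        -- Telescoping: the boundary moves the letter `v` across, and the induction hypothesis for
        -- `v b` moves the rest of the word.
        have h4 := add_mem h3 h2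
        rwa [sub_add_sub_cancel, ← mul_assoc, gen_apply, ← map_mul] at h4
    have h2 : (LinearMap.id - F ∘ₗ bimodAug R : Module.End k (Bimod R)) x ∈
        ((bimodK R s 1).map (bimodD R s 1)).restrictScalars k := by
      rw [mem_bimodK_iff, J_zero hs] at hx
      refine map_mem_of_mem_bimodSub _ _ ?_ hx
      intro a t ht b _
      rw [Submodule.mem_one] at ht
      obtain ⟨c, rfl⟩ := ht
      have h3 := Submodule.smul_mem _ c (h1 a b)
      rw [LinearMap.sub_apply, LinearMap.comp_apply, LinearMap.id_apply, bimodAug_apply, map_smul,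
        Algebra.algebraMap_eq_smul_one, TensorProduct.tmul_smul, ← smul_sub]
      exact h3
    rw [LinearMap.sub_apply, LinearMap.comp_apply, h0, map_zero, sub_zero, LinearMap.id_apply] at h2
    exact h2
  · rintro ⟨y, hy, rfl⟩
    exact bimodAug_bimodD hs hy

/-- The augmented bimodule Koszul complex is a complex of projective graded bimodules. -/
theorem isPureProjectiveComplex (hs : 2 ≤ s) (hR : R ≤ tpow k V s) :
    IsPureProjectiveComplex R s where
  alg_isInternal := (algGr hR).isInternal (f := LinearMap.id) Function.injective_id
    (fun i a => ⟨(algGr hR).π i a, rfl⟩) _ fun i a => mem_gr_iff hR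
  isInternal i := (bimodGrading hR).isInternal Subtype.val_injective
    (fun m x => ⟨⟨_, bimodGrading_π_mem hR m x.2⟩, rfl⟩) _ fun m x => mem_bimodGr_iff hR
  smul_mem p q m a ha b hb x hx := by
    suffices h : bimodGr R m ≤
        (bimodGr R (p + m + q)).comap (Algebra.lsmul k k (Bimod R) (env R a b)) from h hx
    refine Submodule.span_le.2 ?_
    rintro _ ⟨i, n, j, rfl, a', ha', t, ht, b', hb', rfl⟩
    rw [SetLike.mem_coe, Submodule.mem_comap, Algebra.lsmul_coe]
    change env R a b • (env R a' b' ⊗ₜ[k] t : Bimod R) ∈ _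
    rw [env_smul_env_tmul]
    have h := env_tmul_mem_bimodGr (mul_mem_gr ha ha') (mul_mem_gr hb' hb) ht
    rwa [show p + i + n + (j + q) = p + (i + n + j) + q by omega] at h
  -- The term is the base change of the vector space `J_{n(i)}` to the enveloping algebra.
  projective i := Module.Projective.of_equiv
    (Submodule.toBaseChange.toLinearEquiv (Env R) (J R s (koszulDegree s i)))
  pure i := by
    apply le_antisymm
    · exact Submodule.span_le.2 fun x hx => hx.1
    · intro x hx
      rw [bimodK, Submodule.baseChange_eq_span] at hx
      refine Submodule.span_mono ?_ hx
      rintro _ ⟨t, ht, rfl⟩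
      refine ⟨Submodule.tmul_mem_baseChange_of_mem 1 ht, ?_⟩
      have h1 : (1 : Alg R) ∈ gr R 0 := by
        simpa using proj_mem_gr (R := R) one_mem_tpow
      have h := env_tmul_mem_bimodGr h1 h1 (J_le_tpow _ ht)
      rwa [zero_add, add_zero] at h
  map_le i := by
    rintro _ ⟨x, hx, rfl⟩
    exact bimodD_mem hs hx
  map_gr i m x _ hx := bimodD_mem_bimodGr hs (i + 1) hx
  comp_eq_zero i x hx := bimodD_bimodD hR hx
  aug_smul := bimodAug_smul
  aug_gr m x hx := bimodAug_mem_gr hx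
  aug_comp_eq_zero x hx := bimodAug_bimodD hs hx

end BimoduleGrading

/-! ### Comparison of the left complex and the bimodule complex -/

section BimoduleExact

variable {k : Type u} [Field k] {V : Type v} [AddCommGroup V] [Module k V]
variable {R : Submodule k (TensorAlgebra k V)} {s : ℕ}

/-- The grading of `A ⊗ T(V) ⊗ A` in which the right factor has degree `0`. -/
noncomputable def bimodLeftGr (hR : R ≤ tpow k V s) : Grading k (Bimod R) :=
  ((leftGr hR).tensor (Grading.pure 0)).ofEquiv (bimodEquiv R)

theorem bimodLeftGr_tmul (hR : R ≤ tpow k V s) (m : ℕ) (x : Alg R ⊗[k] TensorAlgebra k V)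
    (b : Alg R) : (bimodLeftGr hR).π m (bimodEquiv R (x ⊗ₜ b)) =
      bimodEquiv R ((leftGr hR).π m x ⊗ₜ b) := by
  rw [bimodLeftGr, Grading.ofEquiv_apply]
  have h : (Grading.pure 0 : Grading k (Alg R)).π 0 b = b := by rw [Grading.pure_π, if_pos rfl]
  have h1 := (leftGr hR).tensor_tmul_right _ h m x
  rw [add_zero] at h1
  rw [h1]

theorem bimodLeftGr_hom (hR : R ≤ tpow k V s) {i n : ℕ} {a : Alg R} {t : TensorAlgebra k V}
    (ha : a ∈ gr R i) (ht : t ∈ tpow k V n) (b : Alg R) :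
    (bimodLeftGr hR).π (i + n) (env R a b ⊗ₜ t) = env R a b ⊗ₜ t := by
  rw [← bimodEquiv_tmul, bimodLeftGr_tmul, leftGr_tmul hR ha ht]

theorem bimodLeftGr_mem (hR : R ≤ tpow k V s) {B : Submodule k (Alg R)} {n : ℕ} (m : ℕ)
    {x : Bimod R} (hx : x ∈ bimodSub (J R s n) B) :
    (bimodLeftGr hR).π m x ∈ bimodSub (J R s n) B := by
  obtain ⟨z, hz, rfl⟩ := hx
  refine map_mem_of_mem_tens ((bimodLeftGr hR).π m ∘ₗ (bimodEquiv R).toLinearMap) _ ?_ hz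
  intro y hy b hb
  rw [LinearMap.comp_apply, LinearEquiv.coe_coe, bimodLeftGr_tmul]
  exact ⟨_, tmul_mem_tens (leftGr_π_mem hR m hy) hb, rfl⟩

theorem δL_bimodEquiv (x : Alg R ⊗[k] TensorAlgebra k V) (b : Alg R) :
    δL R (bimodEquiv R (x ⊗ₜ b)) = bimodEquiv R (leftδ R x ⊗ₜ b) := by
  induction x with
  | zero => simp
  | add x y hx hy => simp only [TensorProduct.add_tmul, LinearEquiv.map_add, LinearMap.map_add,
      hx, hy]
  | tmul a t =>
    rw [bimodEquiv_tmul]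
    induction t using word_induction with
    | one => rw [δL_apply_one, leftδ_apply_one, TensorProduct.zero_tmul, map_zero]
    | smul c t ht =>
      rw [TensorProduct.tmul_smul, LinearMap.map_smul_of_tower, ht, TensorProduct.tmul_smul,
        LinearMap.map_smul_of_tower, ← TensorProduct.smul_tmul', map_smul]
    | add t u ht hu =>
      rw [TensorProduct.tmul_add, LinearMap.map_add, ht, hu, TensorProduct.tmul_add,
        LinearMap.map_add, TensorProduct.add_tmul, map_add]
    | ι_mul v t _ => rw [δL_apply, leftδ_apply, bimodEquiv_tmul]

theorem δL_pow_bimodEquiv (r : ℕ) (x : Alg R ⊗[k] TensorAlgebra k V) (b : Alg R) :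
    (δL R ^ r) (bimodEquiv R (x ⊗ₜ b)) = bimodEquiv R ((leftδ R ^ r) x ⊗ₜ b) := by
  induction r with
  | zero => rfl
  | succ r ih => rw [pow_succ', Module.End.mul_apply, ih, δL_bimodEquiv, pow_succ',
      Module.End.mul_apply]

theorem δL_pow_bimodEquiv_apply (r : ℕ) (z : (Alg R ⊗[k] TensorAlgebra k V) ⊗[k] Alg R) :
    (δL R ^ r) (bimodEquiv R z) =
      bimodEquiv R ((((leftδ R ^ r).restrictScalars k).rTensor (Alg R)) z) := by
  induction z using TensorProduct.induction_on with
  | zero => simp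
  | add x y hx hy => simp only [LinearEquiv.map_add, LinearMap.map_add, hx, hy]
  | tmul x b => exact δL_pow_bimodEquiv r x b

theorem δL_bimodLeftGr (hR : R ≤ tpow k V s) (m : ℕ) (x : Bimod R) :
    δL R ((bimodLeftGr hR).π m x) = (bimodLeftGr hR).π m (δL R x) := by
  obtain ⟨z, rfl⟩ := (bimodEquiv R).surjective x
  induction z using TensorProduct.induction_on with
  | zero => simp
  | add x y hx hy => simp only [LinearEquiv.map_add, LinearMap.map_add, hx, hy]
  | tmul x b => rw [bimodLeftGr_tmul, δL_bimodEquiv, δL_bimodEquiv, bimodLeftGr_tmul, leftδ_π]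

theorem δL_pow_bimodLeftGr (hR : R ≤ tpow k V s) (r m : ℕ) (x : Bimod R) :
    (δL R ^ r) ((bimodLeftGr hR).π m x) = (bimodLeftGr hR).π m ((δL R ^ r) x) := by
  induction r with
  | zero => rfl
  | succ r ih => rw [pow_succ', Module.End.mul_apply, ih, δL_bimodLeftGr, Module.End.mul_apply]

/-- `δ_R` takes one letter away from the first two factors, while `δ_L` moves letters between them.
Thus only the pure power of `δ_L` contributes to the leading part of the differential. -/
theorem δR_bimodLeftGr (hR : R ≤ tpow k V s) (m : ℕ) (x : Bimod R) :
    δR R ((bimodLeftGr hR).π (m + 1) x) = (bimodLeftGr hR).π m (δR R x) := by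
  induction x using bimod_hom_induction hR with
  | zero => simp
  | add x y hx hy => simp only [LinearMap.map_add, hx, hy]
  | hom i j n a ha b _ t ht =>
    rw [(bimodLeftGr hR).π_eq_ite (bimodLeftGr_hom hR ha ht b)]
    cases n with
    | zero =>
      rw [tpow_zero, Submodule.mem_one] at ht
      obtain ⟨c, rfl⟩ := ht
      rw [Algebra.algebraMap_eq_smul_one, ← TensorProduct.smul_tmul, δR_apply_one, map_zero]
      split_ifs
      · exact δR_apply_one _ _
      · exact map_zero _
    | succ n =>
      rw [tpow_add, tpow_one] at ht
      refine Submodule.mul_induction_on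
        (C := fun t => δR R (if m + 1 = i + (n + 1) then env R a b ⊗ₜ[k] t else 0) =
          (bimodLeftGr hR).π m (δR R (env R a b ⊗ₜ t))) ht ?_ ?_
      · rintro t ht _ ⟨v, rfl⟩
        rw [δR_apply, (bimodLeftGr hR).π_eq_ite (bimodLeftGr_hom hR ha ht _)]
        by_cases h : m = i + n
        · rw [if_pos (by omega), if_pos h, δR_apply]
        · rw [if_neg (by omega), if_neg h, map_zero]
      · intro x y hx hy
        rw [TensorProduct.tmul_add, LinearMap.map_add, LinearMap.map_add, ← hx, ← hy]
        split_ifs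
        · exact LinearMap.map_add _ _ _
        · rw [map_zero, add_zero]

/-- The part of `A ⊗ T(V) ⊗ A` in which the first two factors have degree less than `M`. -/
noncomputable def bimodLow (hR : R ≤ tpow k V s) (M : ℕ) : Submodule k (Bimod R) :=
  ⨅ (m : ℕ) (_ : M ≤ m), LinearMap.ker ((bimodLeftGr hR).π m)

theorem mem_bimodLow (hR : R ≤ tpow k V s) {M : ℕ} {x : Bimod R} :
    x ∈ bimodLow hR M ↔ ∀ m, M ≤ m → (bimodLeftGr hR).π m x = 0 := by
  simp [bimodLow, Submodule.mem_iInf]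

theorem δL_pow_mem_bimodLow (hR : R ≤ tpow k V s) {M : ℕ} (r : ℕ) {x : Bimod R}
    (hx : x ∈ bimodLow hR M) : (δL R ^ r) x ∈ bimodLow hR M := by
  rw [mem_bimodLow] at hx ⊢
  intro m hm
  rw [← δL_pow_bimodLeftGr, hx m hm, map_zero]

theorem δR_pow_mem_bimodLow (hR : R ≤ tpow k V s) {M : ℕ} (r : ℕ) {x : Bimod R}
    (hx : x ∈ bimodLow hR (M + 1)) : (δR R ^ (r + 1)) x ∈ bimodLow hR M := by
  have h1 : ∀ M, ∀ x ∈ bimodLow hR (M + 1), δR R x ∈ bimodLow hR M := by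
    intro M x hx
    rw [mem_bimodLow] at hx ⊢
    intro m hm
    rw [← δR_bimodLeftGr, hx _ (by omega), map_zero]
  induction r with
  | zero => rw [zero_add, pow_one]; exact h1 M x hx
  | succ r ih =>
    rw [pow_succ', Module.End.mul_apply]
    refine h1 M _ ?_
    rw [mem_bimodLow] at ih ⊢
    exact fun m hm => ih m (by omega)

/-- The leading part of the differential. -/
theorem bimodD_sub_mem_bimodLow (hs : 2 ≤ s) (hR : R ≤ tpow k V s) (i : ℕ) {M : ℕ} {x : Bimod R}
    (hx : x ∈ bimodLow hR (M + 1)) :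
    bimodD R s i x - (δL R ^ koszulStep s i) x ∈ bimodLow hR M := by
  unfold koszulStep
  by_cases hi : Odd i
  · rw [if_pos hi, bimodD_of_odd hi, LinearMap.sub_apply, pow_one, sub_sub_cancel_left]
    have := δR_pow_mem_bimodLow hR 0 hx
    rw [zero_add, pow_one] at this
    exact neg_mem this
  · rw [if_neg hi, bimodD_of_not_odd hi, LinearMap.sum_apply]
    obtain ⟨r, rfl⟩ := Nat.exists_eq_add_of_le' (show 1 ≤ s by omega)
    -- Only the summand `j = 0` contains no `δ_R`; it is the one that is subtracted.
    rw [Finset.sum_range_succ', pow_zero, mul_one, Nat.sub_zero, add_sub_cancel_right]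
    exact Submodule.sum_mem _ fun j _ => δL_pow_mem_bimodLow hR _ (δR_pow_mem_bimodLow hR j hx)

/-- If the left Koszul complex is exact at its `i`-th term, then so is every subcomplex
`A ⊗ J ⊗ B` of the bimodule Koszul complex. -/
theorem exists_bimodD_eq (hs : 2 ≤ s) (hR : R ≤ tpow k V s) {i : ℕ}
    (hi : LeftExact R s (i + 1)) {B : Submodule k (Alg R)} (hB : LetterStable B) {x : Bimod R}
    (hx : x ∈ bimodSub (J R s (koszulDegree s (i + 1))) B) (h0 : bimodD R s (i + 1) x = 0) :
    ∃ y ∈ bimodSub (J R s (koszulDegree s (i + 2))) B, bimodD R s (i + 2) y = x := by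
  suffices h : ∀ M, ∀ x ∈ bimodSub (J R s (koszulDegree s (i + 1))) B, x ∈ bimodLow hR M →
      bimodD R s (i + 1) x = 0 →
      ∃ y ∈ bimodSub (J R s (koszulDegree s (i + 2))) B, bimodD R s (i + 2) y = x by
    obtain ⟨M, hM⟩ := (bimodLeftGr hR).exists_π_eq_zero x
    exact h M x hx ((mem_bimodLow hR).2 hM) h0
  clear hx h0 x
  intro M
  induction M with
  | zero =>
    intro x _ hx' _
    have hx0 : x = 0 := by
      refine (Submodule.mem_bot k).1 ((bimodLeftGr hR).mem_of_π_mem ⊥ fun m => ?_)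
      exact (mem_bimodLow hR).1 hx' m (Nat.zero_le m)
    exact ⟨0, zero_mem _, by rw [map_zero, hx0]⟩
  | succ M ih =>
    intro x hx hlow h0
    have h1 := bimodD_sub_mem_bimodLow hs hR (i + 1) hlow
    rw [h0, zero_sub, mem_bimodLow] at h1
    -- The component of `x` in the top degree `M` is a cycle for the leading part of the
    -- differential, the left differential tensored with `B`.
    have h2 := h1 M le_rfl
    rw [map_neg, neg_eq_zero, ← δL_pow_bimodLeftGr] at h2
    obtain ⟨z, hz, hzx⟩ := bimodLeftGr_mem hR M hx
    rw [LinearEquiv.coe_coe] at hzx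
    rw [← hzx, δL_pow_bimodEquiv_apply, LinearEquiv.map_eq_zero_iff] at h2
    -- Left exactness at the term survives tensoring with the vector space `B`.
    have h3 : bimodEquiv R z ∈
        (bimodSub (J R s (koszulDegree s (i + 2))) B).map
          ((δL R ^ koszulStep s (i + 2)).restrictScalars k) := by
      refine map_mem_of_mem_tens (bimodEquiv R).toLinearMap _ ?_
        (mem_tens_of_rTensor_eq_zero _ hz h2)
      rintro y ⟨hy, hy0⟩ b hb
      obtain ⟨y', hy', rfl⟩ := hi y hy (by rw [leftD_eq]; exact hy0)
      refine ⟨bimodEquiv R (y' ⊗ₜ b), ⟨_, tmul_mem_tens hy' hb, rfl⟩, ?_⟩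
      rw [LinearMap.restrictScalars_apply, δL_pow_bimodEquiv, leftD_eq]
      rfl
    obtain ⟨y, hy, hyz⟩ := h3
    rw [LinearMap.restrictScalars_apply, hzx] at hyz
    -- Only the component of degree `M` is kept, so that the correction introduces nothing in higher
    -- degrees.
    set y' := (bimodLeftGr hR).π M y with hy'
    have hy'mem : y' ∈ bimodSub (J R s (koszulDegree s (i + 2))) B := bimodLeftGr_mem hR M hy
    have hy'low : y' ∈ bimodLow hR (M + 1) := by
      rw [mem_bimodLow]
      intro m hm
      rw [hy', Grading.orth, if_neg (by omega)]
    have h4 : (δL R ^ koszulStep s (i + 2)) y' = (bimodLeftGr hR).π M x := by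
      rw [hy', δL_pow_bimodLeftGr, hyz, Grading.idem]
    have h5 := bimodD_sub_mem_bimodLow hs hR (i + 2) hy'low
    have h6 : x - (bimodLeftGr hR).π M x ∈ bimodLow hR M := by
      rw [mem_bimodLow] at hlow ⊢
      intro m hm
      rw [map_sub, Grading.orth]
      rcases eq_or_ne m M with rfl | hne
      · rw [if_pos rfl, sub_self]
      · rw [if_neg hne, hlow m (by omega), sub_zero]
    -- The leading terms cancel, and the induction hypothesis applies to the rest, which is again a
    -- cycle in `A ⊗ J ⊗ B`.
    have h7 : x - bimodD R s (i + 2) y' ∈ bimodLow hR M := by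
      have := sub_mem h6 h5
      rwa [h4, sub_sub_sub_cancel_right] at this
    have hDy : bimodD R s (i + 2) y' ∈ bimodSub (J R s (koszulDegree s (i + 1))) B :=
      bimodD_mem_bimodSub hs hB hy'mem
    have hDD : bimodD R s (i + 1) (bimodD R s (i + 2) y') = 0 :=
      bimodD_bimodD hR (mem_bimodK_iff.2 (bimodSub_mono le_top hy'mem))
    obtain ⟨w, hw, hwx⟩ := ih _ (sub_mem hx hDy) h7 (by rw [LinearMap.map_sub, h0, hDD, sub_zero])
    exact ⟨w + y', add_mem hw hy'mem, by rw [LinearMap.map_add, hwx, sub_add_cancel]⟩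

/-- The bimodule Koszul complex is exact at its `i`-th term. -/
def BimodExact (R : Submodule k (TensorAlgebra k V)) (s i : ℕ) : Prop :=
  ∀ x ∈ bimodK R s i, bimodD R s i x = 0 → ∃ y ∈ bimodK R s (i + 1), bimodD R s (i + 1) y = x

theorem LeftExact.bimodExact (hs : 2 ≤ s) (hR : R ≤ tpow k V s) {i : ℕ}
    (hi : LeftExact R s (i + 1)) : BimodExact R s (i + 1) := by
  intro x hx h0
  obtain ⟨y, hy, hyx⟩ := exists_bimodD_eq hs hR hi letterStable_top (mem_bimodK_iff.1 hx) h0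
  exact ⟨y, mem_bimodK_iff.2 hy, hyx⟩

/-! ### Reduction of the bimodule complex to the left complex -/

/-- The map `A ⊗ T(V) ⊗ A → A ⊗ T(V)` that is induced by the augmentation of the right factor. -/
noncomputable def rightCounit (hs : s ≠ 0) (hR : R ≤ tpow k V s) :
    Bimod R →ₗ[k] Alg R ⊗[k] TensorAlgebra k V :=
  (TensorProduct.rid k _).toLinearMap ∘ₗ (counit hs hR).lTensor _ ∘ₗ
    (bimodEquiv R).symm.toLinearMap

theorem rightCounit_bimodEquiv (hs : s ≠ 0) (hR : R ≤ tpow k V s)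
    (x : Alg R ⊗[k] TensorAlgebra k V) (b : Alg R) :
    rightCounit hs hR (bimodEquiv R (x ⊗ₜ b)) = counit hs hR b • x := by
  simp [rightCounit]

theorem rightCounit_δL_pow (hs : s ≠ 0) (hR : R ≤ tpow k V s) (r : ℕ) (x : Bimod R) :
    rightCounit hs hR ((δL R ^ r) x) = (leftδ R ^ r) (rightCounit hs hR x) := by
  obtain ⟨z, rfl⟩ := (bimodEquiv R).surjective x
  induction z using TensorProduct.induction_on with
  | zero => simp
  | add x y hx hy => simp only [LinearEquiv.map_add, LinearMap.map_add, hx, hy]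
  | tmul x b => rw [δL_pow_bimodEquiv, rightCounit_bimodEquiv, rightCounit_bimodEquiv,
      LinearMap.map_smul_of_tower]

/-- After `δ_R` the right factor is a multiple of a letter, hence is killed by the augmentation. -/
theorem rightCounit_δR (hs : s ≠ 0) (hR : R ≤ tpow k V s) (x : Bimod R) :
    rightCounit hs hR (δR R x) = 0 := by
  induction x using bimod_induction with
  | zero => simp
  | add x y hx hy => rw [LinearMap.map_add, LinearMap.map_add, hx, hy, add_zero]
  | tmul a b t =>
    induction t using word_induction_right with
    | one => rw [δR_apply_one, map_zero]
    | smul c t ht => rw [TensorProduct.tmul_smul, LinearMap.map_smul_of_tower, map_smul, ht,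
        smul_zero]
    | add t u ht hu => rw [TensorProduct.tmul_add, LinearMap.map_add, LinearMap.map_add, ht, hu,
        add_zero]
    | mul_ι v t _ =>
      rw [δR_apply, ← bimodEquiv_tmul, rightCounit_bimodEquiv, counit_mul, gen_apply, counit_proj,
        algebraMapInv_ι, zero_mul, zero_smul]

/-- Tensoring the bimodule complex with `k` on the right gives the left complex: every summand that
contains `δ_R` dies. -/
theorem rightCounit_bimodD (hs : 2 ≤ s) (hs' : s ≠ 0) (hR : R ≤ tpow k V s) (i : ℕ)
    (x : Bimod R) :
    rightCounit hs' hR (bimodD R s i x) = leftD R s i (rightCounit hs' hR x) := by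
  rw [leftD_eq]
  unfold koszulStep
  by_cases hi : Odd i
  · rw [if_pos hi, bimodD_of_odd hi, LinearMap.sub_apply, map_sub, rightCounit_δR, sub_zero,
      ← rightCounit_δL_pow, pow_one]
  · rw [if_neg hi, bimodD_of_not_odd hi, LinearMap.sum_apply, map_sum,
      Finset.sum_eq_single_of_mem 0 (Finset.mem_range.2 (by omega))]
    · rw [pow_zero, mul_one, Nat.sub_zero, rightCounit_δL_pow]
    · intro j _ hj
      obtain ⟨l, rfl⟩ := Nat.exists_eq_succ_of_ne_zero hj
      rw [Module.End.mul_apply, rightCounit_δL_pow, pow_succ', Module.End.mul_apply,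
        rightCounit_δR, map_zero]

theorem letterStable_aug (hs : s ≠ 0) (hR : R ≤ tpow k V s) : LetterStable (aug R) := by
  intro v b hb
  rw [mem_aug_iff_counit hs hR] at hb ⊢
  rw [counit_mul, hb, mul_zero]

theorem rightCounit_mem (hs : s ≠ 0) (hR : R ≤ tpow k V s) {i : ℕ} {x : Bimod R}
    (hx : x ∈ bimodK R s i) : rightCounit hs hR x ∈ leftK R s i := by
  rw [mem_bimodK_iff] at hx
  refine map_mem_of_mem_bimodSub (rightCounit hs hR) ((leftK R s i).restrictScalars k) ?_ hx
  intro a t ht b _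
  rw [← bimodEquiv_tmul, rightCounit_bimodEquiv]
  exact Submodule.smul_mem _ _ (Submodule.tmul_mem_baseChange_of_mem a ht)

theorem rightCounit_eq_zero_iff (hs : s ≠ 0) (hR : R ≤ tpow k V s) {i : ℕ} {x : Bimod R}
    (hx : x ∈ bimodK R s i) :
    rightCounit hs hR x = 0 ↔ x ∈ bimodSub (J R s (koszulDegree s i)) (aug R) := by
  constructor
  · intro h0
    obtain ⟨z, hz, rfl⟩ := mem_bimodK_iff.1 hx
    have h1 : (counit hs hR).lTensor (Alg R ⊗[k] TensorAlgebra k V) z = 0 := by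
      refine (TensorProduct.rid k _).map_eq_zero_iff.1 ?_
      rw [← h0, rightCounit, LinearEquiv.coe_coe, LinearMap.comp_apply, LinearMap.comp_apply,
        LinearEquiv.coe_coe, LinearEquiv.coe_coe, LinearEquiv.symm_apply_apply]
    refine ⟨z, tens_mono le_rfl ?_ (mem_tens_of_lTensor_eq_zero _ hz h1), rfl⟩
    rintro b ⟨-, hb⟩
    exact (mem_aug_iff_counit hs hR).2 hb
  · intro h
    refine (Submodule.mem_bot k).1 (map_mem_of_mem_bimodSub (rightCounit hs hR) ⊥ ?_ h)
    intro a t _ b hb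
    rw [← bimodEquiv_tmul, rightCounit_bimodEquiv, (mem_aug_iff_counit hs hR).1 hb, zero_smul]
    exact zero_mem _

/-- A chase in `0 → A ⊗ J ⊗ A_+ → A ⊗ J ⊗ A → A ⊗ J → 0`. The kernel complex is exact at the term `i
+ 1` by `exists_bimodD_eq`, so a left cycle at the term `i + 2` lifts to a bimodule cycle; that one
is a boundary, and its preimage is pushed back to the left complex. -/
theorem LeftExact.succ (hs : 2 ≤ s) (hR : R ≤ tpow k V s) {i : ℕ} (hi : LeftExact R s (i + 1))
    (h : BimodExact R s (i + 2)) : LeftExact R s (i + 2) := by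
  have hs' : s ≠ 0 := by omega
  intro x hx h0
  set u := bimodEquiv R (x ⊗ₜ 1) with hu
  have huK : u ∈ bimodK R s (i + 2) := mem_bimodK_iff.2 ⟨_, tmul_mem_tens hx trivial, rfl⟩
  have hux : rightCounit hs' hR u = x := by rw [hu, rightCounit_bimodEquiv, counit_one, one_smul]
  have hDu := bimodD_mem hs huK
  have h1 : rightCounit hs' hR (bimodD R s (i + 2) u) = 0 := by
    rw [rightCounit_bimodD hs, hux, h0]
  -- The lift `x ⊗ 1` need not be a cycle, but its boundary is a cycle in `A ⊗ J ⊗ A_+`; the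
  -- correction `w` stays in that subcomplex and is invisible on the left.
  obtain ⟨w, hw, hwu⟩ := exists_bimodD_eq hs hR hi (letterStable_aug hs' hR)
    ((rightCounit_eq_zero_iff hs' hR hDu).1 h1) (bimodD_bimodD hR huK)
  have hwK : w ∈ bimodK R s (i + 2) := mem_bimodK_iff.2 (bimodSub_mono le_top hw)
  have hw0 := (rightCounit_eq_zero_iff hs' hR hwK).2 hw
  obtain ⟨y, hy, hyu⟩ := h (u - w) (sub_mem huK hwK) (by
    rw [LinearMap.map_sub, hwu, sub_self])
  refine ⟨rightCounit hs' hR y, rightCounit_mem hs' hR hy, ?_⟩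
  rw [← rightCounit_bimodD hs, hyu, LinearMap.map_sub, hux, hw0, sub_zero]

/-- The forward direction is termwise. The backward one needs left exactness at the preceding term,
so it is an induction that starts from `leftExact_one`. -/
theorem leftExact_iff_bimodExact (hs : 2 ≤ s) (hR : R ≤ tpow k V s) :
    (∀ i, LeftExact R s (i + 1)) ↔ ∀ i, BimodExact R s (i + 1) := by
  constructor
  · exact fun h i => (h i).bimodExact hs hR
  · intro h i
    induction i with
    | zero => exact leftExact_one hs hR
    | succ i ih => exact ih.succ hs hR (h (i + 1))

theorem bimodExact_iff (hR : R ≤ tpow k V s) (i : ℕ) : BimodExact R s (i + 1) ↔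
    ∀ x ∈ bimodK R s (i + 1), bimodD R s (i + 1) x = 0 ↔
      ∃ y ∈ bimodK R s (i + 2), bimodD R s (i + 2) y = x := by
  constructor
  · intro h x hx
    refine ⟨h x hx, ?_⟩
    rintro ⟨y, hy, rfl⟩
    exact bimodD_bimodD hR hy
  · exact fun h x hx => (h x hx).1

theorem isExactInLowDegrees (hs : 2 ≤ s) (hR : R ≤ tpow k V s) : IsExactInLowDegrees R s where
  surjective := exists_bimodAug_eq hs
  exact_zero _ hx := bimodAug_eq_zero_iff hs hx
  exact_one := (bimodExact_iff hR 0).1 ((leftExact_one hs hR).bimodExact hs hR)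

theorem isBimoduleKoszulResolution_iff (hs : 2 ≤ s) (hR : R ≤ tpow k V s) :
    IsBimoduleKoszulResolution R s ↔ ∀ i, LeftExact R s (i + 1) := by
  rw [leftExact_iff_bimodExact hs hR]
  constructor
  · exact fun h i => (bimodExact_iff hR i).2 (h.exact_succ i)
  · intro h
    exact
      { isPureProjectiveComplex hs hR with
        surjective := exists_bimodAug_eq hs
        exact_zero := fun _ hx => bimodAug_eq_zero_iff hs hx
        exact_succ := fun i => (bimodExact_iff hR i).1 (h i) }

end BimoduleExact

end HomogKoszul

theorem theorem5p6 {k : Type*} [Field k] {V : Type*} [AddCommGroup V] [Module k V]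
    (s : ℕ) (hs : 2 ≤ s)
    (R : Submodule k (TensorAlgebra k V)) (hR : R ≤ HomogKoszul.tpow k V s) :
    HomogKoszul.IsPureProjectiveComplex R s ∧
    HomogKoszul.IsExactInLowDegrees R s ∧
    (HomogKoszul.IsKoszul R s ↔ HomogKoszul.IsBimoduleKoszulResolution R s) ∧
    (HomogKoszul.IsLeftKoszulResolution R s ↔ HomogKoszul.IsBimoduleKoszulResolution R s) := by
  rw [HomogKoszul.isKoszul_iff_leftExact hs hR, HomogKoszul.isLeftKoszulResolution_iff hs hR,
    HomogKoszul.isBimoduleKoszulResolution_iff hs hR]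
  exact ⟨HomogKoszul.isPureProjectiveComplex hs hR, HomogKoszul.isExactInLowDegrees hs hR,
    Iff.rfl, Iff.rfl⟩
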